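/- Let $y_1<\dots<y_n$ be real points and $Y=\{y_1,\dots,y_n\}$. For a function $f$ write $\langle f\rangle_y=\frac12(f(y^-)+f(y^+))$ and $[f]_y=f(y^+)-f(y^-)$, and let $\sigma_1,\sigma_3$ be the Pauli matrices. Let $H^k(\mathbb R\setminus Y;\mathbb C^2)$ be the space of $\Psi\in L^2(\mathbb R;\mathbb C^2)$ whose distributional derivatives on $\mathbb R\setminus Y$ up to order $k$ are in $L^2$. For $\Psi\in H^1(\mathbb R\setminus Y;\mathbb C^2)$ put $\tau\Psi=(\langle\Psi\rangle_{y_k})_k$ and $\rho\Psi=(i\sigma_1[\Psi]_{y_k})_k$ in $\mathbb C^{2n}$; for scalar $\psi\in H^2(\mathbb R\setminus Y)$ put $\widehat\tau\psi=(\langle\psi\rangle_{y_k},\langle\psi'\rangle_{y_k})_k$ and $\widehat\rho\psi=([\psi']_{y_k},-[\psi]_{y_k})_k$ in $\mathbb C^{2n}$; for $\Psi\in H^2(\mathbb R\setminus Y;\mathbb C^2)$ let $\widehat\tau\mathbb 1,\widehat\rho\mathbb 1$ act on each of the two components, with values in $\mathbb C^{4n}$. A couple $(\Pi,\Theta)$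 in $\mathbb C^d$ consists of an orthogonal projector $\Pi$ in $\mathbb C^d$ and a symmetric operator $\Theta$ in $\mathrm{ran}(\Pi)$. For a couple $(\Pi,\Theta)$ in $\mathbb C^{2n}$, let $D_{\Pi,\Theta}$ be the operator $-i\sigma_1\frac{d}{dx}+\frac12\sigma_3$ on $\mathbb R\setminus Y$ with domain $\{\Psi\in H^1(\mathbb R\setminus Y;\mathbb C^2):\rho\Psi\in\mathrm{ran}(\Pi),\ \Pi\tau\Psi=\Theta\rho\Psi\}$. For a couple $(\widehat\Pi,\widehat\Theta)$ in $\mathbb C^{4n}$, let $\widehat H_{\widehat\Pi,\widehat\Theta}$ be the operator $-\frac{d^2}{dx^2}$ on $\mathbb R\setminus Y$ (on each component) with domain $\{\Psi\in H^2(\mathbb R\setminus Y;\mathbb C^2):(\widehat\rho\mathbb 1)\Psi\in\mathrm{ran}(\widehat\Pi),\ \widehat\Pi(\widehat\tau\mathbb 1)\Psi=\widehat\Theta(\widehat\rho\mathbb 1)\Psi\}$. Let $D$ and $H\mathbb 1$ be the free operators, with domains $H^1(\mathbb R;\mathbb C^2)$ and $H^2(\mathbb R;\mathbb C^2)$. Let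 $\widehat g_z(x)=\frac{e^{i\sqrt z|x|}}{2i\sqrt z}$, $\mathrm{Im}\sqrt z>0$, and $g_z=(D+z)\,\widehat g_{z^2-1/4}\mathbb 1$ be the kernels of $(-H+z)^{-1}=(\frac{d^2}{dx^2}+z)^{-1}$ and $(-D+z)^{-1}$, and $$[G_z\xi](x)=\sum_k g_z(x-y_k)\xi_k,\qquad [\widehat G_z\xi](x)=\sum_k\big(\widehat g_z(y_k-x)\,\xi_{k,1}+\widehat g_z'(y_k-x)\,\xi_{k,2}\big),\qquad \xi\in\mathbb C^{2n},$$ so that $G_z=(\tau(-D+\bar z)^{-1})^*$ and $\widehat G_z=(\widehat\tau(-H+\bar z)^{-1})^*$. Let $\sigma_{disc}$ be the set of isolated points of the spectrum $\sigma$ that are eigenvalues of finite multiplicity, $\sigma_{ess}=\sigma\setminus\sigma_{disc}$, and let $\varrho$ be the resolvent set. Then the following hold. 1. $\sigma_{ess}(D)=(-\infty,-\frac12]\cup[\frac12,\infty)$ and $\sigma_{ess}(H\mathbb 1)=[0,\infty)$. For every couple $(\Pi,\Theta)$ in $\mathbb C^{2n}$, $\sigma_{ess}(D_{\Pi,\Theta})=(-\infty,-\frac12]\cup[\frac12,\infty)$,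 and for every couple $(\widehat\Pi,\widehat\Theta)$ in $\mathbb C^{4n}$, $\sigma_{ess}(\widehat H_{\widehat\Pi,\widehat\Theta})=[0,\infty)$. 2. For every such couple, $$\lambda\in\sigma_{disc}(D_{\Pi,\Theta})\iff \lambda\in(-\tfrac12,\tfrac12)\ \text{ and }\ \det(\Theta-\Pi\,\tau G_\lambda\,\Pi)=0,$$ $$\lambda\in\sigma_{disc}(\widehat H_{\widehat\Pi,\widehat\Theta})\iff \lambda\in(-\infty,0)\ \text{ and }\ \det(\widehat\Theta-\widehat\Pi\,(\widehat\tau\widehat G_\lambda\mathbb 1)\,\widehat\Pi)=0,$$ where the determinants are those of operators in $\mathrm{ran}(\Pi)$ and $\mathrm{ran}(\widehat\Pi)$. 3. Suppose that $(\Pi,\Theta)$ and $(\widehat\Pi,\widehat\Theta)$ are such that $(D_{\Pi,\Theta})^2=\widehat H_{\widehat\Pi,\widehat\Theta}+\frac14$ (equality of operators, including domains). Then, for $z\in\mathbb C$: (a) both $z$ and $-z$ are in $\varrho(D_{\Pi,\Theta})$ if and only if $z^2-\frac14\in\varrho(\widehat H_{\widehat\Pi,\widehat\Theta})$; equivalently,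 at least one of $z,-z$ is in $\sigma(D_{\Pi,\Theta})$ if and only if $z^2-\frac14\in\sigma(\widehat H_{\widehat\Pi,\widehat\Theta})$; (b) whenever the resolvents exist, $(-D_{\Pi,\Theta}+z)^{-1}=(D_{\Pi,\Theta}+z)\big(-\widehat H_{\widehat\Pi,\widehat\Theta}+z^2-\frac14\big)^{-1}$; (c) for every real $\lambda\ge-\frac14$: $\lambda\in\sigma_{disc}(\widehat H_{\widehat\Pi,\widehat\Theta})\cap[-\frac14,0)$ if and only if at least one of $(\lambda+\frac14)^{1/2}$, $-(\lambda+\frac14)^{1/2}$ is in $\sigma_{disc}(D_{\Pi,\Theta})$. -/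

import Mathlib

open MeasureTheory Filter Topology
open scoped ContDiff

noncomputable section

namespace PointInteraction

/-! ### Unbounded operators in a complex Hilbert space -/

section Operators

variable {E : Type*} [NormedAddCommGroup E] [InnerProductSpace ℂ E]

/-- `R` is the (everywhere defined, bounded) resolvent operator `(-A + z)⁻¹`. -/
def IsResolventAt (A : E →ₗ.[ℂ] E) (z : ℂ) (R : E →L[ℂ] E) : Prop :=
  (∀ f : E, ∃ h : R f ∈ A.domain, z • R f - A ⟨R f, h⟩ = f) ∧
    ∀ u : A.domain, R (z • (u : E) - A u) = u

/-- The resolvent set `ϱ(A)`. -/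
def opResolventSet (A : E →ₗ.[ℂ] E) : Set ℂ := {z | ∃ R : E →L[ℂ] E, IsResolventAt A z R}

/-- The spectrum `σ(A)`. -/
def opSpectrum (A : E →ₗ.[ℂ] E) : Set ℂ := (opResolventSet A)ᶜ

/-- The eigenspace `ker (A - z)`, as a subspace of the domain of `A`. -/
def eigenspace (A : E →ₗ.[ℂ] E) (z : ℂ) : Submodule ℂ A.domain :=
  LinearMap.ker (A.toFun - z • A.domain.subtype)

/-- The discrete spectrum: isolated points of the spectrum that are eigenvalues of finite
multiplicity. -/
def discreteSpectrum (A : E →ₗ.[ℂ] E) : Set ℂ :=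
  {z | z ∈ opSpectrum A ∧ (∃ ε > 0, ∀ w ∈ opSpectrum A, dist w z < ε → w = z) ∧
    eigenspace A z ≠ ⊥ ∧ FiniteDimensional ℂ (eigenspace A z)}

/-- The essential spectrum: the complement of the discrete spectrum in the spectrum. -/
def essentialSpectrum (A : E →ₗ.[ℂ] E) : Set ℂ := opSpectrum A \ discreteSpectrum A

/-- The square `A²`, with domain `{u ∈ dom A : A u ∈ dom A}`. -/
def opSq (A : E →ₗ.[ℂ] E) : E →ₗ.[ℂ] E where
  domain :=
    { carrier := {u | ∃ h : u ∈ A.domain, A ⟨u, h⟩ ∈ A.domain}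
      add_mem' := by
        rintro u v ⟨hu, hu'⟩ ⟨hv, hv'⟩
        refine ⟨A.domain.add_mem hu hv, ?_⟩
        have : A ⟨u + v, A.domain.add_mem hu hv⟩ = A ⟨u, hu⟩ + A ⟨v, hv⟩ :=
          A.map_add ⟨u, hu⟩ ⟨v, hv⟩
        rw [this]
        exact A.domain.add_mem hu' hv'
      zero_mem' := by
        refine ⟨A.domain.zero_mem, ?_⟩
        have : A ⟨0, A.domain.zero_mem⟩ = 0 := A.map_zero
        rw [this]
        exact A.domain.zero_mem
      smul_mem' := by
        rintro c u ⟨hu, hu'⟩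
        refine ⟨A.domain.smul_mem c hu, ?_⟩
        have : A ⟨c • u, A.domain.smul_mem c hu⟩ = c • A ⟨u, hu⟩ := A.map_smul c ⟨u, hu⟩
        rw [this]
        exact A.domain.smul_mem c hu' }
  toFun :=
    { toFun := fun u => A ⟨A ⟨u, u.2.1⟩, u.2.2⟩
      map_add' := by
        intro u v
        have h : (⟨A ⟨(u : E) + v, (u + v).2.1⟩, (u + v).2.2⟩ : A.domain) =
            ⟨A ⟨u, u.2.1⟩, u.2.2⟩ + ⟨A ⟨v, v.2.1⟩, v.2.2⟩ :=
          Subtype.ext (A.map_add ⟨u, u.2.1⟩ ⟨v, v.2.1⟩)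
        exact (congrArg A h).trans (A.map_add _ _)
      map_smul' := by
        intro c u
        have h : (⟨A ⟨c • (u : E), (c • u).2.1⟩, (c • u).2.2⟩ : A.domain) =
            c • ⟨A ⟨u, u.2.1⟩, u.2.2⟩ :=
          Subtype.ext (A.map_smul c ⟨u, u.2.1⟩)
        exact (congrArg A h).trans (A.map_smul c _) }

/-- The operator `A + c`, with the domain of `A`. -/
def addConst (A : E →ₗ.[ℂ] E) (c : ℂ) : E →ₗ.[ℂ] E where
  domain := A.domain
  toFun := A.toFun + c • A.domain.subtype

end Operators

/-! ### Weak derivatives on `ℝ \ Y` and the maximal operators -/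

/-- The spinor space `ℂ²`. -/
abbrev C2 : Type := EuclideanSpace ℂ (Fin 2)

/-- The Hilbert space `L²(ℝ; ℂ²)`. -/
abbrev L2 : Type := Lp C2 2 (volume : Measure ℝ)

/-- `Φ ∈ L²` is the distributional derivative of `Ψ ∈ L²` on `ℝ \ Y`. -/
def HasWeakDeriv (Y : Set ℝ) (Ψ Φ : L2) : Prop :=
  ∀ φ : ℝ → ℝ, ContDiff ℝ ∞ φ → HasCompactSupport φ → tsupport φ ⊆ Yᶜ →
    ∫ x, deriv φ x • Ψ x = -∫ x, φ x • Φ x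

theorem integrable_smul_L2 {φ : ℝ → ℝ} (hφ : Continuous φ) (hc : HasCompactSupport φ) (Ψ : L2) :
    Integrable (fun x => φ x • Ψ x) volume :=
  ((Lp.memLp Ψ).locallyIntegrable (by norm_num)).integrable_smul_left_of_hasCompactSupport hφ hc

theorem HasWeakDeriv.add {Y : Set ℝ} {Ψ Φ Ψ' Φ' : L2} (h : HasWeakDeriv Y Ψ Φ)
    (h' : HasWeakDeriv Y Ψ' Φ') : HasWeakDeriv Y (Ψ + Ψ') (Φ + Φ') := by
  intro φ hφ hc hs
  have hd : Continuous (deriv φ) := hφ.continuous_deriv (by simp)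
  have e1 : ∫ x, deriv φ x • (Ψ + Ψ' : L2) x =
      ∫ x, (deriv φ x • Ψ x + deriv φ x • Ψ' x) := by
    refine integral_congr_ae ?_
    filter_upwards [Lp.coeFn_add Ψ Ψ'] with x hx
    rw [hx, Pi.add_apply, smul_add]
  have e2 : ∫ x, φ x • (Φ + Φ' : L2) x = ∫ x, (φ x • Φ x + φ x • Φ' x) := by
    refine integral_congr_ae ?_
    filter_upwards [Lp.coeFn_add Φ Φ'] with x hx
    rw [hx, Pi.add_apply, smul_add]
  rw [e1, e2, integral_add (integrable_smul_L2 hd hc.deriv Ψ) (integrable_smul_L2 hd hc.deriv Ψ'),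
    integral_add (integrable_smul_L2 hφ.continuous hc Φ) (integrable_smul_L2 hφ.continuous hc Φ'),
    h φ hφ hc hs, h' φ hφ hc hs, neg_add]

theorem HasWeakDeriv.smul {Y : Set ℝ} {Ψ Φ : L2} (c : ℂ) (h : HasWeakDeriv Y Ψ Φ) :
    HasWeakDeriv Y (c • Ψ) (c • Φ) := by
  intro φ hφ hc hs
  have e1 : ∫ x, deriv φ x • (c • Ψ : L2) x = ∫ x, c • deriv φ x • Ψ x := by
    refine integral_congr_ae ?_
    filter_upwards [Lp.coeFn_smul c Ψ] with x hx
    rw [hx, Pi.smul_apply, smul_comm]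
  have e2 : ∫ x, φ x • (c • Φ : L2) x = ∫ x, c • φ x • Φ x := by
    refine integral_congr_ae ?_
    filter_upwards [Lp.coeFn_smul c Φ] with x hx
    rw [hx, Pi.smul_apply, smul_comm]
  rw [e1, e2, integral_smul, integral_smul, h φ hφ hc hs, smul_neg]

theorem HasWeakDeriv.unique {Y : Set ℝ} (hY : Y.Finite) {Ψ Φ Φ' : L2} (h : HasWeakDeriv Y Ψ Φ)
    (h' : HasWeakDeriv Y Ψ Φ') : Φ = Φ' := by
  have key : ∀ᵐ x ∂(volume : Measure ℝ), x ∈ Yᶜ → (Φ x - Φ' x) = 0 := by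
    refine hY.isClosed.isOpen_compl.ae_eq_zero_of_integral_contDiff_smul_eq_zero ?_ ?_
    · exact (((Lp.memLp Φ).locallyIntegrable (by norm_num)).sub
        ((Lp.memLp Φ').locallyIntegrable (by norm_num))).locallyIntegrableOn _
    · intro φ hφ hc hs
      simp only [smul_sub]
      rw [integral_sub (integrable_smul_L2 hφ.continuous hc Φ)
        (integrable_smul_L2 hφ.continuous hc Φ'), sub_eq_zero]
      exact neg_injective ((h φ hφ hc hs).symm.trans (h' φ hφ hc hs))
  have hnull : ∀ᵐ x ∂(volume : Measure ℝ), x ∈ Yᶜ := by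
    rw [ae_iff]
    simpa using hY.measure_zero volume
  refine Lp.ext ?_
  filter_upwards [key, hnull] with x hx hx'
  exact sub_eq_zero.1 (hx hx')

/-- The distributional derivative on `ℝ \ Y` as an operator in `L²(ℝ; ℂ²)`, with domain
`H¹(ℝ \ Y; ℂ²)`. -/
def weakDiff (Y : Set ℝ) (hY : Y.Finite) : L2 →ₗ.[ℂ] L2 where
  domain :=
    { carrier := {Ψ | ∃ Φ, HasWeakDeriv Y Ψ Φ}
      add_mem' := by
        rintro Ψ Ψ' ⟨Φ, h⟩ ⟨Φ', h'⟩
        exact ⟨Φ + Φ', h.add h'⟩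
      zero_mem' := by
        refine ⟨0, fun φ _ _ _ => ?_⟩
        have e : ∀ f : ℝ → ℝ, ∫ x, f x • (0 : L2) x = 0 := fun f => by
          refine integral_eq_zero_of_ae ?_
          filter_upwards [Lp.coeFn_zero C2 2 (volume : Measure ℝ)] with x hx
          rw [hx]
          simp
        rw [e, e, neg_zero]
      smul_mem' := by
        rintro c Ψ ⟨Φ, h⟩
        exact ⟨c • Φ, h.smul c⟩ }
  toFun :=
    { toFun := fun Ψ => Classical.choose Ψ.2
      map_add' := fun Ψ Ψ' => (Classical.choose_spec (Ψ + Ψ').2).unique hY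
        ((Classical.choose_spec Ψ.2).add (Classical.choose_spec Ψ'.2))
      map_smul' := fun c Ψ => (Classical.choose_spec (c • Ψ).2).unique hY
        ((Classical.choose_spec Ψ.2).smul c) }

theorem weakDiff_spec {Y : Set ℝ} (hY : Y.Finite) (Ψ : (weakDiff Y hY).domain) :
    HasWeakDeriv Y Ψ (weakDiff Y hY Ψ) :=
  Classical.choose_spec Ψ.2

/-- The Pauli matrix `σ₁`. -/
def pauli1 : Matrix (Fin 2) (Fin 2) ℂ := !![0, 1; 1, 0]

/-- The Pauli matrix `σ₃`. -/
def pauli3 : Matrix (Fin 2) (Fin 2) ℂ := !![1, 0; 0, -1]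

/-- A constant matrix acting pointwise on `L²(ℝ; ℂ²)`. -/
def matOp (M : Matrix (Fin 2) (Fin 2) ℂ) : L2 →L[ℂ] L2 :=
  (Matrix.toEuclideanCLM (n := Fin 2) (𝕜 := ℂ) M).compLpL 2 (volume : Measure ℝ)

/-- The Dirac expression `-i σ₁ d/dx + σ₃/2` on `H¹(ℝ \ Y; ℂ²)`. -/
def maxDirac (Y : Set ℝ) (hY : Y.Finite) : L2 →ₗ.[ℂ] L2 where
  domain := (weakDiff Y hY).domain
  toFun := -Complex.I • (matOp pauli1).toLinearMap ∘ₗ (weakDiff Y hY).toFun +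
    (1 / 2 : ℂ) • (matOp pauli3).toLinearMap ∘ₗ (weakDiff Y hY).domain.subtype

/-- The Schrödinger expression `-d²/dx²` (on each component) on `H²(ℝ \ Y; ℂ²)`. -/
def maxSchrodinger (Y : Set ℝ) (hY : Y.Finite) : L2 →ₗ.[ℂ] L2 := -opSq (weakDiff Y hY)

/-- The free Dirac operator `D`, with domain `H¹(ℝ; ℂ²)`. -/
def freeDirac : L2 →ₗ.[ℂ] L2 := maxDirac ∅ Set.finite_empty

/-- The operator `H𝟙 = H ⊕ H`, with domain `H²(ℝ; ℂ²)`. -/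
def freeSchrodinger : L2 →ₗ.[ℂ] L2 := maxSchrodinger ∅ Set.finite_empty

/-! ### Couples `(Π, Θ)` and the point interactions -/

/-- A couple `(Π, Θ)`: an orthogonal projector `Π` in `ℂ^ι` and a symmetric operator `Θ` in
`ran Π`. -/
structure Couple (ι : Type) [Fintype ι] where
  proj : EuclideanSpace ℂ ι →ₗ[ℂ] EuclideanSpace ℂ ι
  isProj : proj.IsSymmetricProjection
  theta : LinearMap.range proj →ₗ[ℂ] LinearMap.range proj
  isSymm : LinearMap.IsSymmetric (𝕜 := ℂ) (E := LinearMap.range proj) theta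

namespace Couple

variable {ι : Type} [Fintype ι] (c : Couple ι)

/-- The boundary condition `r ∈ ran Π` and `Π t = Θ r`. -/
def Holds (r t : EuclideanSpace ℂ ι) : Prop :=
  ∃ h : r ∈ LinearMap.range c.proj, c.proj.rangeRestrict t = c.theta ⟨r, h⟩

theorem Holds.zero : c.Holds 0 0 :=
  ⟨Submodule.zero_mem _, by
    rw [map_zero]
    exact (map_zero c.theta).symm⟩

variable {c}

theorem Holds.add {r t r' t' : EuclideanSpace ℂ ι} (h : c.Holds r t) (h' : c.Holds r' t') :
    c.Holds (r + r') (t + t') := by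
  obtain ⟨h1, h2⟩ := h
  obtain ⟨h1', h2'⟩ := h'
  refine ⟨Submodule.add_mem _ h1 h1', ?_⟩
  rw [map_add, h2, h2', ← map_add]
  rfl

theorem Holds.smul {r t : EuclideanSpace ℂ ι} (a : ℂ) (h : c.Holds r t) :
    c.Holds (a • r) (a • t) := by
  obtain ⟨h1, h2⟩ := h
  refine ⟨Submodule.smul_mem _ a h1, ?_⟩
  rw [map_smul, h2, ← map_smul]
  rfl

variable (c) in
/-- The operator `Θ - Π M Π` in `ran Π`. -/
def gamma [DecidableEq ι] (M : Matrix ι ι ℂ) :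
    LinearMap.range c.proj →ₗ[ℂ] LinearMap.range c.proj :=
  c.theta - c.proj.rangeRestrict ∘ₗ Matrix.toEuclideanLin M ∘ₗ (LinearMap.range c.proj).subtype

end Couple

variable {n : ℕ}

/-- `a k` and `b k` are the left limit `Ψ(y_k⁻)` and the right limit `Ψ(y_k⁺)`. The limits are taken
along the almost-everywhere filter, so they do not depend on the representative of `Ψ`. -/
def HasTraces (y : Fin n → ℝ) (Ψ : L2) (a b : Fin n → C2) : Prop :=
  ∀ k, Tendsto Ψ (𝓝[<] (y k) ⊓ ae volume) (𝓝 (a k)) ∧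
    Tendsto Ψ (𝓝[>] (y k) ⊓ ae volume) (𝓝 (b k))

theorem HasTraces.zero (y : Fin n → ℝ) : HasTraces y 0 0 0 := by
  intro k
  have h := Lp.coeFn_zero C2 2 (volume : Measure ℝ)
  exact ⟨tendsto_const_nhds.congr' (h.symm.filter_mono inf_le_right),
    tendsto_const_nhds.congr' (h.symm.filter_mono inf_le_right)⟩

theorem HasTraces.add {y : Fin n → ℝ} {Ψ Ψ' : L2} {a b a' b' : Fin n → C2}
    (h : HasTraces y Ψ a b) (h' : HasTraces y Ψ' a' b') :
    HasTraces y (Ψ + Ψ') (a + a') (b + b') := by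
  intro k
  have e := Lp.coeFn_add Ψ Ψ'
  exact ⟨((h k).1.add (h' k).1).congr' (e.symm.filter_mono inf_le_right),
    ((h k).2.add (h' k).2).congr' (e.symm.filter_mono inf_le_right)⟩

theorem HasTraces.smul {y : Fin n → ℝ} {Ψ : L2} {a b : Fin n → C2} (c : ℂ)
    (h : HasTraces y Ψ a b) : HasTraces y (c • Ψ) (c • a) (c • b) := by
  intro k
  have e := Lp.coeFn_smul c Ψ
  exact ⟨((h k).1.const_smul c).congr' (e.symm.filter_mono inf_le_right),
    ((h k).2.const_smul c).congr' (e.symm.filter_mono inf_le_right)⟩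

/-- `τΨ`: the mean values `(Ψ(y_k⁻) + Ψ(y_k⁺)) / 2`. -/
def diracTau (a b : Fin n → C2) : EuclideanSpace ℂ (Fin n × Fin 2) :=
  WithLp.toLp 2 fun p => (a p.1 p.2 + b p.1 p.2) / 2

/-- `ρΨ`: the vectors `i σ₁ (Ψ(y_k⁺) - Ψ(y_k⁻))`. -/
def diracRho (a b : Fin n → C2) : EuclideanSpace ℂ (Fin n × Fin 2) :=
  WithLp.toLp 2 fun p =>
    (Complex.I • Matrix.toEuclideanCLM (n := Fin 2) (𝕜 := ℂ) pauli1 (b p.1 - a p.1)) p.2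

/-- The point interaction `D_{Π,Θ}`: the Dirac expression on `ℝ \ Y` restricted to
`{Ψ ∈ H¹(ℝ \ Y; ℂ²) : ρΨ ∈ ran Π, Π τΨ = Θ ρΨ}`. -/
def diracOp (y : Fin n → ℝ) (c : Couple (Fin n × Fin 2)) : L2 →ₗ.[ℂ] L2 :=
  (maxDirac (Set.range y) (Set.finite_range y)).domRestrict
    { carrier := {Ψ | ∃ a b, HasTraces y Ψ a b ∧ c.Holds (diracRho a b) (diracTau a b)}
      add_mem' := by
        rintro Ψ Ψ' ⟨a, b, h1, h2⟩ ⟨a', b', h1', h2'⟩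
        refine ⟨_, _, h1.add h1', ?_⟩
        convert h2.add h2' using 1
        · ext p
          simp only [diracRho, Pi.add_apply, add_sub_add_comm, map_add, smul_add, PiLp.add_apply]
        · ext p
          simp only [diracTau, Pi.add_apply, PiLp.add_apply]
          ring
      zero_mem' := by
        refine ⟨_, _, HasTraces.zero y, ?_⟩
        convert Couple.Holds.zero c using 1
        · ext p
          simp [diracRho]
        · ext p
          simp [diracTau]
      smul_mem' := by
        rintro s Ψ ⟨a, b, h1, h2⟩
        refine ⟨_, _, h1.smul s, ?_⟩
        convert h2.smul s using 1
        · ext p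
          simp only [diracRho, Pi.smul_apply, ← smul_sub, map_smul, PiLp.smul_apply, smul_eq_mul]
          ring
        · ext p
          simp only [diracTau, Pi.smul_apply, PiLp.smul_apply, smul_eq_mul]
          ring }

/-- `(τ̂𝟙)Ψ`: for each component `ψ` of `Ψ`, the mean values of `ψ` and of `ψ'` at the points `y_k`.
The index is (component of `Ψ`, point, value or derivative); `a, b` are the one-sided limits of `Ψ`
and `a', b'` those of `Ψ'`. -/
def schrodingerTau (a b a' b' : Fin n → C2) : EuclideanSpace ℂ (Fin 2 × Fin n × Fin 2) :=
  WithLp.toLp 2 fun p =>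
    ![(a p.2.1 p.1 + b p.2.1 p.1) / 2, (a' p.2.1 p.1 + b' p.2.1 p.1) / 2] p.2.2

/-- `(ρ̂𝟙)Ψ`: for each component `ψ` of `Ψ`, the jumps `[ψ']` and `[-ψ]` at the points `y_k`. -/
def schrodingerRho (a b a' b' : Fin n → C2) : EuclideanSpace ℂ (Fin 2 × Fin n × Fin 2) :=
  WithLp.toLp 2 fun p =>
    ![b' p.2.1 p.1 - a' p.2.1 p.1, -(b p.2.1 p.1 - a p.2.1 p.1)] p.2.2

/-- The point interaction `Ĥ_{Π̂,Θ̂}`: the Schrödinger expression on `ℝ \ Y` restricted to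
`{Ψ ∈ H²(ℝ \ Y; ℂ²) : (ρ̂𝟙)Ψ ∈ ran Π̂, Π̂ (τ̂𝟙)Ψ = Θ̂ (ρ̂𝟙)Ψ}`. -/
def schrodingerOp (y : Fin n → ℝ) (c : Couple (Fin 2 × Fin n × Fin 2)) : L2 →ₗ.[ℂ] L2 :=
  (maxSchrodinger (Set.range y) (Set.finite_range y)).domRestrict
    { carrier := {Ψ | ∃ Φ, HasWeakDeriv (Set.range y) Ψ Φ ∧ ∃ a b a' b',
        HasTraces y Ψ a b ∧ HasTraces y Φ a' b' ∧
          c.Holds (schrodingerRho a b a' b') (schrodingerTau a b a' b')}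
      add_mem' := by
        rintro Ψ₁ Ψ₂ ⟨Φ₁, d1, a₁, b₁, a₁', b₁', h1, h1', k1⟩ ⟨Φ₂, d2, a₂, b₂, a₂', b₂', h2, h2', k2⟩
        refine ⟨_, d1.add d2, _, _, _, _, h1.add h2, h1'.add h2', ?_⟩
        convert k1.add k2 using 1
        · ext ⟨i, k, j⟩
          fin_cases j <;> simp [schrodingerRho] <;> ring
        · ext ⟨i, k, j⟩
          fin_cases j <;> simp [schrodingerTau] <;> ring
      zero_mem' := by
        refine ⟨_, weakDiff_spec (Set.finite_range y) 0, 0, 0, 0, 0, HasTraces.zero y, ?_, ?_⟩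
        · rw [LinearPMap.map_zero]
          exact HasTraces.zero y
        · convert Couple.Holds.zero c using 1
          · ext ⟨i, k, j⟩
            fin_cases j <;> simp [schrodingerRho]
          · ext ⟨i, k, j⟩
            fin_cases j <;> simp [schrodingerTau]
      smul_mem' := by
        rintro s Ψ ⟨Φ, d, a, b, a', b', h, h', k⟩
        refine ⟨_, d.smul s, _, _, _, _, h.smul s, h'.smul s, ?_⟩
        convert k.smul s using 1
        · ext ⟨i, k, j⟩
          fin_cases j <;> simp [schrodingerRho] <;> ring
        · ext ⟨i, k, j⟩
          fin_cases j <;> simp [schrodingerTau] <;> ring }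

/-! ### Resolvent kernels and the matrices `τ G_z`, `τ̂ Ĝ_z` -/

/-- The square root with positive imaginary part on `ℂ \ [0, ∞)`. -/
def upperSqrt (z : ℂ) : ℂ := Complex.I * Complex.sqrt (-z)

theorem upperSqrt_sq (z : ℂ) : upperSqrt z ^ 2 = z := by
  have : Complex.sqrt (-z) ^ 2 = -z := by
    rw [Complex.sqrt, ← Complex.cpow_nat_mul]
    norm_num
  rw [upperSqrt, mul_pow, this, Complex.I_sq]
  ring

theorem upperSqrt_im_pos {z : ℂ} (hz : ∀ x : ℝ, 0 ≤ x → z ≠ x) : 0 < (upperSqrt z).im := by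
  have hz0 : -z ≠ 0 := fun h => hz 0 le_rfl (by simpa using h)
  have harg : (-z).arg ≠ Real.pi := by
    intro h
    rw [Complex.arg_eq_pi_iff] at h
    refine hz z.re (by simpa using h.1.le) (Complex.ext rfl ?_)
    simpa using h.2
  have h1 := (-z).arg_le_pi.lt_of_ne harg
  have h2 := (-z).neg_pi_lt_arg
  have hre : 0 < (Complex.sqrt (-z)).re := by
    rw [Complex.sqrt, Complex.cpow_def_of_ne_zero hz0, Complex.exp_re]
    refine mul_pos (Real.exp_pos _) (Real.cos_pos_of_mem_Ioo ?_)
    have : (Complex.log (-z) * 2⁻¹).im = (-z).arg / 2 := by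
      rw [show (2⁻¹ : ℂ) = ((2⁻¹ : ℝ) : ℂ) by push_cast; rfl, Complex.im_mul_ofReal, Complex.log_im]
      ring
    rw [this]
    constructor <;> linarith
  simpa [upperSqrt] using hre

/-- The kernel `ĝ_z(x)` of the free Schrödinger resolvent `(-H + z)⁻¹`. -/
def schrodingerKernel (z : ℂ) (x : ℝ) : ℂ :=
  Complex.exp (Complex.I * upperSqrt z * |x|) / (2 * Complex.I * upperSqrt z)

/-- The derivative `ĝ_z'(x)` (at `x = 0`, the mean of its one-sided limits). -/
def schrodingerKernelDeriv (z : ℂ) (x : ℝ) : ℂ :=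
  Real.sign x * Complex.exp (Complex.I * upperSqrt z * |x|) / 2

/-- The kernel `g_z(x) = (D + z) ĝ_w 𝟙`, `w = z² - 1/4`, of the free Dirac resolvent `(-D + z)⁻¹`
(at `x = 0`, the mean of its one-sided limits). -/
def diracKernel (z : ℂ) (x : ℝ) : Matrix (Fin 2) (Fin 2) ℂ :=
  (-Complex.I * schrodingerKernelDeriv (z ^ 2 - 1 / 4) x) • pauli1 +
    schrodingerKernel (z ^ 2 - 1 / 4) x • ((1 / 2 : ℂ) • pauli3 + z • (1 : Matrix (Fin 2) (Fin 2) ℂ))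

/-- The function `G_z ξ`, where `G_z = (τ (-D + z̄)⁻¹)*`. -/
def diracG (y : Fin n → ℝ) (z : ℂ) (ξ : EuclideanSpace ℂ (Fin n × Fin 2)) (x : ℝ) : C2 :=
  WithLp.toLp 2 fun i => ∑ q : Fin n × Fin 2, diracKernel z (x - y q.1) i q.2 * ξ q

/-- The matrix of `τ G_z`. -/
def tauG (y : Fin n → ℝ) (z : ℂ) : Matrix (Fin n × Fin 2) (Fin n × Fin 2) ℂ :=
  Matrix.of fun p q => diracKernel z (y p.1 - y q.1) p.2 q.2

/-- The function `Ĝ_z ξ`, where `Ĝ_z = (τ̂ (-H + z̄)⁻¹)*`. -/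
def schrodingerG (y : Fin n → ℝ) (z : ℂ) (ξ : EuclideanSpace ℂ (Fin n × Fin 2)) (x : ℝ) : ℂ :=
  ∑ q : Fin n × Fin 2,
    ![schrodingerKernel z (y q.1 - x), schrodingerKernelDeriv z (y q.1 - x)] q.2 * ξ q

/-- The derivative of `Ĝ_z ξ` off the points `y_k`, obtained from `ĝ_z'' = -z ĝ_z` off the origin. -/
def schrodingerGDeriv (y : Fin n → ℝ) (z : ℂ) (ξ : EuclideanSpace ℂ (Fin n × Fin 2)) (x : ℝ) : ℂ :=
  ∑ q : Fin n × Fin 2,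
    ![-schrodingerKernelDeriv z (y q.1 - x), z * schrodingerKernel z (y q.1 - x)] q.2 * ξ q

/-- The matrix of `τ̂ Ĝ_z`. -/
def tauGHat (y : Fin n → ℝ) (z : ℂ) : Matrix (Fin n × Fin 2) (Fin n × Fin 2) ℂ :=
  Matrix.of fun p q =>
    !![schrodingerKernel z (y q.1 - y p.1), schrodingerKernelDeriv z (y q.1 - y p.1);
      -schrodingerKernelDeriv z (y q.1 - y p.1), z * schrodingerKernel z (y q.1 - y p.1)] p.2 q.2

/-- The matrix of `τ̂ Ĝ_z 𝟙 = τ̂ Ĝ_z ⊕ τ̂ Ĝ_z`. -/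
def tauGHatOne (y : Fin n → ℝ) (z : ℂ) :
    Matrix (Fin 2 × Fin n × Fin 2) (Fin 2 × Fin n × Fin 2) ℂ :=
  Matrix.kronecker (1 : Matrix (Fin 2) (Fin 2) ℂ) (tauGHat y z)

theorem upperSqrt_ne_zero {z : ℂ} (hz : z ≠ 0) : upperSqrt z ≠ 0 := fun h =>
  hz (by rw [← upperSqrt_sq z, h]; ring)

theorem hasDerivAt_exp_abs (c : ℂ) {x : ℝ} (hx : x ≠ 0) :
    HasDerivAt (fun x : ℝ => Complex.exp (c * |x|)) (c * Real.sign x * Complex.exp (c * |x|)) x := by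
  have h1 : HasDerivAt (fun x : ℝ => |x|) (Real.sign x) x := by
    rcases lt_or_gt_of_ne hx with h | h
    · rw [Real.sign_of_neg h]
      exact hasDerivAt_abs_neg h
    · rw [Real.sign_of_pos h]
      exact hasDerivAt_abs_pos h
  have h2 := (h1.ofReal_comp.const_mul c).cexp
  convert h2 using 1
  ring

theorem hasDerivAt_schrodingerKernel {z : ℂ} (hz : z ≠ 0) {x : ℝ} (hx : x ≠ 0) :
    HasDerivAt (schrodingerKernel z) (schrodingerKernelDeriv z x) x := by
  have h := (hasDerivAt_exp_abs (Complex.I * upperSqrt z) hx).div_const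
    (2 * Complex.I * upperSqrt z)
  have h0 := upperSqrt_ne_zero hz
  refine HasDerivAt.congr_deriv (f := schrodingerKernel z) h ?_
  rw [schrodingerKernelDeriv]
  field_simp

theorem eventually_sign_eq {x : ℝ} (hx : x ≠ 0) : ∀ᶠ t in 𝓝 x, Real.sign t = Real.sign x := by
  rcases lt_or_gt_of_ne hx with h | h
  · filter_upwards [eventually_lt_nhds h] with t ht
    rw [Real.sign_of_neg h, Real.sign_of_neg ht]
  · filter_upwards [eventually_gt_nhds h] with t ht
    rw [Real.sign_of_pos h, Real.sign_of_pos ht]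

theorem hasDerivAt_schrodingerKernelDeriv {z : ℂ} (hz : z ≠ 0) {x : ℝ} (hx : x ≠ 0) :
    HasDerivAt (schrodingerKernelDeriv z) (-z * schrodingerKernel z x) x := by
  have h := ((hasDerivAt_exp_abs (Complex.I * upperSqrt z) hx).const_mul
    ((Real.sign x : ℝ) : ℂ)).div_const 2
  have e : schrodingerKernelDeriv z =ᶠ[𝓝 x] fun t =>
      ((Real.sign x : ℝ) : ℂ) * Complex.exp (Complex.I * upperSqrt z * |t|) / 2 := by
    filter_upwards [eventually_sign_eq hx] with t ht
    rw [schrodingerKernelDeriv, ht]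
  refine (h.congr_of_eventuallyEq e).congr_deriv ?_
  have h0 := upperSqrt_ne_zero hz
  have hs : ((Real.sign x : ℝ) : ℂ) * ((Real.sign x : ℝ) : ℂ) = 1 := by
    rcases lt_or_gt_of_ne hx with h | h
    · rw [Real.sign_of_neg h]; norm_num
    · rw [Real.sign_of_pos h]; norm_num
  have hsq := upperSqrt_sq z
  have hK : z * schrodingerKernel z x =
      -(Complex.I * upperSqrt z * Complex.exp (Complex.I * upperSqrt z * |x|) / 2) := by
    have h1 : z * schrodingerKernel z x = upperSqrt z ^ 2 * schrodingerKernel z x := by rw [hsq]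
    rw [h1, schrodingerKernel]
    field_simp
    rw [Complex.I_sq, neg_neg]
  rw [neg_mul, hK]
  linear_combination
    (Complex.I * upperSqrt z * Complex.exp (Complex.I * upperSqrt z * |x|) / 2) * hs

theorem continuous_schrodingerKernel (z : ℂ) : Continuous (schrodingerKernel z) := by
  unfold schrodingerKernel
  fun_prop

theorem tendsto_schrodingerKernelDeriv (z : ℂ) :
    Tendsto (schrodingerKernelDeriv z) (𝓝[<] 0) (𝓝 (-1 / 2)) ∧
      Tendsto (schrodingerKernelDeriv z) (𝓝[>] 0) (𝓝 (1 / 2)) := by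
  have h : ∀ s : ℂ, Tendsto (fun x : ℝ => s * Complex.exp (Complex.I * upperSqrt z * |x|) / 2)
      (𝓝 0) (𝓝 (s / 2)) := by
    intro s
    have hc : Continuous fun x : ℝ => s * Complex.exp (Complex.I * upperSqrt z * |x|) / 2 := by
      fun_prop
    simpa using hc.tendsto 0
  constructor
  · refine ((h (-1)).mono_left nhdsWithin_le_nhds).congr' ?_
    filter_upwards [self_mem_nhdsWithin] with x hx
    rw [schrodingerKernelDeriv, Real.sign_of_neg hx]
    norm_num
  · refine ((h 1).mono_left nhdsWithin_le_nhds).congr' ?_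
    filter_upwards [self_mem_nhdsWithin] with x hx
    rw [schrodingerKernelDeriv, Real.sign_of_pos hx]
    norm_num

theorem tendsto_kernelDeriv_sub (z : ℂ) (hz : z ≠ 0) (u v : ℝ) :
    Tendsto (fun x => schrodingerKernelDeriv z (x - v)) (𝓝[<] u)
      (𝓝 (schrodingerKernelDeriv z (u - v) - if u = v then 1 / 2 else 0)) ∧
    Tendsto (fun x => schrodingerKernelDeriv z (x - v)) (𝓝[>] u)
      (𝓝 (schrodingerKernelDeriv z (u - v) + if u = v then 1 / 2 else 0)) := by
  by_cases huv : u = v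
  · subst huv
    have h0 : schrodingerKernelDeriv z (u - u) = 0 := by simp [schrodingerKernelDeriv]
    have hs : Tendsto (fun x : ℝ => x - u) (𝓝 u) (𝓝 0) := by
      simpa using (continuous_id.sub continuous_const).tendsto (X := ℝ) (x := u) (f := fun x : ℝ => x - u)
    rw [h0, if_pos rfl, zero_sub, zero_add]
    constructor
    · have := (tendsto_schrodingerKernelDeriv z).1
      rw [neg_div] at this
      refine this.comp (tendsto_nhdsWithin_iff.2 ⟨hs.mono_left nhdsWithin_le_nhds, ?_⟩)
      filter_upwards [self_mem_nhdsWithin] with x hx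
      simpa using hx
    · refine (tendsto_schrodingerKernelDeriv z).2.comp
        (tendsto_nhdsWithin_iff.2 ⟨hs.mono_left nhdsWithin_le_nhds, ?_⟩)
      filter_upwards [self_mem_nhdsWithin] with x hx
      simpa using hx
  · have h : Tendsto (fun x => schrodingerKernelDeriv z (x - v)) (𝓝 u)
        (𝓝 (schrodingerKernelDeriv z (u - v))) := by
      have h1 := (hasDerivAt_schrodingerKernelDeriv hz (sub_ne_zero.2 huv)).continuousAt
      exact ContinuousAt.comp (f := fun x : ℝ => x - v) h1 (by fun_prop)
    simp only [if_neg huv, sub_zero, add_zero]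
    exact ⟨h.mono_left nhdsWithin_le_nhds, h.mono_left nhdsWithin_le_nhds⟩

/-- `G_z ξ` has one-sided limits at the points `y_k`, with mean values `(τ G_z) ξ` and
`ρ G_z ξ = ξ`. -/
theorem diracG_traces {y : Fin n → ℝ} (hy : Function.Injective y) {z : ℂ} (hz : z ^ 2 - 1 / 4 ≠ 0)
    (ξ : EuclideanSpace ℂ (Fin n × Fin 2)) :
    ∃ a b : Fin n → C2, (∀ k, Tendsto (diracG y z ξ) (𝓝[<] (y k)) (𝓝 (a k)) ∧
      Tendsto (diracG y z ξ) (𝓝[>] (y k)) (𝓝 (b k))) ∧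
      diracTau a b = Matrix.toEuclideanLin (tauG y z) ξ ∧ diracRho a b = ξ := by
  let J : Fin n → Fin 2 → Fin n × Fin 2 → ℂ := fun k i q =>
    (-Complex.I * if y k = y q.1 then 1 / 2 else 0) * pauli1 i q.2
  let a : Fin n → C2 := fun k => WithLp.toLp 2 fun i =>
    ∑ q : Fin n × Fin 2, (diracKernel z (y k - y q.1) i q.2 - J k i q) * ξ q
  let b : Fin n → C2 := fun k => WithLp.toLp 2 fun i =>
    ∑ q : Fin n × Fin 2, (diracKernel z (y k - y q.1) i q.2 + J k i q) * ξ q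
  have hK : ∀ u v : ℝ, Tendsto (fun x => schrodingerKernel (z ^ 2 - 1 / 4) (x - v)) (𝓝 u)
      (𝓝 (schrodingerKernel (z ^ 2 - 1 / 4) (u - v))) := fun u v =>
    ((continuous_schrodingerKernel _).comp (continuous_id.sub continuous_const)).tendsto u
  refine ⟨a, b, fun k => ⟨?_, ?_⟩, ?_, ?_⟩
  · refine (PiLp.continuous_toLp 2 _).continuousAt.tendsto.comp (tendsto_pi_nhds.2 fun i => ?_)
    refine tendsto_finsetSum _ fun q _ => Tendsto.mul_const _ ?_
    have h := (((tendsto_kernelDeriv_sub _ hz (y k) (y q.1)).1.const_mul (-Complex.I)).mul_const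
      (pauli1 i q.2)).add (((hK (y k) (y q.1)).mono_left nhdsWithin_le_nhds).mul_const
        (((1 / 2 : ℂ) • pauli3 + z • (1 : Matrix (Fin 2) (Fin 2) ℂ)) i q.2))
    convert h using 2
    · simp only [diracKernel, Matrix.add_apply, Matrix.smul_apply, smul_eq_mul]
    · simp only [diracKernel, J, Matrix.add_apply, Matrix.smul_apply, smul_eq_mul]
      ring
  · refine (PiLp.continuous_toLp 2 _).continuousAt.tendsto.comp (tendsto_pi_nhds.2 fun i => ?_)
    refine tendsto_finsetSum _ fun q _ => Tendsto.mul_const _ ?_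
    have h := (((tendsto_kernelDeriv_sub _ hz (y k) (y q.1)).2.const_mul (-Complex.I)).mul_const
      (pauli1 i q.2)).add (((hK (y k) (y q.1)).mono_left nhdsWithin_le_nhds).mul_const
        (((1 / 2 : ℂ) • pauli3 + z • (1 : Matrix (Fin 2) (Fin 2) ℂ)) i q.2))
    convert h using 2
    · simp only [diracKernel, Matrix.add_apply, Matrix.smul_apply, smul_eq_mul]
    · simp only [diracKernel, J, Matrix.add_apply, Matrix.smul_apply, smul_eq_mul]
      ring
  · ext ⟨k, i⟩
    simp only [diracTau, a, b, Matrix.toLpLin_apply, Matrix.mulVec, dotProduct, tauG,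
      Matrix.of_apply, ← Finset.sum_add_distrib, Finset.sum_div]
    refine Finset.sum_congr rfl fun q _ => ?_
    ring
  · have hd : ∀ k i, (b k - a k) i = -Complex.I * ∑ j, pauli1 i j * ξ (k, j) := by
      intro k i
      simp only [a, b, PiLp.sub_apply, ← Finset.sum_sub_distrib, Fintype.sum_prod_type]
      rw [Finset.sum_eq_single k, Finset.mul_sum]
      · refine Finset.sum_congr rfl fun j _ => ?_
        simp only [J, if_true]
        ring
      · intro m _ hm
        have : y k ≠ y m := fun h => hm (hy h).symm
        simp [J, this]
      · simp
    ext ⟨k, i⟩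
    have hI := Complex.I_mul_I
    simp only [diracRho, PiLp.smul_apply, smul_eq_mul, Matrix.ofLp_toEuclideanCLM, Matrix.mulVec,
      dotProduct]
    simp only [hd, Fin.sum_univ_two]
    fin_cases i <;> simp [pauli1, ← mul_assoc]

/-- `Ĝ_z ξ` and its derivative have one-sided limits at the points `y_k`, with mean values
`(τ̂ Ĝ_z) ξ` and `ρ̂ Ĝ_z ξ = ξ`. -/
theorem schrodingerG_traces {y : Fin n → ℝ} (hy : Function.Injective y) {z : ℂ} (hz : z ≠ 0)
    (ξ : EuclideanSpace ℂ (Fin n × Fin 2)) :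
    (∀ x, x ∉ Set.range y → HasDerivAt (schrodingerG y z ξ) (schrodingerGDeriv y z ξ x) x) ∧
    ∀ k, ∃ a b a' b' : ℂ,
      Tendsto (schrodingerG y z ξ) (𝓝[<] (y k)) (𝓝 a) ∧
      Tendsto (schrodingerG y z ξ) (𝓝[>] (y k)) (𝓝 b) ∧
      Tendsto (schrodingerGDeriv y z ξ) (𝓝[<] (y k)) (𝓝 a') ∧
      Tendsto (schrodingerGDeriv y z ξ) (𝓝[>] (y k)) (𝓝 b') ∧
      (a + b) / 2 = Matrix.toEuclideanLin (tauGHat y z) ξ (k, 0) ∧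
      (a' + b') / 2 = Matrix.toEuclideanLin (tauGHat y z) ξ (k, 1) ∧
      b' - a' = ξ (k, 0) ∧ -(b - a) = ξ (k, 1) := by
  have hodd : ∀ x, schrodingerKernelDeriv z (-x) = -schrodingerKernelDeriv z x := fun x => by
    simp only [schrodingerKernelDeriv, Real.sign_neg, abs_neg]
    push_cast
    ring
  have hK : ∀ u v : ℝ, Tendsto (fun x => schrodingerKernel z (v - x)) (𝓝 u)
      (𝓝 (schrodingerKernel z (v - u))) := fun u v =>
    ((continuous_schrodingerKernel _).comp (continuous_const.sub continuous_id)).tendsto u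
  have hL : ∀ u v : ℝ, Tendsto (fun x => schrodingerKernelDeriv z (v - x)) (𝓝[<] u)
      (𝓝 (schrodingerKernelDeriv z (v - u) + if u = v then 1 / 2 else 0)) := fun u v => by
    have h := (tendsto_kernelDeriv_sub z hz u v).1.neg
    simp only [← hodd, neg_sub] at h
    convert h using 2
    rw [← neg_sub u v, hodd]
    ring
  have hR : ∀ u v : ℝ, Tendsto (fun x => schrodingerKernelDeriv z (v - x)) (𝓝[>] u)
      (𝓝 (schrodingerKernelDeriv z (v - u) - if u = v then 1 / 2 else 0)) := fun u v => by
    have h := (tendsto_kernelDeriv_sub z hz u v).2.neg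
    simp only [← hodd, neg_sub] at h
    convert h using 2
    rw [← neg_sub u v, hodd]
    ring
  constructor
  · intro x hx
    refine HasDerivAt.fun_sum (u := Finset.univ) fun q _ => ?_
    have hne : y q.1 - x ≠ 0 := fun h => hx ⟨q.1, sub_eq_zero.1 h⟩
    obtain ⟨m, j⟩ := q
    refine HasDerivAt.mul_const ?_ _
    have hs : HasDerivAt (fun x : ℝ => y m - x) (-1) x := by
      simpa using (hasDerivAt_id x).const_sub (y m)
    fin_cases j
    · have h := (hasDerivAt_schrodingerKernel hz hne).scomp x hs
      simpa [Function.comp_def] using h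
    · have h := (hasDerivAt_schrodingerKernelDeriv hz hne).scomp x hs
      simpa [Function.comp_def] using h
  · intro k
    refine ⟨_, _, _, _,
      tendsto_finsetSum _ fun q _ => Tendsto.mul_const _ (a := ![schrodingerKernel z (y q.1 - y k),
        schrodingerKernelDeriv z (y q.1 - y k) + if y k = y q.1 then 1 / 2 else 0] q.2) ?_,
      tendsto_finsetSum _ fun q _ => Tendsto.mul_const _ (a := ![schrodingerKernel z (y q.1 - y k),
        schrodingerKernelDeriv z (y q.1 - y k) - if y k = y q.1 then 1 / 2 else 0] q.2) ?_,
      tendsto_finsetSum _ fun q _ => Tendsto.mul_const _ (a := ![-(schrodingerKernelDeriv z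
        (y q.1 - y k) + if y k = y q.1 then 1 / 2 else 0), z * schrodingerKernel z (y q.1 - y k)]
        q.2) ?_,
      tendsto_finsetSum _ fun q _ => Tendsto.mul_const _ (a := ![-(schrodingerKernelDeriv z
        (y q.1 - y k) - if y k = y q.1 then 1 / 2 else 0), z * schrodingerKernel z (y q.1 - y k)]
        q.2) ?_, ?_, ?_, ?_, ?_⟩
    · obtain ⟨m, j⟩ := q
      fin_cases j
      · exact (hK _ _).mono_left nhdsWithin_le_nhds
      · exact hL _ _
    · obtain ⟨m, j⟩ := q
      fin_cases j
      · exact (hK _ _).mono_left nhdsWithin_le_nhds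
      · exact hR _ _
    · obtain ⟨m, j⟩ := q
      fin_cases j
      · exact (hL _ _).neg
      · exact ((hK _ _).mono_left nhdsWithin_le_nhds).const_mul z
    · obtain ⟨m, j⟩ := q
      fin_cases j
      · exact (hR _ _).neg
      · exact ((hK _ _).mono_left nhdsWithin_le_nhds).const_mul z
    · simp only [Matrix.toLpLin_apply, Matrix.mulVec, dotProduct, tauGHat, Matrix.of_apply,
        ← Finset.sum_add_distrib, Finset.sum_div]
      refine Finset.sum_congr rfl fun ⟨m, j⟩ _ => ?_
      fin_cases j <;> simp <;> ring
    · simp only [Matrix.toLpLin_apply, Matrix.mulVec, dotProduct, tauGHat, Matrix.of_apply,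
        ← Finset.sum_add_distrib, Finset.sum_div]
      refine Finset.sum_congr rfl fun ⟨m, j⟩ _ => ?_
      fin_cases j <;> simp <;> ring
    · rw [← Finset.sum_sub_distrib, Fintype.sum_prod_type, Finset.sum_eq_single k]
      · simp [Fin.sum_univ_two]
        ring
      · intro m _ hm
        have : y k ≠ y m := fun h => hm (hy h).symm
        simp [this]
      · simp
    · rw [← Finset.sum_sub_distrib, Fintype.sum_prod_type, Finset.sum_eq_single k]
      · simp [Fin.sum_univ_two]
        ring
      · intro m _ hm
        have : y k ≠ y m := fun h => hm (hy h).symm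
        simp [this]
      · simp

end PointInteraction

end

/-!
The operators `D_{Π,Θ}` and `Ĥ_{Π̂,Θ̂}` are both restrictions of a maximal operator, defined off the
points `y_k`, by finitely many boundary conditions, and their spectra are found by one abstract
argument about such restrictions.

The abstract data is a `BoundaryRelation`: a maximal operator `A` with boundary maps `ρ` and `τ`
satisfying Green's identity `⟨A u, v⟩ - ⟨u, A v⟩ = ⟨ρ u, τ v⟩ - ⟨τ u, ρ v⟩`. A couple `(Π, Θ)` makes
the right side vanish, so that every restriction is symmetric. At a point `z` where the free operator
(`ρ u = 0`) has a bounded resolvent `R_z` and the solutions of `A u = z u` are `u = G_z ξ` with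
`ξ = ρ u` and `τ u = M_z ξ`, the equation `(-A + z) u = f` with boundary conditions is solved by
`u = R_z f + G_z ξ`, where `(Θ - Π M_z Π) ξ = Π τ R_z f` in `ran Π`. Hence `z` is in the resolvent set
if `det (Θ - Π M_z Π) ≠ 0` and is an eigenvalue of finite multiplicity otherwise. This determinant is
analytic off the closed set `Ess` of irregular points, and its zeros are real by symmetry, so they
are isolated. As no point of `Ess` is isolated in `Ess`, the discrete spectrum consists of the zeros of
the determinant and the essential spectrum is `Ess`, provided that `Ess` lies in the spectrum
(`BoundaryRelation.IsRestriction.spectrum`).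

For the concrete operators, Green's identity is integration by parts on `ℝ \ Y`
(`HasWeakDeriv.inner_add_inner`). It rests on the lemma of du Bois-Reymond, by which elements of
`H¹(ℝ \ Y)` are locally primitives of their weak derivatives. The free resolvents come from
`d²/dx² + w = (d/dx + i √w) (d/dx - i √w)` (`exists_resolvent_second_deriv`); the factors are
invertible since `d/dx` is closed and skew-symmetric on the line. The solutions `G_z ξ` are given by
the resolvent kernels, which decay exponentially. The points of `Ess` are approximate eigenvalues, with
slowly modulated plane waves supported away from the points `y_k` (`exists_wave`). The free operators
are the case of no points.

If `A² = B + c` with `A` symmetric, then `z² - A² = -(z - A) (-z - A)` expresses the resolvent of `B`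
at `z² - c` through those of `A` at `z` and `-z`. Conversely, if `R̂` is the resolvent of `B` at
`z² - c`, then `(A + z) R̂` is the resolvent of `A` at `z`; it is bounded because
`‖A R̂ f‖² = ⟨A² R̂ f, R̂ f⟩` (`mem_opResolventSet_of_sq_sub_mem`). The statement on discrete spectra
follows, as the discrete spectrum is the spectrum without the essential spectrum.
-/

noncomputable section

namespace PointInteraction

/-! ### Primitives, weak derivatives and one-sided limits -/

section Primitives

theorem _root_.MeasureTheory.LocallyIntegrable.intervalIntegrable' {F : Type*}
    [NormedAddCommGroup F] {f : ℝ → F}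
    (hf : LocallyIntegrable f) (a b : ℝ) : IntervalIntegrable f volume a b :=
  (hf.integrableOn_isCompact isCompact_uIcc).intervalIntegrable

variable {F : Type*} [NormedAddCommGroup F] [NormedSpace ℝ F]

theorem absolutelyContinuousOnInterval_primitive {f : ℝ → F} (hf : LocallyIntegrable f)
    {a b c : ℝ} (hc : c ∈ Set.uIcc a b) :
    AbsolutelyContinuousOnInterval (fun x => ∫ t in c..x, f t) a b := by
  have hi : ∀ x y, IntervalIntegrable f volume x y := hf.intervalIntegrable'
  have h := (hf.intervalIntegrable' a b).norm.absolutelyContinuousOnInterval_intervalIntegral hc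
  refine squeeze_zero (fun _ => Finset.sum_nonneg fun _ _ => dist_nonneg) (fun E => ?_) h
  refine Finset.sum_le_sum fun i _ => ?_
  rw [dist_eq_norm, Real.dist_eq, intervalIntegral.integral_interval_sub_left (hi _ _) (hi _ _),
    intervalIntegral.integral_interval_sub_left (hi _ _).norm (hi _ _).norm]
  exact intervalIntegral.norm_integral_le_abs_integral_norm

variable [CompleteSpace F]

/-- The fundamental theorem of calculus for absolutely continuous functions with values in a Banach
space: `u` and the primitive of `f` have the same derivative almost everywhere. -/
theorem integral_eq_sub_of_absolutelyContinuous {u f : ℝ → F} (hf : LocallyIntegrable f)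
    {a b : ℝ} (hu : AbsolutelyContinuousOnInterval u a b)
    (hd : ∀ᵐ x, x ∈ Set.uIcc a b → HasDerivAt u (f x) x) : ∫ t in a..b, f t = u b - u a := by
  have hg := hu.sub (absolutelyContinuousOnInterval_primitive hf (Set.left_mem_uIcc (a := a) (b := b)))
  obtain ⟨C, hC⟩ := hg.const_of_ae_hasDerivAt_zero (by
    filter_upwards [hd, _root_.LocallyIntegrable.ae_hasDerivAt_integral hf] with x h1 h2 h3
    simpa using (h1 h3).sub (h2 a))
  have h1 := hC a Set.left_mem_uIcc
  have h2 := hC b Set.right_mem_uIcc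
  simp only [Pi.sub_apply, intervalIntegral.integral_same, sub_zero] at h1 h2
  rw [h1, ← h2]
  abel

/-- A primitive of `f` has the distributional derivative `f`. -/
theorem integral_deriv_smul_primitive {f : ℝ → F} (hf : LocallyIntegrable f) {φ : ℝ → ℝ}
    (hφ : ContDiff ℝ ∞ φ) (hc : HasCompactSupport φ) :
    ∫ x, deriv φ x • ∫ t in (0 : ℝ)..x, f t = -∫ x, φ x • f x := by
  have hd : Continuous (deriv φ) := hφ.continuous_deriv (by simp)
  have hP : Continuous fun x => ∫ t in (0 : ℝ)..x, f t :=
    intervalIntegral.continuous_primitive hf.intervalIntegrable' 0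
  have i1 : Integrable fun x => deriv φ x • ∫ t in (0 : ℝ)..x, f t :=
    (hd.smul hP).integrable_of_hasCompactSupport hc.deriv.smul_right
  have i2 : Integrable fun x => φ x • f x :=
    hf.integrable_smul_left_of_hasCompactSupport hφ.continuous hc
  obtain ⟨R, hR⟩ := hc.isCompact.isBounded.subset_closedBall 0
  have hz : ∀ x, x ∉ Set.Ioo (-(|R| + 1)) (|R| + 1) → φ x = 0 := by
    intro x hx
    refine image_eq_zero_of_notMem_tsupport fun h => hx ?_
    have := hR h
    rw [Metric.mem_closedBall, Real.dist_eq, sub_zero] at this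
    have h2 := abs_le.1 (this.trans (le_abs_self R))
    exact ⟨by linarith [h2.1], by linarith [h2.2]⟩
  set B := |R| + 1 with hB
  have hB0 : -B ≤ B := by have := abs_nonneg R; linarith
  have key := integral_eq_sub_of_absolutelyContinuous (F := F) (a := -B) (b := B)
    (u := φ • fun x => ∫ t in (0 : ℝ)..x, f t) (f := fun x => φ x • f x + deriv φ x • ∫ t in (0 : ℝ)..x, f t)
    (i2.add i1).locallyIntegrable
    ((hφ.of_le (by simp)).contDiffOn.absolutelyContinuousOnInterval.smul
      (absolutelyContinuousOnInterval_primitive hf (by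
        rw [Set.uIcc_of_le hB0]; constructor <;> linarith [abs_nonneg R]))) (by
      filter_upwards [_root_.LocallyIntegrable.ae_hasDerivAt_integral hf] with x h2 _
      exact ((hφ.differentiable (by simp)) x).hasDerivAt.smul (h2 0))
  have e : ∫ x, (φ x • f x + deriv φ x • ∫ t in (0 : ℝ)..x, f t) = 0 := by
    rw [← intervalIntegral.integral_eq_integral_of_support_subset (a := -B) (b := B), key]
    · simp [hz B (by simp), hz (-B) (by simp)]
    · intro x hx
      by_contra h
      have hx' : x ∉ Set.Ioo (-B) B := fun h' => h ⟨h'.1, h'.2.le⟩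
      have h0 := hz x hx'
      refine hx ?_
      have hdz : deriv φ x = 0 := by
        by_contra h3
        have h4 := hR (support_deriv_subset h3)
        rw [Metric.mem_closedBall, Real.dist_eq, sub_zero] at h4
        have h2 := abs_le.1 (h4.trans (le_abs_self R))
        exact hx' ⟨by linarith [h2.1], by linarith [h2.2]⟩
      simp [h0, hdz]
  rw [integral_add i2 i1] at e
  exact eq_neg_of_add_eq_zero_right e

end Primitives

/-- One-sided limits along the almost-everywhere filter are unique. -/
theorem neBot_nhdsWithin_inf_ae {U : Set ℝ} (hU : IsOpen U) {x : ℝ} (hx : x ∈ closure U) :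
    NeBot (𝓝[U] x ⊓ ae (volume : Measure ℝ)) := by
  rw [inf_neBot_iff]
  intro s hs t ht
  obtain ⟨V, hV, hxV, hVs⟩ := mem_nhdsWithin.1 hs
  have hd : Dense t := Measure.dense_of_ae (p := fun z => z ∈ t) ht
  obtain ⟨z, hz, hzt⟩ := hd.inter_open_nonempty _ (hV.inter hU) (mem_closure_iff.1 hx V hV hxV)
  exact ⟨z, hVs hz, hzt⟩

theorem neBot_nhds_inf_ae (x : ℝ) : NeBot (𝓝 x ⊓ ae (volume : Measure ℝ)) := by
  simpa using neBot_nhdsWithin_inf_ae isOpen_univ (x := x) (by simp)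

theorem neBot_Iio_inf_ae (x : ℝ) : NeBot (𝓝[<] x ⊓ ae (volume : Measure ℝ)) :=
  neBot_nhdsWithin_inf_ae isOpen_Iio (by simp)

theorem neBot_Ioi_inf_ae (x : ℝ) : NeBot (𝓝[>] x ⊓ ae (volume : Measure ℝ)) :=
  neBot_nhdsWithin_inf_ae isOpen_Ioi (by simp)

/-- A function that is almost everywhere constant near each point of a preconnected open set is
almost everywhere constant on the set. -/
theorem exists_ae_eq_const_of_isPreconnected {F : Type*} [Nonempty F] {U : Set ℝ} (hU : IsOpen U)
    (hc : IsPreconnected U) (g : ℝ → F)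
    (h : ∀ x ∈ U, ∃ C, ∀ᶠ t in 𝓝 x ⊓ ae volume, g t = C) :
    ∃ C, ∀ᵐ t, t ∈ U → g t = C := by
  choose! C hC using h
  have hnb := neBot_nhds_inf_ae
  have hconst : ∀ x ∈ U, ∀ z ∈ U, C x = C z := by
    intro x hx z hz
    refine hc.induction₂ (fun x z => C x = C z) (fun x hx => ?_) (fun _ _ _ _ _ _ h1 h2 => h1.trans h2)
      (fun _ _ _ _ h => h.symm) hx hz
    obtain ⟨s, hs, t, ht, hst⟩ := mem_inf_iff_superset.1 (hC x hx)
    rw [nhdsWithin, eventually_inf_principal]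
    filter_upwards [eventually_mem_nhds_iff.2 hs] with z hz hzU
    have h1 : ∀ᶠ w in 𝓝 z ⊓ ae volume, g w = C x := by
      filter_upwards [inter_mem_inf hz ht] with w hw
      exact hst hw
    obtain ⟨w, h2, h3⟩ := (h1.and (hC z hzU)).exists
    exact h2.symm.trans h3
  rcases U.eq_empty_or_nonempty with rfl | ⟨x, hx⟩
  · exact ⟨Classical.arbitrary F, by simp⟩
  refine ⟨C x, ?_⟩
  rw [ae_iff]
  refine measure_null_of_locally_null _ fun z hz => ?_
  have hzU : z ∈ U := by by_contra h; exact hz fun h' => absurd h' h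
  obtain ⟨s, hs, t, ht, hst⟩ := mem_inf_iff_superset.1 (hC z hzU)
  refine ⟨_, inter_mem_nhdsWithin _ hs, measure_mono_null ?_ (mem_ae_iff.1 ht)⟩
  rintro w ⟨hw, hws⟩ hwt
  exact hw fun hwU => (hst ⟨hws, hwt⟩).trans (hconst z hzU x hx)

/-- The lemma of du Bois-Reymond, near a point. -/
theorem eventually_const_of_integral_deriv_smul_eq_zero {F : Type*} [NormedAddCommGroup F]
    [NormedSpace ℝ F] [CompleteSpace F] {g : ℝ → F} (hg : LocallyIntegrable g) {x r : ℝ}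
    (hr : 0 < r) (h : ∀ φ : ℝ → ℝ, ContDiff ℝ ∞ φ → HasCompactSupport φ →
      tsupport φ ⊆ Metric.ball x r → ∫ t, deriv φ t • g t = 0) :
    ∃ C, ∀ᶠ t in 𝓝 x ⊓ ae volume, g t = C := by
  let B : ContDiffBump x := ⟨r / 4, r / 2, by linarith, by linarith⟩
  set β : ℝ → ℝ := B.normed volume with hβ
  have hβd : ContDiff ℝ ∞ β := B.contDiff_normed
  have hβc : HasCompactSupport β := B.hasCompactSupport_normed
  have hβs : tsupport β ⊆ Metric.ball x r := by
    rw [hβ, B.tsupport_normed_eq]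
    exact Metric.closedBall_subset_ball (by change r / 2 < r; linarith)
  refine ⟨∫ t, β t • g t, ?_⟩
  have key : ∀ᵐ t, t ∈ Metric.ball x r → g t - (∫ t, β t • g t) = 0 := by
    refine Metric.isOpen_ball.ae_eq_zero_of_integral_contDiff_smul_eq_zero
      ((hg.sub (locallyIntegrable_const _)).locallyIntegrableOn _) ?_
    intro φ hφ hφc hφs
    obtain ⟨r', hr', hsub⟩ := exists_lt_subset_ball
      ((isClosed_tsupport φ).union (isClosed_tsupport β)) (Set.union_subset hφs hβs)
    -- `φ - m β` has mean zero, so it is the derivative of a test function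
    set m : ℝ := ∫ t, φ t with hm
    set ψ : ℝ → ℝ := fun t => φ t - m * β t with hψ
    have hψd : ContDiff ℝ ∞ ψ := hφ.sub (contDiff_const.mul hβd)
    have hiφ : Integrable φ := hφ.continuous.integrable_of_hasCompactSupport hφc
    have hiβ : Integrable β := hβd.continuous.integrable_of_hasCompactSupport hβc
    have hψi : Integrable ψ := hiφ.sub (hiβ.const_mul m)
    have hψ0 : ∫ t, ψ t = 0 := by
      rw [hψ, integral_sub hiφ (hiβ.const_mul m), integral_const_mul, hβ, B.integral_normed, ← hm]
      ring
    have hψz : ∀ t, t ∉ Metric.ball x r' → ψ t = 0 := by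
      intro t ht
      have h1 : φ t = 0 := image_eq_zero_of_notMem_tsupport fun h' => ht (hsub (Or.inl h'))
      have h2 : β t = 0 := image_eq_zero_of_notMem_tsupport fun h' => ht (hsub (Or.inr h'))
      simp [hψ, h1, h2]
    set η : ℝ → ℝ := fun t => ∫ s in (x - r')..t, ψ s with hη
    have hηd : ∀ t, HasDerivAt η (ψ t) t := fun t =>
      (hψd.continuous).integral_hasStrictDerivAt _ _ |>.hasDerivAt
    have hηd' : deriv η = ψ := funext fun t => (hηd t).deriv
    have hηs : ContDiff ℝ ∞ η := by
      rw [contDiff_infty_iff_deriv, hηd']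
      exact ⟨fun t => (hηd t).differentiableAt, hψd⟩
    have hηz : ∀ t, t ∉ Metric.closedBall x r' → η t = 0 := by
      intro t ht
      rw [Real.closedBall_eq_Icc, Set.mem_Icc, not_and_or, not_le, not_le] at ht
      rcases ht with ht | ht
      · rw [hη]
        simp only
        rw [intervalIntegral.integral_congr (g := fun _ => (0 : ℝ)), intervalIntegral.integral_zero]
        intro s hs
        rw [Set.uIcc_of_ge ht.le] at hs
        refine hψz s ?_
        rw [Real.ball_eq_Ioo]
        exact fun h' => absurd h'.1 (not_lt.2 hs.2)
      · rw [hη]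
        simp only
        rw [intervalIntegral.integral_eq_integral_of_support_subset, hψ0]
        intro s hs
        have : s ∈ Metric.ball x r' := by
          by_contra h'
          exact hs (hψz s h')
        rw [Real.ball_eq_Ioo] at this
        exact ⟨this.1, by linarith [this.2]⟩
    have hηc : HasCompactSupport η :=
      HasCompactSupport.intro (isCompact_closedBall x r') hηz
    have hηt : tsupport η ⊆ Metric.ball x r := by
      refine (closure_minimal ?_ Metric.isClosed_closedBall).trans
        (Metric.closedBall_subset_ball hr')
      intro t ht
      by_contra h'
      exact ht (hηz t h')
    have h0 := h η hηs hηc hηt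
    rw [hηd'] at h0
    have iφg := hg.integrable_smul_left_of_hasCompactSupport hφ.continuous hφc
    have iβg := hg.integrable_smul_left_of_hasCompactSupport hβd.continuous hβc
    simp only [hψ, sub_smul, mul_smul] at h0
    rw [integral_sub iφg (iβg.fun_smul m), integral_smul] at h0
    simp only [smul_sub]
    rw [integral_sub iφg (hiφ.smul_const _), integral_smul_const, h0]
  filter_upwards [mem_inf_of_left (Metric.ball_mem_nhds x hr), mem_inf_of_right key] with t h1 h2
  exact sub_eq_zero.1 (h2 h1)

theorem absolutelyContinuousOnInterval_inner {u v : ℝ → C2} {a b : ℝ}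
    (hu : AbsolutelyContinuousOnInterval u a b) (hv : AbsolutelyContinuousOnInterval v a b) :
    AbsolutelyContinuousOnInterval (fun t => inner ℂ (u t) (v t)) a b := by
  obtain ⟨C, hC⟩ := hu.exists_bound
  obtain ⟨D, hD⟩ := hv.exists_bound
  unfold AbsolutelyContinuousOnInterval at hu hv ⊢
  refine squeeze_zero' ?_ ?_ (by simpa using (hv.const_mul C).add (hu.const_mul D))
  · exact Filter.Eventually.of_forall fun _ => Finset.sum_nonneg fun i hi => dist_nonneg
  rw [eventually_inf_principal]
  filter_upwards with (n, I) hnI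
  simp only [Finset.mul_sum, ← Finset.sum_add_distrib]
  refine Finset.sum_le_sum fun i hi => ?_
  have h1 := hC _ ((hnI.left i hi).1)
  have h2 := hD _ ((hnI.left i hi).2)
  have e : inner ℂ (u (I i).1) (v (I i).1) - inner ℂ (u (I i).2) (v (I i).2) =
      inner ℂ (u (I i).1) (v (I i).1 - v (I i).2) +
        inner ℂ (u (I i).1 - u (I i).2) (v (I i).2) := by
    rw [inner_sub_left, inner_sub_right]
    ring
  rw [dist_eq_norm, e, dist_eq_norm, dist_eq_norm]
  refine (norm_add_le _ _).trans (add_le_add ?_ ?_)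
  · exact (norm_inner_le_norm _ _).trans (mul_le_mul_of_nonneg_right h1 (norm_nonneg _))
  · rw [mul_comm D]
    exact (norm_inner_le_norm _ _).trans (mul_le_mul_of_nonneg_left h2 (norm_nonneg _))

/-- The fundamental theorem of calculus for an integrable function `p` on the line that is
piecewise a primitive of the integrable function `q`: the integral of `q` is minus the sum of the
jumps of `p`. -/
theorem integral_eq_neg_sum_jumps {F : Type*} [NormedAddCommGroup F] [NormedSpace ℝ F]
    [CompleteSpace F] {n : ℕ} {y : Fin n → ℝ} (hy : Function.Injective y) {p q : ℝ → F}
    (hp : Integrable p) (hq : Integrable q)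
    (hloc : ∀ x ∉ Set.range y, ∃ C, ∀ᶠ t in 𝓝 x ⊓ ae volume, p t - ∫ s in (0 : ℝ)..t, q s = C)
    {α β : Fin n → F} (hα : ∀ k, Tendsto p (𝓝[<] (y k) ⊓ ae volume) (𝓝 (α k)))
    (hβ : ∀ k, Tendsto p (𝓝[>] (y k) ⊓ ae volume) (𝓝 (β k))) :
    ∫ t, q t = -∑ k, (β k - α k) := by
  set Q : ℝ → F := fun t => ∫ s in (0 : ℝ)..t, q s with hQ
  have hQc : Continuous Q := intervalIntegral.continuous_primitive
    (fun _ _ => hq.intervalIntegrable) 0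
  -- `p` is the primitive `Q` of `q` plus the step function `S` with the jumps of `p`, up to a constant
  set S : ℝ → F := fun t => ∑ k, if y k < t then β k - α k else 0 with hS
  set g : ℝ → F := fun t => p t - Q t - S t with hg
  have hSloc : ∀ x, x ∉ Set.range y → ∀ᶠ t in 𝓝 x, S t = S x := by
    intro x hx
    have : ∀ k, ∀ᶠ t in 𝓝 x, (y k < t ↔ y k < x) := by
      intro k
      rcases lt_or_gt_of_ne (fun h => hx ⟨k, h⟩ : y k ≠ x) with h | h
      · filter_upwards [eventually_gt_nhds h] with t ht
        simp [ht, h]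
      · filter_upwards [eventually_lt_nhds h] with t ht
        exact iff_of_false ht.not_gt h.not_gt
    filter_upwards [eventually_all.2 this] with t ht
    simp only [hS, ht]
  have hgloc : ∀ x, x ∉ Set.range y → ∃ C, ∀ᶠ t in 𝓝 x ⊓ ae volume, g t = C := by
    intro x hx
    obtain ⟨C, hC⟩ := hloc x hx
    refine ⟨C - S x, ?_⟩
    filter_upwards [hC, (hSloc x hx).filter_mono inf_le_left] with t h1 h2
    rw [hg]
    simp only
    rw [h1, h2]
  have hYc : IsClosed (Set.range y) := (Set.finite_range y).isClosed
  have hside : ∀ U : Set ℝ, IsOpen U → IsPreconnected U → U ⊆ (Set.range y)ᶜ →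
      ∃ C, ∀ᵐ t, t ∈ U → g t = C := fun U hU hUc hUs =>
    exists_ae_eq_const_of_isPreconnected hU hUc g fun x hx => hgloc x (hUs hx)
  have hgloc' : ∀ x, ∃ C, ∀ᶠ t in 𝓝 x ⊓ ae volume, g t = C := by
    intro x
    by_cases hx : x ∈ Set.range y
    swap
    · exact hgloc x hx
    obtain ⟨k, rfl⟩ := hx
    obtain ⟨r, hr, hrs⟩ : ∃ r > 0, ∀ t ∈ Set.range y, dist t (y k) < r → t = y k := by
      have hfin : (Set.range y \ {y k}).Finite := (Set.finite_range y).sdiff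
      have : (Set.range y \ {y k})ᶜ ∈ 𝓝 (y k) := hfin.isClosed.isOpen_compl.mem_nhds (by simp)
      obtain ⟨r, hr, hrs⟩ := Metric.mem_nhds_iff.1 this
      refine ⟨r, hr, fun t ht htr => ?_⟩
      by_contra hne
      exact hrs (Metric.mem_ball.2 htr) ⟨ht, hne⟩
    -- at `y k`, the constants on the two sides are both the common one-sided limit `L` of `g`
    obtain ⟨Cl, hCl⟩ := hside (Set.Ioo (y k - r) (y k)) isOpen_Ioo isPreconnected_Ioo (by
      intro t ht hty
      have := hrs t hty (by rw [Real.dist_eq, abs_lt]; constructor <;> linarith [ht.1, ht.2])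
      exact absurd this ht.2.ne)
    obtain ⟨Cr, hCr⟩ := hside (Set.Ioo (y k) (y k + r)) isOpen_Ioo isPreconnected_Ioo (by
      intro t ht hty
      have := hrs t hty (by rw [Real.dist_eq, abs_lt]; constructor <;> linarith [ht.1, ht.2])
      exact absurd this ht.1.ne')
    have hSl : ∀ᶠ t in 𝓝[<] (y k), S t = ∑ j, if y j < y k then β j - α j else 0 := by
      have : ∀ j, ∀ᶠ t in 𝓝[<] (y k), (y j < t ↔ y j < y k) := by
        intro j
        rcases lt_or_ge (y j) (y k) with h | h
        · filter_upwards [nhdsWithin_le_nhds (eventually_gt_nhds h)] with t ht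
          simp [ht, h]
        · filter_upwards [self_mem_nhdsWithin] with t ht
          exact iff_of_false (lt_of_lt_of_le ht h).not_gt h.not_gt
      filter_upwards [eventually_all.2 this] with t ht
      simp only [hS, ht]
    have hSr : ∀ᶠ t in 𝓝[>] (y k), S t = ∑ j, if y j ≤ y k then β j - α j else 0 := by
      have : ∀ j, ∀ᶠ t in 𝓝[>] (y k), (y j < t ↔ y j ≤ y k) := by
        intro j
        rcases le_or_gt (y j) (y k) with h | h
        · filter_upwards [self_mem_nhdsWithin] with t ht
          exact iff_of_true (lt_of_le_of_lt h ht) h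
        · filter_upwards [nhdsWithin_le_nhds (eventually_lt_nhds h)] with t ht
          exact iff_of_false ht.not_gt h.not_ge
      filter_upwards [eventually_all.2 this] with t ht
      simp only [hS, ht]
    have hjump : (∑ j, if y j ≤ y k then β j - α j else 0) =
        (∑ j, if y j < y k then β j - α j else 0) + (β k - α k) := by
      have : β k - α k = ∑ j, if j = k then β j - α j else 0 := by simp
      rw [this, ← Finset.sum_add_distrib]
      refine Finset.sum_congr rfl fun j _ => ?_
      rcases lt_trichotomy (y j) (y k) with h | h | h
      · have : j ≠ k := fun h' => h.ne (by rw [h'])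
        simp [h, h.le, this]
      · have := hy h
        subst this
        simp
      · have : j ≠ k := fun h' => h.ne' (by rw [h'])
        simp [h.not_ge, h.not_gt, this]
    set L := α k - Q (y k) - ∑ j, if y j < y k then β j - α j else 0 with hL
    have hnl := neBot_Iio_inf_ae (y k)
    have hnr := neBot_Ioi_inf_ae (y k)
    have hl : Tendsto g (𝓝[<] (y k) ⊓ ae volume) (𝓝 L) := by
      refine ((hα k).sub ((hQc.tendsto (y k)).mono_left (inf_le_left.trans nhdsWithin_le_nhds))).sub ?_
      exact tendsto_const_nhds.congr' ((hSl.filter_mono inf_le_left).mono fun t ht => ht.symm)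
    have hr' : Tendsto g (𝓝[>] (y k) ⊓ ae volume) (𝓝 L) := by
      have e : L = β k - Q (y k) - ∑ j, if y j ≤ y k then β j - α j else 0 := by
        rw [hjump, hL]
        abel
      rw [e]
      refine ((hβ k).sub ((hQc.tendsto (y k)).mono_left (inf_le_left.trans nhdsWithin_le_nhds))).sub ?_
      exact tendsto_const_nhds.congr' ((hSr.filter_mono inf_le_left).mono fun t ht => ht.symm)
    have el : Cl = L := by
      refine tendsto_nhds_unique (tendsto_const_nhds.congr' ?_) hl
      filter_upwards [mem_inf_of_left (Ioo_mem_nhdsLT (by linarith : y k - r < y k)),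
        mem_inf_of_right hCl] with t h1 h2
      exact (h2 h1).symm
    have er : Cr = L := by
      refine tendsto_nhds_unique (tendsto_const_nhds.congr' ?_) hr'
      filter_upwards [mem_inf_of_left (Ioo_mem_nhdsGT (by linarith : y k < y k + r)),
        mem_inf_of_right hCr] with t h1 h2
      exact (h2 h1).symm
    refine ⟨L, ?_⟩
    have hne : ∀ᵐ t, t ≠ y k := by simp [ae_iff, measure_singleton]
    filter_upwards [mem_inf_of_left (Ioo_mem_nhds (by linarith : y k - r < y k)
      (by linarith : y k < y k + r)), mem_inf_of_right hCl, mem_inf_of_right hCr,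
      mem_inf_of_right hne] with t h1 h2 h3 h4
    rcases lt_or_gt_of_ne h4 with h | h
    · exact (h2 ⟨h1.1, h⟩).trans el
    · exact (h3 ⟨h, h1.2⟩).trans er
  obtain ⟨C, hC⟩ := exists_ae_eq_const_of_isPreconnected isOpen_univ isPreconnected_univ g
    fun x _ => hgloc' x
  have hpe : p =ᵐ[volume] fun t => C + Q t + S t := by
    filter_upwards [hC] with t ht
    rw [← ht trivial, hg]
    simp only
    abel
  -- an integrable function with limits at `-∞` and `+∞` has the limits zero; subtract the two
  have hpi : Integrable fun t => C + Q t + S t := hp.congr hpe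
  have hbot : Tendsto (fun t => C + Q t + S t) atBot (𝓝 (C + -(∫ t in Set.Iic 0, q t) + 0)) := by
    refine (tendsto_const_nhds.add ?_).add ?_
    · have := (intervalIntegral_tendsto_integral_Iic (f := q) 0 hq.integrableOn tendsto_id).neg
      refine this.congr fun t => ?_
      rw [hQ]
      simp only [id]
      rw [intervalIntegral.integral_symm, neg_neg]
    · refine tendsto_const_nhds.congr' ?_
      filter_upwards [eventually_all.2 fun k => eventually_le_atBot (y k)] with t ht
      simp [hS, fun k => not_lt.2 (ht k)]
  have htop : Tendsto (fun t => C + Q t + S t) atTop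
      (𝓝 (C + (∫ t in Set.Ioi 0, q t) + ∑ k, (β k - α k))) := by
    refine (tendsto_const_nhds.add ?_).add ?_
    · exact intervalIntegral_tendsto_integral_Ioi (f := q) 0 hq.integrableOn tendsto_id
    · refine tendsto_const_nhds.congr' ?_
      filter_upwards [eventually_all.2 fun k => eventually_gt_atTop (y k)] with t ht
      simp [hS, ht]
  have h1 := IntegrableAtFilter.eq_zero_of_tendsto (hpi.integrableAtFilter atBot) (fun s hs => by
    obtain ⟨a, ha⟩ := mem_atBot_sets.1 hs
    exact measure_mono_top (fun t ht => ha t ht) (Real.volume_Iic (a := a))) hbot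
  have h2 := IntegrableAtFilter.eq_zero_of_tendsto (hpi.integrableAtFilter atTop) (fun s hs => by
    obtain ⟨a, ha⟩ := mem_atTop_sets.1 hs
    exact measure_mono_top (fun t ht => ha t ht) (Real.volume_Ici (a := a))) htop
  have h3 : (∫ t in Set.Iic 0, q t) + ∫ t in Set.Ioi 0, q t = ∫ t, q t :=
    intervalIntegral.integral_Iic_add_Ioi hq.integrableOn hq.integrableOn
  rw [← h3, eq_neg_iff_add_eq_zero]
  have h4 := congrArg₂ (· - ·) h2 h1
  simp only [sub_zero] at h4
  rw [← h4]
  abel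

theorem locallyIntegrable_L2 (Ψ : L2) : LocallyIntegrable Ψ volume :=
  (Lp.memLp Ψ).locallyIntegrable (by norm_num)

/-- Off `Y`, an element of `H¹(ℝ \ Y)` is locally a primitive of its weak derivative. -/
theorem HasWeakDeriv.eventually_sub_primitive_eq {Y : Set ℝ} (hY : IsClosed Y) {Ψ Φ : L2}
    (h : HasWeakDeriv Y Ψ Φ) {x : ℝ} (hx : x ∉ Y) :
    ∃ C, ∀ᶠ t in 𝓝 x ⊓ ae volume, Ψ t - ∫ s in (0 : ℝ)..t, Φ s = C := by
  obtain ⟨r, hr, hrs⟩ := Metric.isOpen_iff.1 hY.isOpen_compl x hx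
  have hΦ := locallyIntegrable_L2 Φ
  have hP : Continuous fun t => ∫ s in (0 : ℝ)..t, Φ s :=
    intervalIntegral.continuous_primitive hΦ.intervalIntegrable' 0
  refine eventually_const_of_integral_deriv_smul_eq_zero
    ((locallyIntegrable_L2 Ψ).sub hP.locallyIntegrable) hr fun φ hφ hc hs => ?_
  have hd : Continuous (deriv φ) := hφ.continuous_deriv (by simp)
  simp only [Pi.sub_apply, smul_sub]
  rw [integral_sub (integrable_smul_L2 hd hc.deriv Ψ)
    (hP.locallyIntegrable.integrable_smul_left_of_hasCompactSupport hd hc.deriv),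
    h φ hφ hc (hs.trans hrs), integral_deriv_smul_primitive hΦ hφ hc, sub_self]

theorem HasWeakDeriv.mono {Y Z : Set ℝ} (hYZ : Y ⊆ Z) {Ψ Φ : L2} (h : HasWeakDeriv Y Ψ Φ) :
    HasWeakDeriv Z Ψ Φ := fun φ hφ hc hs =>
  h φ hφ hc (hs.trans (Set.compl_subset_compl.2 hYZ))

/-- Elements of `H¹(ℝ)` are continuous. -/
theorem HasWeakDeriv.exists_hasTraces {n : ℕ} (y : Fin n → ℝ) {Ψ Φ : L2}
    (h : HasWeakDeriv ∅ Ψ Φ) : ∃ a, HasTraces y Ψ a a := by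
  have key : ∀ x : ℝ, ∃ c, Tendsto Ψ (𝓝 x ⊓ ae volume) (𝓝 c) := by
    intro x
    obtain ⟨C, hC⟩ := h.eventually_sub_primitive_eq isClosed_empty (Set.notMem_empty x)
    have hP : Continuous fun t => ∫ s in (0 : ℝ)..t, Φ s :=
      intervalIntegral.continuous_primitive (locallyIntegrable_L2 Φ).intervalIntegrable' 0
    refine ⟨_, ((tendsto_const_nhds (x := C)).add
      ((hP.tendsto x).mono_left inf_le_left)).congr' ?_⟩
    filter_upwards [hC] with t ht
    rw [← ht, sub_add_cancel]
  choose c hc using key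
  exact ⟨fun k => c (y k), fun k => ⟨(hc _).mono_left (inf_le_inf_right _ nhdsWithin_le_nhds),
    (hc _).mono_left (inf_le_inf_right _ nhdsWithin_le_nhds)⟩⟩

/-- Integration by parts on `ℝ \ Y`. -/
theorem HasWeakDeriv.inner_add_inner {n : ℕ} {y : Fin n → ℝ} (hy : Function.Injective y)
    {Ψ Φ Ψ' Φ' : L2} (h : HasWeakDeriv (Set.range y) Ψ Φ) (h' : HasWeakDeriv (Set.range y) Ψ' Φ')
    {a b a' b' : Fin n → C2} (ht : HasTraces y Ψ a b) (ht' : HasTraces y Ψ' a' b') :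
    inner ℂ Φ Ψ' + inner ℂ Ψ Φ' = -∑ k, (inner ℂ (b k) (b' k) - inner ℂ (a k) (a' k)) := by
  rw [L2.inner_def, L2.inner_def, ← integral_add (L2.integrable_inner _ _) (L2.integrable_inner _ _)]
  have hq : Integrable fun t => inner ℂ (Φ t) (Ψ' t) + inner ℂ (Ψ t) (Φ' t) :=
    (L2.integrable_inner _ _).add (L2.integrable_inner _ _)
  refine integral_eq_neg_sum_jumps hy (p := fun t => inner ℂ (Ψ t) (Ψ' t))
    (L2.integrable_inner _ _) hq ?_
    (fun k => (ht k).1.inner (ht' k).1) (fun k => (ht k).2.inner (ht' k).2)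
  intro x hx
  have hYc : IsClosed (Set.range y) := (Set.finite_range y).isClosed
  obtain ⟨C, hC⟩ := h.eventually_sub_primitive_eq hYc hx
  obtain ⟨C', hC'⟩ := h'.eventually_sub_primitive_eq hYc hx
  set P : ℝ → C2 := fun t => C + ∫ s in (0 : ℝ)..t, Φ s with hP
  set P' : ℝ → C2 := fun t => C' + ∫ s in (0 : ℝ)..t, Φ' s with hP'
  obtain ⟨s, hs, T, hT, hsT⟩ := mem_inf_iff_superset.1 (hC.and hC')
  obtain ⟨r, hr, hrs⟩ := Metric.mem_nhds_iff.1 hs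
  have hae : ∀ᵐ t, t ∈ Metric.ball x r → Ψ t = P t ∧ Ψ' t = P' t := by
    filter_upwards [hT] with t ht htr
    obtain ⟨h1, h2⟩ := hsT ⟨hrs htr, ht⟩
    exact ⟨by rw [hP, ← h1]; simp, by rw [hP', ← h2]; simp⟩
  have hAC : ∀ (C : C2) (Φ : L2) (a b : ℝ),
      AbsolutelyContinuousOnInterval (fun t => C + ∫ s in (0 : ℝ)..t, Φ s) a b := by
    intro C Φ a b
    have h1 : AbsolutelyContinuousOnInterval (fun t => C + ∫ s in (0 : ℝ)..t, Φ s)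
        (min a (min b 0)) (max a (max b 0)) :=
      ((contDiff_const (c := C)).contDiffOn.absolutelyContinuousOnInterval).add
        (absolutelyContinuousOnInterval_primitive (locallyIntegrable_L2 Φ) (by
          rw [Set.uIcc_of_le (by simp)]
          simp))
    refine h1.mono ?_
    rw [Set.uIcc_of_le (a := min a (min b 0)) (by simp)]
    exact Set.uIcc_subset_Icc (by simp) (by simp)
  refine ⟨inner ℂ (P x) (P' x) - ∫ s in (0 : ℝ)..x,
    (inner ℂ (Φ s) (Ψ' s) + inner ℂ (Ψ s) (Φ' s)), ?_⟩
  filter_upwards [mem_inf_of_left (Metric.ball_mem_nhds x hr), mem_inf_of_right hae] with t h1 h2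
  have key := integral_eq_sub_of_absolutelyContinuous hq.locallyIntegrable (a := x) (b := t)
    (absolutelyContinuousOnInterval_inner (hAC C Φ x t) (hAC C' Φ' x t)) (by
      filter_upwards [hae, _root_.LocallyIntegrable.ae_hasDerivAt_integral (locallyIntegrable_L2 Φ),
        _root_.LocallyIntegrable.ae_hasDerivAt_integral (locallyIntegrable_L2 Φ')] with s i1 i2 i3 i4
      have hsb : s ∈ Metric.ball x r := by
        rw [Real.ball_eq_Ioo] at h1 ⊢
        exact Set.OrdConnected.uIcc_subset Set.ordConnected_Ioo
          ⟨by linarith, by linarith⟩ h1 i4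
      obtain ⟨j1, j2⟩ := i1 hsb
      have := ((i2 0).const_add C).inner ℂ ((i3 0).const_add C')
      rw [j1, j2, add_comm]
      exact this)
  have e := intervalIntegral.integral_add_adjacent_intervals
    (hq.intervalIntegrable (a := 0) (b := x)) (hq.intervalIntegrable (a := x) (b := t))
  rw [← e, key, (h2 h1).1, (h2 h1).2]
  simp only [hP, hP']
  ring

/-! ### The resolvent of the derivative on the line -/

theorem integrable_smul_toLp {φ : ℝ → ℝ} (hφ : Continuous φ) (hc : HasCompactSupport φ)
    {f : ℝ → C2} (hf : MemLp f 2) : Integrable (fun x => φ x • f x) volume :=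
  (hf.locallyIntegrable (by norm_num)).integrable_smul_left_of_hasCompactSupport hφ hc

/-- A square integrable derivative off `Y` is a weak derivative on `ℝ \ Y`. -/
theorem hasWeakDeriv_toLp {Y : Set ℝ} {f f' : ℝ → C2} (hf : MemLp f 2)
    (hf' : MemLp f' 2) (hd : ∀ x ∉ Y, HasDerivAt f (f' x) x) :
    HasWeakDeriv Y (hf.toLp f) (hf'.toLp f') := by
  intro φ hφ hc hs
  have hdc : Continuous (deriv φ) := hφ.continuous_deriv (by simp)
  have e1 : ∫ x, deriv φ x • hf.toLp f x = ∫ x, deriv φ x • f x := by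
    refine integral_congr_ae ?_
    filter_upwards [hf.coeFn_toLp] with x hx
    rw [hx]
  have e2 : ∫ x, φ x • hf'.toLp f' x = ∫ x, φ x • f' x := by
    refine integral_congr_ae ?_
    filter_upwards [hf'.coeFn_toLp] with x hx
    rw [hx]
  rw [e1, e2, eq_neg_iff_add_eq_zero, add_comm]
  have i1 := integrable_smul_toLp hdc hc.deriv hf
  have i2 := integrable_smul_toLp hφ.continuous hc hf'
  rw [← integral_add i2 i1]
  refine integral_eq_zero_of_hasDerivAt_of_integrable (f := fun x => φ x • f x) (fun x => ?_)
    (i2.add i1) (integrable_smul_toLp hφ.continuous hc hf)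
  by_cases hx : x ∈ Y
  · have hx' : x ∉ tsupport φ := fun h => hs h hx
    have h0 : φ =ᶠ[𝓝 x] fun _ => 0 := notMem_tsupport_iff_eventuallyEq.1 hx'
    have h1 : deriv φ x = 0 := by rw [h0.deriv_eq]; simp
    rw [h0.self_of_nhds, h1, zero_smul, zero_smul, add_zero]
    refine (hasDerivAt_const x (0 : C2)).congr_of_eventuallyEq ?_
    filter_upwards [h0] with t ht
    rw [ht, zero_smul]
  · exact ((hφ.differentiable (by simp)) x).hasDerivAt.smul (hd x hx)

theorem hasTraces_toLp {n : ℕ} {y : Fin n → ℝ} {f : ℝ → C2} (hf : MemLp f 2) {a b : Fin n → C2}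
    (h : ∀ k, Tendsto f (𝓝[<] (y k)) (𝓝 (a k)) ∧ Tendsto f (𝓝[>] (y k)) (𝓝 (b k))) :
    HasTraces y (hf.toLp f) a b := fun k =>
  ⟨((h k).1.mono_left inf_le_left).congr' (hf.coeFn_toLp.symm.filter_mono inf_le_right),
    ((h k).2.mono_left inf_le_left).congr' (hf.coeFn_toLp.symm.filter_mono inf_le_right)⟩

theorem HasTraces.unique {n : ℕ} {y : Fin n → ℝ} {Ψ : L2} {a b a' b' : Fin n → C2}
    (h : HasTraces y Ψ a b) (h' : HasTraces y Ψ a' b') : a = a' ∧ b = b' := by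
  constructor <;> funext k
  · have := neBot_Iio_inf_ae (y k)
    exact tendsto_nhds_unique (h k).1 (h' k).1
  · have := neBot_Ioi_inf_ae (y k)
    exact tendsto_nhds_unique (h k).2 (h' k).2

theorem memLp_smul_const {φ : ℝ → ℝ} (hφ : Continuous φ) (hc : HasCompactSupport φ) (v : C2) :
    MemLp (fun x => φ x • v) 2 :=
  (hφ.smul continuous_const).memLp_of_hasCompactSupport hc.smul_right

theorem inner_toLp_smul_const {φ : ℝ → ℝ} (hφ : Continuous φ) (hc : HasCompactSupport φ) (v : C2)
    (Ψ : L2) :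
    inner ℂ ((memLp_smul_const hφ hc v).toLp _) Ψ = inner ℂ v (∫ x, φ x • Ψ x) := by
  rw [L2.inner_def, ← integral_inner (integrable_smul_L2 hφ hc Ψ) v]
  refine integral_congr_ae ?_
  filter_upwards [(memLp_smul_const hφ hc v).coeFn_toLp] with x hx
  rw [hx, inner_smul_left_eq_star_smul, inner_smul_right_eq_smul]
  simp

/-- The weak derivative on `ℝ \ Y`, tested in the inner product of `L²`. -/
theorem hasWeakDeriv_iff_inner {Y : Set ℝ} {Ψ Φ : L2} :
    HasWeakDeriv Y Ψ Φ ↔ ∀ (φ : ℝ → ℝ) (hφ : ContDiff ℝ ∞ φ) (hc : HasCompactSupport φ),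
      tsupport φ ⊆ Yᶜ → ∀ v : C2,
      inner ℂ ((memLp_smul_const (hφ.continuous_deriv (by simp)) hc.deriv v).toLp _) Ψ =
        -inner ℂ ((memLp_smul_const hφ.continuous hc v).toLp _) Φ := by
  refine forall_congr' fun φ => ⟨fun h hφ hc hs v => ?_, fun h hφ hc hs => ?_⟩
  · rw [inner_toLp_smul_const hφ.continuous hc,
      inner_toLp_smul_const (hφ.continuous_deriv (by simp)) hc.deriv, h hφ hc hs, inner_neg_right]
  · refine ext_inner_left ℂ fun v => ?_
    have := h hφ hc hs v
    rwa [inner_toLp_smul_const hφ.continuous hc,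
      inner_toLp_smul_const (hφ.continuous_deriv (by simp)) hc.deriv, ← inner_neg_right] at this

/-- The graph of the weak derivative on `ℝ \ Y`. -/
def weakGraph (Y : Set ℝ) : Submodule ℂ (L2 × L2) where
  carrier := {p | HasWeakDeriv Y p.1 p.2}
  add_mem' := fun h h' => h.add h'
  zero_mem' := by
    rw [Set.mem_ofPred_eq, hasWeakDeriv_iff_inner]
    simp
  smul_mem' := fun c _ h => h.smul c

theorem isClosed_weakGraph (Y : Set ℝ) : IsClosed (weakGraph Y : Set (L2 × L2)) := by
  have : (weakGraph Y : Set (L2 × L2)) = {p | HasWeakDeriv Y p.1 p.2} := rfl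
  rw [this]
  simp only [hasWeakDeriv_iff_inner, Set.ofPred_forall]
  refine isClosed_iInter fun φ => isClosed_iInter fun hφ => isClosed_iInter fun hc =>
    isClosed_iInter fun _ => isClosed_iInter fun v => isClosed_eq ?_ ?_
  · exact continuous_const.inner continuous_fst
  · exact (continuous_const.inner continuous_snd).neg

/-- The derivative on the line is skew-symmetric. -/
theorem HasWeakDeriv.inner_add_inner_empty {Ψ Φ Ψ' Φ' : L2} (h : HasWeakDeriv ∅ Ψ Φ)
    (h' : HasWeakDeriv ∅ Ψ' Φ') : inner ℂ Φ Ψ' + inner ℂ Ψ Φ' = 0 := by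
  have e : Set.range (Fin.elim0 : Fin 0 → ℝ) = ∅ := Set.range_eq_empty _
  rw [← e] at h h'
  simpa using h.inner_add_inner (Function.injective_of_subsingleton _) h'
    (a := Fin.elim0) (b := Fin.elim0) (a' := Fin.elim0) (b' := Fin.elim0)
    (fun k => k.elim0) (fun k => k.elim0)

theorem HasWeakDeriv.re_inner_eq_zero {Ψ Φ : L2} (h : HasWeakDeriv ∅ Ψ Φ) :
    (inner ℂ Ψ Φ : ℂ).re = 0 := by
  have h1 := congrArg Complex.re (h.inner_add_inner_empty h)
  rw [← inner_conj_symm] at h1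
  simp only [Complex.add_re, Complex.conj_re, Complex.zero_re] at h1
  linarith

/-- As `d/dx` is skew-symmetric, `d/dx - c` is bounded below by `|Re c|`. -/
theorem HasWeakDeriv.abs_re_mul_norm_le {Ψ Φ : L2} (h : HasWeakDeriv ∅ Ψ Φ) (c : ℂ) :
    |c.re| * ‖Ψ‖ ≤ ‖Φ - c • Ψ‖ := by
  rcases eq_or_ne Ψ 0 with rfl | hΨ
  · simp
  have hpos : 0 < ‖Ψ‖ := norm_pos_iff.2 hΨ
  have h1 : (inner ℂ Ψ (Φ - c • Ψ) : ℂ).re = -(c.re * ‖Ψ‖ ^ 2) := by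
    rw [inner_sub_right, inner_smul_right, inner_self_eq_norm_sq_to_K, Complex.sub_re,
      h.re_inner_eq_zero]
    have : (c * ((‖Ψ‖ : ℝ) : ℂ) ^ 2).re = c.re * ‖Ψ‖ ^ 2 := by
      rw [← Complex.ofReal_pow, Complex.re_mul_ofReal]
    rw [zero_sub, ← this]
    rfl
  have h2 : |c.re| * ‖Ψ‖ ^ 2 ≤ ‖Ψ‖ * ‖Φ - c • Ψ‖ := by
    have h3 := (Complex.abs_re_le_norm _).trans (norm_inner_le_norm (𝕜 := ℂ) Ψ (Φ - c • Ψ))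
    rwa [h1, abs_neg, abs_mul, abs_of_nonneg (sq_nonneg ‖Ψ‖)] at h3
  nlinarith

/-- `d/dx - c` is boundedly invertible on the line if `Re c ≠ 0`: its range is closed, because the
derivative is closed and skew-symmetric, and its orthogonal complement consists of the solutions of
`Ψ' = -c̄ Ψ`. -/
theorem exists_resolvent_deriv {c : ℂ} (hc : c.re ≠ 0) :
    ∃ S : L2 →L[ℂ] L2, ∀ f, HasWeakDeriv ∅ (S f) (f + c • S f) := by
  let G := weakGraph ∅
  have : CompleteSpace G := (isClosed_weakGraph ∅).completeSpace_coe
  let T : G →L[ℂ] L2 := (ContinuousLinearMap.snd ℂ L2 L2 - c • ContinuousLinearMap.fst ℂ L2 L2) ∘L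
    G.subtypeL
  have hT : ∀ p : G, T p = (p : L2 × L2).2 - c • (p : L2 × L2).1 := fun p => rfl
  have hanti : ∀ p : G, ‖p‖ ≤ (1 + (1 + ‖c‖) / |c.re|) * ‖T p‖ := by
    intro p
    have h1 := HasWeakDeriv.abs_re_mul_norm_le (show HasWeakDeriv ∅ _ _ from p.2) c
    rw [← hT] at h1
    have hc' : 0 < |c.re| := abs_pos.2 hc
    have h2 : ‖(p : L2 × L2).1‖ ≤ ‖T p‖ / |c.re| := by
      rw [le_div_iff₀ hc', mul_comm]
      exact h1
    have h3 : ‖(p : L2 × L2).2‖ ≤ ‖T p‖ + ‖c‖ * (‖T p‖ / |c.re|) := by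
      have : (p : L2 × L2).2 = T p + c • (p : L2 × L2).1 := by rw [hT]; simp
      rw [this]
      refine (norm_add_le _ _).trans (add_le_add le_rfl ?_)
      rw [norm_smul]
      exact mul_le_mul_of_nonneg_left h2 (norm_nonneg _)
    have h0 := norm_nonneg (T p)
    have h5 : 0 ≤ ‖T p‖ / |c.re| := by positivity
    have h4 : (1 + (1 + ‖c‖) / |c.re|) * ‖T p‖ =
        ‖T p‖ + ‖T p‖ / |c.re| + ‖c‖ * (‖T p‖ / |c.re|) := by
      field_simp
      ring
    rw [h4, Submodule.coe_norm, Prod.norm_def]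
    have h6 : 0 ≤ ‖c‖ * (‖T p‖ / |c.re|) := by positivity
    exact max_le (by linarith) (by linarith)
  have hA := AddMonoidHomClass.antilipschitz_of_bound T
    (K := ⟨1 + (1 + ‖c‖) / |c.re|, by positivity⟩) hanti
  have hcl : IsClosed (T.range : Set L2) := hA.isClosed_range T.uniformContinuous
  have hbot : (T.range)ᗮ = ⊥ := by
    rw [Submodule.eq_bot_iff]
    intro v hv
    rw [Submodule.mem_orthogonal] at hv
    have hw : HasWeakDeriv ∅ v ((-(starRingEnd ℂ) c) • v) := by
      rw [hasWeakDeriv_iff_inner]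
      intro φ hφ hcs _ e
      have hm : ((memLp_smul_const hφ.continuous hcs e).toLp _,
          (memLp_smul_const (hφ.continuous_deriv (by simp)) hcs.deriv e).toLp _) ∈ G :=
        hasWeakDeriv_toLp (memLp_smul_const hφ.continuous hcs e)
          (memLp_smul_const (hφ.continuous_deriv (by simp)) hcs.deriv e) fun x _ =>
          ((hφ.differentiable (by simp)) x).hasDerivAt.smul_const e
      have := hv _ ⟨⟨_, hm⟩, rfl⟩
      rw [ContinuousLinearMap.coe_coe, hT, inner_sub_left, inner_smul_left, sub_eq_zero] at this
      rw [inner_smul_right, neg_mul, neg_neg]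
      exact this
    have h1 := hw.re_inner_eq_zero
    rw [inner_smul_right, inner_self_eq_norm_sq_to_K] at h1
    have h2 : -c.re * ‖v‖ ^ 2 = 0 := by
      have : ((-(starRingEnd ℂ) c) * ((‖v‖ : ℝ) : ℂ) ^ 2).re = -c.re * ‖v‖ ^ 2 := by
        rw [← Complex.ofReal_pow, Complex.re_mul_ofReal]
        simp
      rw [← this]
      exact h1
    have h3 : ‖v‖ ^ 2 = 0 := by
      rcases mul_eq_zero.1 h2 with h | h
      · exact absurd (neg_eq_zero.1 h) hc
      · exact h
    exact norm_eq_zero.1 (pow_eq_zero_iff two_ne_zero |>.1 h3)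
  have htop : T.range = ⊤ := by
    have : CompleteSpace T.range := hcl.completeSpace_coe
    exact Submodule.orthogonal_eq_bot_iff.1 hbot
  let e := ContinuousLinearEquiv.ofBijective T (LinearMap.ker_eq_bot.2 hA.injective) htop
  refine ⟨ContinuousLinearMap.fst ℂ L2 L2 ∘L G.subtypeL ∘L e.symm, fun f => ?_⟩
  have h1 : T (e.symm f) = f := e.apply_symm_apply f
  have h2 : f + c • ((e.symm f : G) : L2 × L2).1 = ((e.symm f : G) : L2 × L2).2 := by
    nth_rewrite 1 [← h1]
    rw [hT]
    simp
  change HasWeakDeriv ∅ ((e.symm f : G) : L2 × L2).1 (f + c • ((e.symm f : G) : L2 × L2).1)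
  rw [h2]
  exact (e.symm f).2

/-- `U = (d²/dx² + w)⁻¹` and `V = d/dx (d²/dx² + w)⁻¹` are bounded for `w` outside `[0, ∞)`, because
`d²/dx² + w = (d/dx + i √w) (d/dx - i √w)`. -/
theorem exists_resolvent_second_deriv {w : ℂ} (hw : ∀ x : ℝ, 0 ≤ x → w ≠ x) :
    ∃ U V : L2 →L[ℂ] L2, ∀ f, HasWeakDeriv ∅ (U f) (V f) ∧
      HasWeakDeriv ∅ (V f) (f - w • U f) := by
  have him := upperSqrt_im_pos hw
  have hsq := upperSqrt_sq w
  set κ := upperSqrt w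
  obtain ⟨S, hS⟩ := exists_resolvent_deriv (c := Complex.I * κ) (by simpa using him.ne')
  obtain ⟨S', hS'⟩ := exists_resolvent_deriv (c := -(Complex.I * κ)) (by simpa using him.ne')
  refine ⟨S ∘L S', S' + (Complex.I * κ) • (S ∘L S'), fun f => ⟨hS (S' f), ?_⟩⟩
  have h := (hS' f).add ((hS (S' f)).smul (Complex.I * κ))
  change HasWeakDeriv ∅ (S' f + (Complex.I * κ) • S (S' f)) (f - w • S (S' f))
  convert h using 1
  simp only [smul_add, smul_smul, neg_smul]
  have e : Complex.I * κ * (Complex.I * κ) = -w := by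
    rw [← hsq]
    linear_combination κ ^ 2 * Complex.I_mul_I
  rw [e, neg_smul]
  abel

/-! ### Constant matrices acting on spinors -/

theorem matOp_toLp (M : Matrix (Fin 2) (Fin 2) ℂ) {f : ℝ → C2} (hf : MemLp f 2)
    (hg : MemLp (fun x => Matrix.toEuclideanCLM (n := Fin 2) (𝕜 := ℂ) M (f x)) 2) :
    matOp M (hf.toLp f) = hg.toLp _ := by
  refine Lp.ext ?_
  filter_upwards [(Matrix.toEuclideanCLM (n := Fin 2) (𝕜 := ℂ) M).coeFn_compLpL (hf.toLp f),
    hf.coeFn_toLp, hg.coeFn_toLp] with x h1 h2 h3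
  rw [h3, ← h2]
  exact h1

theorem matOp_comp (M N : Matrix (Fin 2) (Fin 2) ℂ) (Ψ : L2) :
    matOp M (matOp N Ψ) = matOp (M * N) Ψ := by
  refine Lp.ext ?_
  filter_upwards [(Matrix.toEuclideanCLM (n := Fin 2) (𝕜 := ℂ) M).coeFn_compLpL (matOp N Ψ),
    (Matrix.toEuclideanCLM (n := Fin 2) (𝕜 := ℂ) N).coeFn_compLpL Ψ,
    (Matrix.toEuclideanCLM (n := Fin 2) (𝕜 := ℂ) (M * N)).coeFn_compLpL Ψ] with x h1 h2 h3
  have e1 : (matOp M (matOp N Ψ)) x = Matrix.toEuclideanCLM (n := Fin 2) (𝕜 := ℂ) M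
      (Matrix.toEuclideanCLM (n := Fin 2) (𝕜 := ℂ) N (Ψ x)) := h1.trans (congrArg _ h2)
  rw [e1, show (matOp (M * N) Ψ) x = _ from h3, map_mul]
  rfl

theorem matOp_add (M N : Matrix (Fin 2) (Fin 2) ℂ) (Ψ : L2) :
    matOp (M + N) Ψ = matOp M Ψ + matOp N Ψ := by
  refine Lp.ext ?_
  filter_upwards [(Matrix.toEuclideanCLM (n := Fin 2) (𝕜 := ℂ) M).coeFn_compLpL Ψ,
    (Matrix.toEuclideanCLM (n := Fin 2) (𝕜 := ℂ) N).coeFn_compLpL Ψ,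
    (Matrix.toEuclideanCLM (n := Fin 2) (𝕜 := ℂ) (M + N)).coeFn_compLpL Ψ,
    Lp.coeFn_add (matOp M Ψ) (matOp N Ψ)] with x h1 h2 h3 h4
  rw [h4, show (matOp (M + N) Ψ) x = _ from h3, Pi.add_apply, show (matOp M Ψ) x = _ from h1,
    show (matOp N Ψ) x = _ from h2, map_add]
  rfl

theorem matOp_one (Ψ : L2) : matOp 1 Ψ = Ψ := by
  refine Lp.ext ?_
  filter_upwards [(Matrix.toEuclideanCLM (n := Fin 2) (𝕜 := ℂ) 1).coeFn_compLpL Ψ] with x h1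
  rw [show (matOp 1 Ψ) x = _ from h1, map_one]
  rfl

theorem matOp_zero (Ψ : L2) : matOp 0 Ψ = 0 := by
  have h := matOp_add 0 0 Ψ
  rw [add_zero] at h
  simpa using h.symm

theorem inner_matOp_left {M : Matrix (Fin 2) (Fin 2) ℂ} (hM : M.IsHermitian) (Ψ Φ : L2) :
    inner ℂ (matOp M Ψ) Φ = inner ℂ Ψ (matOp M Φ) := by
  rw [L2.inner_def, L2.inner_def]
  refine integral_congr_ae ?_
  filter_upwards [(Matrix.toEuclideanCLM (n := Fin 2) (𝕜 := ℂ) M).coeFn_compLpL Ψ,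
    (Matrix.toEuclideanCLM (n := Fin 2) (𝕜 := ℂ) M).coeFn_compLpL Φ] with x h1 h2
  rw [show (matOp M Ψ) x = _ from h1, show (matOp M Φ) x = _ from h2]
  have h3 := (Matrix.isSymmetric_toEuclideanLin_iff.2 hM) (Ψ x) (Φ x)
  exact h3

theorem HasWeakDeriv.matOp {Y : Set ℝ} {Ψ Φ : L2} (h : HasWeakDeriv Y Ψ Φ)
    (M : Matrix (Fin 2) (Fin 2) ℂ) :
    HasWeakDeriv Y (PointInteraction.matOp M Ψ) (PointInteraction.matOp M Φ) := by
  set L := Matrix.toEuclideanCLM (n := Fin 2) (𝕜 := ℂ) M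
  have key : ∀ (f : ℝ → ℝ) (Ψ : L2), Continuous f → HasCompactSupport f →
      ∫ x, f x • (PointInteraction.matOp M Ψ) x = L (∫ x, f x • Ψ x) := by
    intro f Ψ hf hc
    rw [← L.integral_comp_comm (integrable_smul_L2 hf hc Ψ)]
    refine integral_congr_ae ?_
    filter_upwards [L.coeFn_compLpL Ψ] with x hx
    rw [show (PointInteraction.matOp M Ψ) x = _ from hx]
    exact (L.map_smul_of_tower _ _).symm
  intro φ hφ hc hs
  rw [key _ _ (hφ.continuous_deriv (by simp)) hc.deriv, key _ _ hφ.continuous hc, h φ hφ hc hs,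
    map_neg]

theorem HasTraces.matOp {n : ℕ} {y : Fin n → ℝ} {Ψ : L2} {a b : Fin n → C2}
    (h : HasTraces y Ψ a b) (M : Matrix (Fin 2) (Fin 2) ℂ) :
    HasTraces y (PointInteraction.matOp M Ψ)
      (fun k => Matrix.toEuclideanCLM (n := Fin 2) (𝕜 := ℂ) M (a k))
      (fun k => Matrix.toEuclideanCLM (n := Fin 2) (𝕜 := ℂ) M (b k)) := by
  set L := Matrix.toEuclideanCLM (n := Fin 2) (𝕜 := ℂ) M
  intro k
  exact ⟨((L.continuous.tendsto _).comp (h k).1).congr'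
      ((L.coeFn_compLpL Ψ).symm.filter_mono inf_le_right),
    ((L.continuous.tendsto _).comp (h k).2).congr'
      ((L.coeFn_compLpL Ψ).symm.filter_mono inf_le_right)⟩

/-! ### Slowly modulated plane waves -/

/-- The function `h((x - s) / N) e^{ikx} v`. -/
def wave (h : ℝ → ℝ) (k s N : ℝ) (v : C2) (x : ℝ) : C2 :=
  ((h ((x - s) / N) : ℂ) * Complex.exp (Complex.I * k * x)) • v

theorem memLp_wave {h : ℝ → ℝ} (hh : Continuous h) (hc : HasCompactSupport h) (k s : ℝ) {N : ℝ}
    (hN : 0 < N) (v : C2) : MemLp (wave h k s N v) 2 := by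
  have hcont : Continuous (wave h k s N v) := by
    unfold wave
    fun_prop
  refine hcont.memLp_of_hasCompactSupport ?_
  have h1 : HasCompactSupport fun x : ℝ => h ((x - s) / N) := by
    have := hc.comp_homeomorph ((Homeomorph.subRight s).trans (Homeomorph.mulRight₀ N⁻¹ (inv_ne_zero hN.ne')))
    simpa [Function.comp_def, div_eq_mul_inv] using this
  refine h1.mono' (fun x hx => ?_)
  refine subset_tsupport _ fun h0 => hx ?_
  simp [wave, h0]

theorem hasDerivAt_wave {h : ℝ → ℝ} (hh : Differentiable ℝ h) (k s N : ℝ) (v : C2) (x : ℝ) :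
    HasDerivAt (wave h k s N v)
      ((Complex.I * k) • wave h k s N v x + (N⁻¹ : ℂ) • wave (deriv h) k s N v x) x := by
  have h1 : HasDerivAt (fun x : ℝ => h ((x - s) / N)) (deriv h ((x - s) / N) * (1 / N)) x :=
    (hh _).hasDerivAt.comp x (((hasDerivAt_id x).sub_const s).div_const N)
  have h2 : HasDerivAt (fun x : ℝ => Complex.exp (Complex.I * k * x))
      (Complex.exp (Complex.I * k * x) * (Complex.I * k * 1)) x :=
    (((hasDerivAt_id x).ofReal_comp).const_mul (Complex.I * k)).cexp
  have h3 := (h1.ofReal_comp.mul h2).smul_const v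
  refine h3.congr_deriv ?_
  simp only [wave, smul_smul, ← add_smul]
  congr 1
  push_cast
  ring

theorem norm_sq_toLp {f : ℝ → C2} (hf : MemLp f 2) : ‖hf.toLp f‖ ^ 2 = ∫ x, ‖f x‖ ^ 2 := by
  have h1 : (inner ℂ (hf.toLp f) (hf.toLp f) : ℂ) = ((∫ x, ‖f x‖ ^ 2 : ℝ) : ℂ) := by
    rw [L2.inner_def, ← integral_complex_ofReal]
    refine integral_congr_ae ?_
    filter_upwards [hf.coeFn_toLp] with x hx
    rw [hx, inner_self_eq_norm_sq_to_K]
    norm_cast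
  rw [inner_self_eq_norm_sq_to_K] at h1
  exact Complex.ofReal_injective (by rw [← h1, Complex.ofReal_pow]; rfl)

theorem norm_sq_toLp_wave {h : ℝ → ℝ} {k s N : ℝ} (hN : 0 < N) {v : C2}
    (hf : MemLp (wave h k s N v) 2) :
    ‖hf.toLp _‖ ^ 2 = N * (∫ x, h x ^ 2) * ‖v‖ ^ 2 := by
  have e : ∀ x, ‖wave h k s N v x‖ ^ 2 = h ((x - s) / N) ^ 2 * ‖v‖ ^ 2 := by
    intro x
    have : ‖Complex.exp (Complex.I * k * x)‖ = 1 := by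
      rw [Complex.norm_exp]
      simp
    rw [wave, norm_smul, norm_mul, this, mul_one, mul_pow, Complex.norm_real, Real.norm_eq_abs,
      sq_abs]
  rw [norm_sq_toLp]
  simp only [e]
  rw [integral_mul_const, integral_sub_right_eq_self (fun x => h (x / N) ^ 2),
    Measure.integral_comp_div (fun x => h x ^ 2), abs_of_pos hN, smul_eq_mul]

theorem hasTraces_wave {h : ℝ → ℝ} {k s N M : ℝ} (hN : 0 < N) (hs : M + 2 * N < s) {v : C2}
    (hh : ∀ t < -2, h t = 0) (hf : MemLp (wave h k s N v) 2) {n : ℕ} {y : Fin n → ℝ}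
    (hy : ∀ k, y k ≤ M) : HasTraces y (hf.toLp _) 0 0 := by
  refine hasTraces_toLp hf fun j => ?_
  have h0 : (fun _ => (0 : C2)) =ᶠ[𝓝 (y j)] wave h k s N v := by
    have : y j < s - 2 * N := by linarith [hy j]
    filter_upwards [eventually_lt_nhds this] with x hx
    rw [wave, hh _ (by rw [div_lt_iff₀ hN]; linarith)]
    simp
  exact ⟨(tendsto_const_nhds.congr' h0).mono_left nhdsWithin_le_nhds,
    (tendsto_const_nhds.congr' h0).mono_left nhdsWithin_le_nhds⟩

/-- Plane waves `e^{ikx} v`, modulated slowly enough, and supported to the right of `M`: they are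
almost solutions of `Ψ' = ik Ψ`. -/
theorem exists_wave (k M : ℝ) {ε : ℝ} (hε : 0 < ε) :
    ∃ W W₁ W₂ : C2 → L2,
      (∀ v, HasWeakDeriv ∅ (W v) ((Complex.I * k) • W v + W₁ v)) ∧
      (∀ v, HasWeakDeriv ∅ (W₁ v) ((Complex.I * k) • W₁ v + W₂ v)) ∧
      (∀ v (n : ℕ) (y : Fin n → ℝ), (∀ j, y j ≤ M) →
        HasTraces y (W v) 0 0 ∧ HasTraces y (W₁ v) 0 0) ∧
      (∀ A v, matOp A (W v) = W (Matrix.toEuclideanCLM (n := Fin 2) (𝕜 := ℂ) A v)) ∧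
      (∀ v, ‖W₁ v‖ ≤ ε * ‖W v‖) ∧ (∀ v, ‖W₂ v‖ ≤ ε * ‖W v‖) ∧ ∀ v, W v = 0 → v = 0 := by
  let B : ContDiffBump (0 : ℝ) := ⟨1, 2, one_pos, one_lt_two⟩
  set h : ℝ → ℝ := fun x => B x with hB
  have hd : ContDiff ℝ ∞ h := B.contDiff
  have hd1 : ContDiff ℝ ∞ (deriv h) := (contDiff_infty_iff_deriv.1 hd).2
  have hd2 : ContDiff ℝ ∞ (deriv (deriv h)) := (contDiff_infty_iff_deriv.1 hd1).2
  have hc : HasCompactSupport h := B.hasCompactSupport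
  have hz : ∀ t < -2, h t = 0 := fun t ht => by
    refine B.zero_of_le_dist ?_
    rw [Real.dist_eq, sub_zero, abs_of_neg (by linarith)]
    change 2 ≤ -t
    linarith
  have hz1 : ∀ t < -2, deriv h t = 0 := fun t ht => by
    have : h =ᶠ[𝓝 t] fun _ => 0 := by
      filter_upwards [eventually_lt_nhds ht] with x hx
      exact hz x hx
    rw [this.deriv_eq]
    simp
  set I₀ := ∫ x, h x ^ 2 with hI₀
  set I₁ := ∫ x, deriv h x ^ 2 with hI₁
  set I₂ := ∫ x, deriv (deriv h) x ^ 2 with hI₂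
  have hI₀pos : 0 < I₀ := by
    have hcont : Continuous fun x => h x ^ 2 := hd.continuous.pow 2
    refine hcont.integral_pos_of_hasCompactSupport_nonneg_nonzero ?_ (fun x => sq_nonneg _) (x := 0) ?_
    · exact hc.comp_left (g := fun t : ℝ => t ^ 2) (by simp)
    · have : h 0 = 1 := B.one_of_mem_closedBall (by simp [B.rIn_pos.le])
      simp [this]
  have hI₁0 : 0 ≤ I₁ := integral_nonneg fun x => sq_nonneg _
  have hI₂0 : 0 ≤ I₂ := integral_nonneg fun x => sq_nonneg _
  -- scaling the bump `h` by `N` multiplies the norm of `h'` relative to that of `h` by `N⁻¹`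
  obtain ⟨N, hN1, hNε₁, hNε₂⟩ : ∃ N : ℝ, 1 ≤ N ∧ I₁ / I₀ / ε ^ 2 ≤ N ∧ I₂ / I₀ / ε ^ 2 ≤ N :=
    ⟨max 1 (max _ _), le_max_left _ _, (le_max_left _ _).trans (le_max_right _ _),
      (le_max_right _ _).trans (le_max_right _ _)⟩
  have hN : 0 < N := by linarith
  -- the support `[s - 2N, s + 2N]` lies to the right of `M`
  set s := M + 2 * N + 1 with hs
  have hm := fun v => memLp_wave hd.continuous hc k s hN v
  have hm1 := fun v => memLp_wave hd1.continuous hc.deriv k s hN v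
  have hm2 := fun v => memLp_wave hd2.continuous hc.deriv.deriv k s hN v
  have hN2 : N ≤ N ^ 2 := by nlinarith
  have hder : ∀ (g : ℝ → ℝ) (hg : Differentiable ℝ g) (v : C2) (c : ℂ)
      (m : MemLp (wave g k s N v) 2) (m1 : MemLp (wave (deriv g) k s N v) 2),
      HasWeakDeriv ∅ (c • m.toLp _)
        ((Complex.I * k) • (c • m.toLp _) + c • (N⁻¹ : ℂ) • m1.toLp _) := by
    intro g hg v c m m1
    have := (hasWeakDeriv_toLp (Y := ∅) m ((m.const_smul (Complex.I * k)).add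
      (m1.const_smul (N⁻¹ : ℂ))) fun x _ => hasDerivAt_wave hg k s N v x).smul c
    rw [MemLp.toLp_add (m.const_smul _) (m1.const_smul _), MemLp.toLp_const_smul,
      MemLp.toLp_const_smul, smul_add,
      smul_comm c (Complex.I * (k : ℂ))] at this
    exact this
  refine ⟨fun v => (hm v).toLp _, fun v => (N⁻¹ : ℂ) • (hm1 v).toLp _,
    fun v => (N⁻¹ : ℂ) • (N⁻¹ : ℂ) • (hm2 v).toLp _, fun v => ?_, fun v => ?_, fun v n y hy => ?_,
    fun A v => ?_, fun v => ?_, fun v => ?_, fun v hv => ?_⟩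
  · simpa using hder h (hd.differentiable (by simp)) v 1 (hm v) (hm1 v)
  · exact hder (deriv h) (hd1.differentiable (by simp)) v _ (hm1 v) (hm2 v)
  · refine ⟨hasTraces_wave hN (by linarith) hz (hm v) hy, ?_⟩
    have := (hasTraces_wave hN (by linarith) hz1 (hm1 v) hy).smul (N⁻¹ : ℂ)
    simpa using this
  · have e : (fun x => Matrix.toEuclideanCLM (n := Fin 2) (𝕜 := ℂ) A (wave h k s N v x)) =
        wave h k s N (Matrix.toEuclideanCLM (n := Fin 2) (𝕜 := ℂ) A v) := by
      funext x
      simp only [wave, map_smul]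
    have hm' := hm (Matrix.toEuclideanCLM (n := Fin 2) (𝕜 := ℂ) A v)
    rw [← e] at hm'
    rw [matOp_toLp A (hm v) hm']
    congr 1
  · refine le_of_sq_le_sq ?_ (by positivity)
    rw [norm_smul, mul_pow, mul_pow, norm_sq_toLp_wave hN, norm_sq_toLp_wave hN, norm_inv,
      Complex.norm_real, Real.norm_of_nonneg hN.le, ← hI₀, ← hI₁]
    rw [div_div, div_le_iff₀ (by positivity)] at hNε₁
    have h1 : I₁ ≤ ε ^ 2 * (N ^ 2 * I₀) := by nlinarith [mul_pos hI₀pos (pow_pos hε 2)]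
    calc N⁻¹ ^ 2 * (N * I₁ * ‖v‖ ^ 2) = N⁻¹ ^ 2 * N * ‖v‖ ^ 2 * I₁ := by ring
      _ ≤ N⁻¹ ^ 2 * N * ‖v‖ ^ 2 * (ε ^ 2 * (N ^ 2 * I₀)) :=
        mul_le_mul_of_nonneg_left h1 (by positivity)
      _ = ε ^ 2 * (N * I₀ * ‖v‖ ^ 2) := by field_simp
  · refine le_of_sq_le_sq ?_ (by positivity)
    rw [norm_smul, norm_smul, mul_pow, mul_pow, mul_pow, norm_sq_toLp_wave hN,
      norm_sq_toLp_wave hN, norm_inv,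
      Complex.norm_real, Real.norm_of_nonneg hN.le, ← hI₀, ← hI₂]
    rw [div_div, div_le_iff₀ (by positivity)] at hNε₂
    have hN4 : N ≤ N ^ 4 := by nlinarith [pow_pos hN 2]
    have h1 : I₂ ≤ ε ^ 2 * (N ^ 4 * I₀) := by nlinarith [mul_pos hI₀pos (pow_pos hε 2)]
    calc N⁻¹ ^ 2 * (N⁻¹ ^ 2 * (N * I₂ * ‖v‖ ^ 2)) = N⁻¹ ^ 4 * N * ‖v‖ ^ 2 * I₂ := by ring
      _ ≤ N⁻¹ ^ 4 * N * ‖v‖ ^ 2 * (ε ^ 2 * (N ^ 4 * I₀)) :=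
        mul_le_mul_of_nonneg_left h1 (by positivity)
      _ = ε ^ 2 * (N * I₀ * ‖v‖ ^ 2) := by field_simp
  · have h1 := norm_sq_toLp_wave hN (hm v)
    rw [show (hm v).toLp _ = 0 from hv, norm_zero, zero_pow two_ne_zero] at h1
    have h2 : ‖v‖ ^ 2 = 0 := by
      rcases mul_eq_zero.1 h1.symm with h | h
      · exact absurd h (mul_pos hN hI₀pos).ne'
      · exact h
    exact norm_eq_zero.1 (pow_eq_zero_iff two_ne_zero |>.1 h2)

/-! ### Square integrability of the resolvent kernels -/

theorem memLp_of_norm_le_exp_neg_abs {f : ℝ → ℂ} (hf : AEStronglyMeasurable f volume) {a C : ℝ}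
    (ha : 0 < a) (h : ∀ x, ‖f x‖ ≤ C * Real.exp (-a * |x|)) : MemLp f 2 := by
  have key : MemLp (fun x : ℝ => C * Real.exp (-a * |x|)) 2 := by
    refine MemLp.const_mul ?_ C
    rw [memLp_two_iff_integrable_sq (by fun_prop)]
    have e : ∀ x : ℝ, Real.exp (-a * |x|) ^ 2 = Real.exp (-(2 * a) * |x|) := fun x => by
      rw [← Real.exp_nat_mul]
      congr 1
      push_cast
      ring
    simp only [e]
    rw [← integrableOn_univ, ← Set.Iic_union_Ioi (a := (0 : ℝ)), integrableOn_union]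
    constructor
    · refine (integrableOn_exp_mul_Iic (a := 2 * a) (by linarith) 0).congr_fun (fun x hx => ?_)
        measurableSet_Iic
      simp only [abs_of_nonpos (Set.mem_Iic.1 hx)]
      ring_nf
    · refine (integrableOn_exp_mul_Ioi (a := -(2 * a)) (by linarith) 0).congr_fun (fun x hx => ?_)
        measurableSet_Ioi
      simp only [abs_of_pos (Set.mem_Ioi.1 hx)]
  exact key.mono' hf (Eventually.of_forall h)

theorem norm_exp_upperSqrt (z : ℂ) (x : ℝ) :
    ‖Complex.exp (Complex.I * upperSqrt z * |x|)‖ = Real.exp (-(upperSqrt z).im * |x|) := by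
  rw [Complex.norm_exp]
  congr 1
  simp

theorem memLp_schrodingerKernel {z : ℂ} (hz : ∀ x : ℝ, 0 ≤ x → z ≠ x) :
    MemLp (schrodingerKernel z) 2 := by
  refine memLp_of_norm_le_exp_neg_abs (continuous_schrodingerKernel z).aestronglyMeasurable
    (upperSqrt_im_pos hz) (C := ‖2 * Complex.I * upperSqrt z‖⁻¹) fun x => ?_
  rw [schrodingerKernel, norm_div, norm_exp_upperSqrt, div_eq_inv_mul]

theorem memLp_schrodingerKernelDeriv {z : ℂ} (hz : ∀ x : ℝ, 0 ≤ x → z ≠ x) :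
    MemLp (schrodingerKernelDeriv z) 2 := by
  have hs : Measurable Real.sign := by
    unfold Real.sign
    exact Measurable.ite measurableSet_Iio measurable_const
      (Measurable.ite measurableSet_Ioi measurable_const measurable_const)
  have hm : Measurable (schrodingerKernelDeriv z) := by
    unfold schrodingerKernelDeriv
    refine Measurable.div_const (Measurable.mul (Complex.measurable_ofReal.comp hs) ?_) _
    exact Continuous.measurable (by fun_prop)
  refine memLp_of_norm_le_exp_neg_abs hm.aestronglyMeasurable
    (upperSqrt_im_pos hz) (C := 1) fun x => ?_
  rw [schrodingerKernelDeriv, norm_div, norm_mul, norm_exp_upperSqrt, Complex.norm_real]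
  have h1 : ‖Real.sign x‖ ≤ 1 := by
    rcases Real.sign_apply_eq x with h | h | h <;> simp [h]
  have h2 := Real.exp_pos (-(upperSqrt z).im * |x|)
  have h3 : ‖(2 : ℂ)‖ = 2 := by simp
  rw [h3]
  nlinarith

theorem _root_.MeasureTheory.MemLp.comp_sub_right {f : ℝ → ℂ} (hf : MemLp f 2) (v : ℝ) :
    MemLp (fun x => f (x - v)) 2 :=
  hf.comp_measurePreserving (measurePreserving_sub_right volume v)

theorem _root_.MeasureTheory.MemLp.comp_sub_left {f : ℝ → ℂ} (hf : MemLp f 2) (v : ℝ) :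
    MemLp (fun x => f (v - x)) 2 :=
  hf.comp_measurePreserving (Measure.measurePreserving_sub_left volume v)

theorem hasDerivAt_C2 {f : ℝ → C2} {f' : C2} {x : ℝ}
    (h : ∀ i, HasDerivAt (fun x => f x i) (f' i) x) : HasDerivAt f f' x := by
  have h1 : HasDerivAt (fun x => (f x).ofLp) f'.ofLp x := hasDerivAt_pi.2 h
  exact ((PiLp.continuousLinearEquiv 2 ℝ (fun _ : Fin 2 => ℂ)).symm.hasFDerivAt).comp_hasDerivAt x h1

/-! ### Extensions of a symmetric operator with finitely many boundary values -/

section Abstract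

variable {E : Type*} [NormedAddCommGroup E] [InnerProductSpace ℂ E]
variable {ι : Type} [Fintype ι]

/-- Boundary data for a maximal operator: `rel` contains `(u, w, r, t)` when `w` is the value of the
operator at `u`, and `r = ρ u`, `t = τ u` are the boundary values of `u`. These satisfy Green's
identity. A relation stands for the three maps, as these are defined on a dense domain only;
`rho_zero` says that the boundary values depend on `u` and `w` only. -/
structure BoundaryRelation (E : Type*) [NormedAddCommGroup E] [InnerProductSpace ℂ E]
    (ι : Type) [Fintype ι] where
  rel : Submodule ℂ (E × E × EuclideanSpace ℂ ι × EuclideanSpace ℂ ι)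
  green : ∀ {u w r t u' w' r' t'}, (u, w, r, t) ∈ rel → (u', w', r', t') ∈ rel →
    inner ℂ w u' - inner ℂ u w' = inner ℂ r t' - inner ℂ t r'
  rho_zero : ∀ {r t}, ((0 : E), (0 : E), r, t) ∈ rel → r = 0 ∧ t = 0

/-- `A` is the restriction of the maximal operator to the boundary condition of the couple `c`. -/
def BoundaryRelation.IsRestriction (T : BoundaryRelation E ι) (c : Couple ι) (A : E →ₗ.[ℂ] E) :
    Prop :=
  ∀ u w, (u, w) ∈ A.graph ↔ ∃ r t, (u, w, r, t) ∈ T.rel ∧ c.Holds r t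

/-- At the point `z` the operator with `ρ u = 0` has a bounded resolvent, and the solutions of
`A u = z u` are parametrized by `ξ = ρ u`, with `τ u = M ξ`. -/
def BoundaryRelation.IsRegularAt [DecidableEq ι] (T : BoundaryRelation E ι) (z : ℂ)
    (M : Matrix ι ι ℂ) : Prop :=
  (∀ ξ, ∃ u, (u, z • u, ξ, Matrix.toEuclideanLin M ξ) ∈ T.rel) ∧
    ∃ R : E →L[ℂ] E, ∀ f, ∃ t, (R f, z • R f - f, 0, t) ∈ T.rel

/-- The boundary condition of a couple makes the boundary form vanish. -/
theorem Couple.Holds.inner_eq {c : Couple ι} {r t r' t' : EuclideanSpace ℂ ι}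
    (h : c.Holds r t) (h' : c.Holds r' t') : inner ℂ r t' = inner ℂ t r' := by
  obtain ⟨hr, ht⟩ := h
  obtain ⟨hr', ht'⟩ := h'
  have hid : ∀ x ∈ LinearMap.range c.proj, c.proj x = x := by
    rintro _ ⟨x, rfl⟩
    exact LinearMap.congr_fun c.isProj.isIdempotentElem x
  have hsym := c.isProj.isSymmetric
  calc inner ℂ r t' = inner ℂ (c.proj r) t' := by rw [hid r hr]
    _ = inner ℂ r (c.proj t') := hsym r t'
    _ = inner ℂ (⟨r, hr⟩ : LinearMap.range c.proj) (c.proj.rangeRestrict t') := rfl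
    _ = inner ℂ (⟨r, hr⟩ : LinearMap.range c.proj) (c.theta ⟨r', hr'⟩) := by rw [ht']
    _ = inner ℂ (c.theta ⟨r, hr⟩) (⟨r', hr'⟩ : LinearMap.range c.proj) := (c.isSymm _ _).symm
    _ = inner ℂ (c.proj.rangeRestrict t) (⟨r', hr'⟩ : LinearMap.range c.proj) := by rw [ht]
    _ = inner ℂ (c.proj t) r' := rfl
    _ = inner ℂ t (c.proj r') := hsym t r'
    _ = inner ℂ t r' := by rw [hid r' hr']

theorem Couple.holds_add_iff [DecidableEq ι] {c : Couple ι} {M : Matrix ι ι ℂ}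
    {ξ t : EuclideanSpace ℂ ι} :
    c.Holds ξ (t + Matrix.toEuclideanLin M ξ) ↔
      ∃ h : ξ ∈ LinearMap.range c.proj, c.gamma M ⟨ξ, h⟩ = c.proj.rangeRestrict t := by
  refine exists_congr fun h => ?_
  rw [map_add, Couple.gamma, LinearMap.sub_apply, sub_eq_iff_eq_add]
  exact eq_comm

theorem Couple.holds_iff_gamma_eq_zero [DecidableEq ι] {c : Couple ι} {M : Matrix ι ι ℂ}
    {ξ : EuclideanSpace ℂ ι} :
    c.Holds ξ (Matrix.toEuclideanLin M ξ) ↔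
      ∃ h : ξ ∈ LinearMap.range c.proj, c.gamma M ⟨ξ, h⟩ = 0 := by
  have := Couple.holds_add_iff (c := c) (M := M) (ξ := ξ) (t := 0)
  rwa [zero_add, map_zero] at this

theorem mem_opSpectrum_of_eigenvector {A : E →ₗ.[ℂ] E} {z : ℂ} {u : E} (hu : u ≠ 0)
    (h : (u, z • u) ∈ A.graph) : z ∈ opSpectrum A := by
  rintro ⟨R, -, hR⟩
  obtain ⟨v, hv, hAv⟩ := (LinearPMap.mem_graph_iff A).1 h
  simp only at hv hAv
  have := hR v
  rw [hv, hAv, sub_self, map_zero] at this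
  exact hu this.symm

theorem mem_eigenspace_iff {A : E →ₗ.[ℂ] E} {z : ℂ} {v : A.domain} :
    v ∈ eigenspace A z ↔ ((v : E), z • (v : E)) ∈ A.graph := by
  rw [eigenspace, LinearMap.mem_ker, LinearPMap.mem_graph_iff]
  constructor
  · intro h
    exact ⟨v, rfl, sub_eq_zero.1 h⟩
  · rintro ⟨v', h1, h2⟩
    have : v' = v := Subtype.ext h1
    subst this
    exact sub_eq_zero.2 h2

/-- A restriction defined by a couple is symmetric. -/
theorem BoundaryRelation.IsRestriction.inner_eq {T : BoundaryRelation E ι} {c : Couple ι}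
    {A : E →ₗ.[ℂ] E} (hA : T.IsRestriction c A) {u w u' w' : E} (h : (u, w) ∈ A.graph)
    (h' : (u', w') ∈ A.graph) : inner ℂ w u' = inner ℂ u w' := by
  obtain ⟨r, t, h1, h2⟩ := (hA _ _).1 h
  obtain ⟨r', t', h1', h2'⟩ := (hA _ _).1 h'
  have := T.green h1 h1'
  rwa [h2.inner_eq h2', sub_self, sub_eq_zero] at this

theorem conj_eq_of_eigenvector {A : E →ₗ.[ℂ] E}
    (hA : ∀ {u w u' w' : E}, (u, w) ∈ A.graph → (u', w') ∈ A.graph → inner ℂ w u' = inner ℂ u w')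
    {z : ℂ} {u : E} (hu : u ≠ 0) (h : (u, z • u) ∈ A.graph) : (starRingEnd ℂ) z = z := by
  have h1 := hA h h
  rw [inner_smul_left, inner_smul_right] at h1
  exact mul_right_cancel₀ (inner_self_ne_zero.2 hu) h1

variable [DecidableEq ι]

namespace BoundaryRelation

variable {T : BoundaryRelation E ι} {z : ℂ} {M M' : Matrix ι ι ℂ}

/-- The operator with `ρ u = 0` has no eigenvalue at a regular point: its resolvent at `z̄` is
surjective onto its domain, and Green's identity applies. -/
theorem IsRegularAt.eq_zero (hz' : T.IsRegularAt ((starRingEnd ℂ) z) M') {u : E}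
    {t : EuclideanSpace ℂ ι} (h : (u, z • u, 0, t) ∈ T.rel) : u = 0 ∧ t = 0 := by
  obtain ⟨-, R, hR⟩ := hz'
  have hu : u = 0 := by
    obtain ⟨t', ht'⟩ := hR u
    have := T.green h ht'
    rw [inner_sub_right, inner_smul_left, inner_smul_right, inner_zero_left, inner_zero_right,
      sub_sub_cancel, sub_zero] at this
    exact inner_self_eq_zero.1 this
  subst hu
  rw [smul_zero] at h
  exact ⟨rfl, (T.rho_zero h).2⟩

/-- `M` is the Weyl function: it maps `ρ u` to `τ u` for every solution of `A u = z u`. -/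
theorem IsRegularAt.tau_eq (hz : T.IsRegularAt z M) (hz' : T.IsRegularAt ((starRingEnd ℂ) z) M')
    {u : E} {r t : EuclideanSpace ℂ ι} (h : (u, z • u, r, t) ∈ T.rel) :
    t = Matrix.toEuclideanLin M r := by
  obtain ⟨v, hv⟩ := hz.1 r
  have h1 := T.rel.sub_mem h hv
  have h2 : (u - v, z • (u - v), (0 : EuclideanSpace ℂ ι), t - Matrix.toEuclideanLin M r) ∈ T.rel := by
    simpa [smul_sub] using h1
  exact sub_eq_zero.1 (hz'.eq_zero h2).2

/-- The solution operator `ξ ↦ G_z ξ`. -/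
theorem IsRegularAt.exists_linear (hz : T.IsRegularAt z M)
    (hz' : T.IsRegularAt ((starRingEnd ℂ) z) M') :
    ∃ G : EuclideanSpace ℂ ι →ₗ[ℂ] E,
      ∀ ξ, (G ξ, z • G ξ, ξ, Matrix.toEuclideanLin M ξ) ∈ T.rel := by
  choose G hG using hz.1
  have huniq : ∀ ξ u, (u, z • u, ξ, Matrix.toEuclideanLin M ξ) ∈ T.rel → u = G ξ := by
    intro ξ u hu
    have h1 := T.rel.sub_mem hu (hG ξ)
    have h2 : (u - G ξ, z • (u - G ξ), (0 : EuclideanSpace ℂ ι), (0 : EuclideanSpace ℂ ι)) ∈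
        T.rel := by
      convert h1 using 1
      simp [smul_sub]
    exact sub_eq_zero.1 (hz'.eq_zero h2).1
  refine ⟨{ toFun := G, map_add' := fun ξ η => (huniq _ _ ?_).symm,
            map_smul' := fun a ξ => (huniq _ _ ?_).symm }, hG⟩
  · simpa [smul_add] using T.rel.add_mem (hG ξ) (hG η)
  · simpa [smul_comm z a] using T.rel.smul_mem a (hG ξ)

/-- Krein's formula: if `Θ - Π M Π` is invertible, then so is `-A + z`. -/
theorem IsRestriction.mem_opResolventSet {c : Couple ι} {A : E →ₗ.[ℂ] E}
    (hA : T.IsRestriction c A) (hz : T.IsRegularAt z M)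
    (hz' : T.IsRegularAt ((starRingEnd ℂ) z) M') (hdet : LinearMap.det (c.gamma M) ≠ 0) :
    z ∈ opResolventSet A := by
  obtain ⟨G, hG⟩ := hz.exists_linear hz'
  obtain ⟨R, hR⟩ := hz.2
  let e := LinearMap.equivOfDetNeZero (c.gamma M) hdet
  have he : ∀ x, c.gamma M x = e x := fun x => rfl
  -- `τ R`, which is bounded since `⟨ξ, τ R f⟩ = ⟨G_{z̄} ξ, f⟩`
  choose g hg using fun p => hz'.1 (EuclideanSpace.single p (1 : ℂ))
  let τR : E →L[ℂ] EuclideanSpace ℂ ι := (EuclideanSpace.equiv ι ℂ).symm.toContinuousLinearMap ∘L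
    ContinuousLinearMap.pi fun p => innerSL ℂ (g p)
  have hτR : ∀ f, (R f, z • R f - f, 0, τR f) ∈ T.rel := by
    intro f
    obtain ⟨t, ht⟩ := hR f
    suffices t = τR f by rwa [← this]
    ext p
    have h1 := T.green ht (hg p)
    rw [inner_sub_left, inner_smul_left, inner_smul_right, inner_zero_left, sub_sub_cancel_left,
      zero_sub, neg_inj] at h1
    have h2 := congrArg (starRingEnd ℂ) h1
    rw [inner_conj_symm, inner_conj_symm] at h2
    change t p = inner ℂ (g p) f
    rw [h2]
    simp [EuclideanSpace.inner_single_left]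
  let K : EuclideanSpace ℂ ι →ₗ[ℂ] E :=
    G ∘ₗ (LinearMap.range c.proj).subtype ∘ₗ e.symm.toLinearMap ∘ₗ c.proj.rangeRestrict
  have hgraph : ∀ f, (R f + K (τR f), z • (R f + K (τR f)) - f) ∈ A.graph := by
    intro f
    set ξ := e.symm (c.proj.rangeRestrict (τR f)) with hξ
    refine (hA _ _).2 ⟨(ξ : EuclideanSpace ℂ ι), _, ?_,
      Couple.holds_add_iff (M := M) (t := τR f) |>.2 ⟨ξ.2, ?_⟩⟩
    · have := T.rel.add_mem (hτR f) (hG ξ)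
      convert this using 1
      simp only [Prod.mk_add_mk, zero_add, Prod.mk.injEq, and_true]
      refine ⟨rfl, ?_⟩
      change z • (R f + G ξ) - f = _
      rw [smul_add]
      abel
    · rw [he, Subtype.coe_eta, hξ, LinearEquiv.apply_symm_apply]
  refine ⟨R + LinearMap.toContinuousLinearMap K ∘L τR, fun f => ?_, fun u => ?_⟩
  · obtain ⟨v, hv, hAv⟩ := (LinearPMap.mem_graph_iff A).1 (hgraph f)
    simp only at hv hAv
    have hmem : R f + K (τR f) ∈ A.domain := hv ▸ v.2
    refine ⟨hmem, ?_⟩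
    have : (⟨R f + K (τR f), hmem⟩ : A.domain) = v := Subtype.ext hv.symm
    change z • (R f + K (τR f)) - A ⟨R f + K (τR f), hmem⟩ = f
    rw [this, hAv]
    abel
  · set f := z • (u : E) - A u with hf
    have h1 := A.graph.sub_mem (A.mem_graph u) (hgraph f)
    set v := (u : E) - (R f + K (τR f)) with hv
    have h2 : (v, z • v) ∈ A.graph := by
      convert h1 using 1
      refine Prod.ext rfl ?_
      change z • v = A u - (z • (R f + K (τR f)) - f)
      rw [hv, hf, smul_sub]
      abel
    obtain ⟨r, t, h3, h4⟩ := (hA _ _).1 h2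
    have h5 := hz.tau_eq hz' h3
    subst h5
    obtain ⟨hr, h6⟩ := Couple.holds_iff_gamma_eq_zero.1 h4
    rw [he, LinearEquiv.map_eq_zero_iff] at h6
    have hr0 : r = 0 := congrArg Subtype.val h6
    subst hr0
    exact (sub_eq_zero.1 (hz'.eq_zero h3).1).symm

/-- A vector `ξ` in the kernel of `Θ - Π M Π` gives the eigenvector `G_z ξ`. -/
theorem IsRestriction.exists_eigenvector {c : Couple ι} {A : E →ₗ.[ℂ] E}
    (hA : T.IsRestriction c A) (hz : T.IsRegularAt z M) (hdet : LinearMap.det (c.gamma M) = 0) :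
    ∃ u, u ≠ 0 ∧ (u, z • u) ∈ A.graph := by
  obtain ⟨ξ, hξ, hξ0⟩ := (Submodule.ne_bot_iff _).1 (LinearMap.bot_lt_ker_of_det_eq_zero hdet).ne'
  obtain ⟨u, hu⟩ := hz.1 ξ
  refine ⟨u, ?_, (hA _ _).2 ⟨_, _, hu, Couple.holds_iff_gamma_eq_zero.2 ⟨ξ.2, hξ⟩⟩⟩
  rintro rfl
  rw [smul_zero] at hu
  exact hξ0 (Subtype.ext (T.rho_zero hu).1)

/-- The eigenvectors at a regular point `z` are of the form `G_z ξ`. -/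
theorem IsRestriction.finiteDimensional_eigenspace {c : Couple ι} {A : E →ₗ.[ℂ] E}
    (hA : T.IsRestriction c A) (hz : T.IsRegularAt z M)
    (hz' : T.IsRegularAt ((starRingEnd ℂ) z) M') : FiniteDimensional ℂ (eigenspace A z) := by
  obtain ⟨G, hG⟩ := hz.exists_linear hz'
  have hmem : ∀ v : eigenspace A z, ((v : A.domain) : E) ∈ LinearMap.range G := by
    intro v
    obtain ⟨r, t, h1, -⟩ := (hA _ _).1 (mem_eigenspace_iff.1 v.2)
    have h2 := hz.tau_eq hz' h1
    subst h2
    have h3 := T.rel.sub_mem h1 (hG r)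
    have h4 : (((v : A.domain) : E) - G r, z • (((v : A.domain) : E) - G r),
        (0 : EuclideanSpace ℂ ι), (0 : EuclideanSpace ℂ ι)) ∈ T.rel := by
      convert h3 using 1
      simp [smul_sub]
    exact ⟨r, (sub_eq_zero.1 (hz'.eq_zero h4).1).symm⟩
  refine FiniteDimensional.of_injective
    ((A.domain.subtype ∘ₗ (eigenspace A z).subtype).codRestrict (LinearMap.range G) hmem) ?_
  intro v v' h
  exact Subtype.ext (Subtype.ext (congrArg (fun x : LinearMap.range G => (x : E)) h))

theorem differentiableOn_det_gamma (c : Couple ι) {U : Set ℂ} {M : ℂ → Matrix ι ι ℂ}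
    (hM : ∀ p q, DifferentiableOn ℂ (fun z => M z p q) U) :
    DifferentiableOn ℂ (fun z => LinearMap.det (c.gamma (M z))) U := by
  let b := Module.finBasis ℂ (LinearMap.range c.proj)
  have e : ∀ z i j, LinearMap.toMatrix b b (c.gamma (M z)) i j =
      b.repr (c.theta (b j)) i - ∑ p, (∑ q, M z p q * (b j : EuclideanSpace ℂ ι) q) *
        b.repr (c.proj.rangeRestrict (EuclideanSpace.single p 1)) i := by
    intro z i j
    have h1 : Matrix.toEuclideanLin (M z) (b j : EuclideanSpace ℂ ι) =
        ∑ p, (∑ q, M z p q * (b j : EuclideanSpace ℂ ι) q) • EuclideanSpace.single p (1 : ℂ) := by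
      ext p
      simp [Matrix.toLpLin_apply, Matrix.mulVec, dotProduct, Finset.sum_apply, Pi.single_apply]
    rw [LinearMap.toMatrix_apply, Couple.gamma, LinearMap.sub_apply, map_sub, Finsupp.sub_apply,
      LinearMap.comp_apply, LinearMap.comp_apply, Submodule.subtype_apply, h1]
    simp only [map_sum, map_smul, Finsupp.coe_finsetSum, Finset.sum_apply, Finsupp.smul_apply,
      smul_eq_mul]
  have hdet : ∀ z, LinearMap.det (c.gamma (M z)) = ∑ σ : Equiv.Perm (Fin _), Equiv.Perm.sign σ •
      ∏ j, (b.repr (c.theta (b j)) (σ j) - ∑ p, (∑ q, M z p q * (b j : EuclideanSpace ℂ ι) q) *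
        b.repr (c.proj.rangeRestrict (EuclideanSpace.single p 1)) (σ j)) := by
    intro z
    rw [← LinearMap.det_toMatrix b, Matrix.det_apply]
    exact Finset.sum_congr rfl fun σ _ => congrArg _ (Finset.prod_congr rfl fun j _ => e z (σ j) j)
  simp only [hdet]
  refine DifferentiableOn.fun_sum fun σ _ => DifferentiableOn.fun_const_smul ?_ _
  exact DifferentiableOn.fun_finsetProd fun j _ => DifferentiableOn.const_sub
    (DifferentiableOn.fun_sum fun p _ => DifferentiableOn.mul_const
      (DifferentiableOn.fun_sum fun q _ => (hM p q).mul_const _) _) _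

/-- The spectrum of a restriction off the set `Ess` of irregular points is discrete and given by
the zeros of `det (Θ - Π M Π)`, which is analytic there and has real zeros only. -/
theorem IsRestriction.spectrum {c : Couple ι} {A : E →ₗ.[ℂ] E}
    (hA : T.IsRestriction c A) {Ess : Set ℝ} (hcl : IsClosed Ess) {M : ℂ → Matrix ι ι ℂ}
    (hreg : ∀ z, z ∉ Complex.ofReal '' Ess → T.IsRegularAt z (M z))
    (hM : ∀ p q, DifferentiableOn ℂ (fun z => M z p q) (Complex.ofReal '' Ess)ᶜ)
    (hEss : ∀ x ∈ Ess, (x : ℂ) ∈ opSpectrum A)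
    (hacc : ∀ x ∈ Ess, ∀ ε > 0, ∃ x' ∈ Ess, x' ≠ x ∧ |x' - x| < ε) :
    essentialSpectrum A = Complex.ofReal '' Ess ∧
      ∀ μ : ℂ, μ ∈ discreteSpectrum A ↔
        ∃ x ∈ Essᶜ, μ = (x : ℂ) ∧ LinearMap.det (c.gamma (M x)) = 0 := by
  set U : Set ℂ := (Complex.ofReal '' Ess)ᶜ with hU
  have hUo : IsOpen U := by
    rw [hU, isOpen_compl_iff]
    exact Complex.isometry_ofReal.isClosedEmbedding.isClosedMap _ hcl
  have hconj : ∀ z ∈ U, (starRingEnd ℂ) z ∈ U := by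
    rintro z hz ⟨x, hx, h⟩
    refine hz ⟨x, hx, ?_⟩
    rw [← Complex.conj_conj z, ← h, Complex.conj_ofReal]
  have hres : ∀ z ∈ U, LinearMap.det (c.gamma (M z)) ≠ 0 → z ∈ opResolventSet A :=
    fun z hz h => hA.mem_opResolventSet (hreg z hz) (hreg _ (hconj z hz)) h
  have heig : ∀ z ∈ U, LinearMap.det (c.gamma (M z)) = 0 → ∃ u, u ≠ 0 ∧ (u, z • u) ∈ A.graph :=
    fun z hz h => hA.exists_eigenvector (hreg z hz) h
  have hreal : ∀ z ∈ U, LinearMap.det (c.gamma (M z)) = 0 → (starRingEnd ℂ) z = z := by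
    intro z hz h
    obtain ⟨u, hu, hg⟩ := heig z hz h
    exact conj_eq_of_eigenvector hA.inner_eq hu hg
  have hspec : ∀ z ∈ U, (z ∈ opSpectrum A ↔ LinearMap.det (c.gamma (M z)) = 0) := by
    intro z hz
    constructor
    · intro h
      by_contra h'
      exact h (hres z hz h')
    · intro h
      obtain ⟨u, hu, hg⟩ := heig z hz h
      exact mem_opSpectrum_of_eigenvector hu hg
  have hdiff := differentiableOn_det_gamma c hM
  have hiso : ∀ z ∈ U, ∀ᶠ w in 𝓝[≠] z, LinearMap.det (c.gamma (M w)) ≠ 0 := by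
    intro z hz
    refine (hdiff.analyticAt (hUo.mem_nhds hz)).eventually_eq_zero_or_eventually_ne_zero.resolve_left
      fun h0 => ?_
    obtain ⟨δ, hδ, hball⟩ := Metric.eventually_nhds_iff.1 (h0.and (hUo.mem_nhds hz))
    -- a determinant vanishing near `z` would have non-real zeros:
    -- one of two points near `z` on a vertical line is not real
    have key : ∀ w, dist w z < δ → w.im = 0 := by
      intro w hw
      have h1 := hreal w (hball hw).2 (hball hw).1
      exact Complex.conj_eq_iff_im.1 h1
    have h1 := key z (by simpa using hδ)
    have h2 := key (z + Complex.I * (δ / 2 : ℝ)) (by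
      rw [dist_eq_norm, add_sub_cancel_left, norm_mul, Complex.norm_I, one_mul, Complex.norm_real,
        Real.norm_of_nonneg (by linarith)]
      linarith)
    simp [h1, hδ.ne'] at h2
  have hdisc : ∀ z ∈ U, z ∈ opSpectrum A → z ∈ discreteSpectrum A := by
    intro z hz hzs
    refine ⟨hzs, ?_, ?_, hA.finiteDimensional_eigenspace (hreg z hz) (hreg _ (hconj z hz))⟩
    · obtain ⟨δ, hδ, hball⟩ := Metric.eventually_nhds_iff.1
        ((eventually_nhdsWithin_iff.1 (hiso z hz)).and (hUo.mem_nhds hz))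
      refine ⟨δ, hδ, fun w hw hwd => ?_⟩
      by_contra hne
      obtain ⟨h1, h2⟩ := hball hwd
      exact h1 hne ((hspec w h2).1 hw)
    · obtain ⟨u, hu, hg⟩ := heig z hz ((hspec z hz).1 hzs)
      obtain ⟨v, hv, -⟩ := (LinearPMap.mem_graph_iff A).1 hg
      simp only at hv
      rw [Submodule.ne_bot_iff]
      refine ⟨v, mem_eigenspace_iff.2 (by rwa [hv]), fun h => hu ?_⟩
      rw [← hv, h]
      rfl
  have hnd : ∀ z ∈ discreteSpectrum A, z ∈ U := by
    rintro z ⟨-, ⟨ε, hε, hε'⟩, -⟩ ⟨x, hx, rfl⟩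
    obtain ⟨x', hx', hne, hlt⟩ := hacc x hx ε hε
    have := hε' (x' : ℂ) (hEss x' hx') (by
      rw [dist_eq_norm, ← Complex.ofReal_sub, Complex.norm_real]
      exact hlt)
    exact hne (Complex.ofReal_injective this)
  constructor
  · ext z
    constructor
    · rintro ⟨h1, h2⟩
      by_contra h3
      exact h2 (hdisc z h3 h1)
    · intro hz
      refine ⟨?_, fun h => hnd z h hz⟩
      obtain ⟨x, hx, rfl⟩ := hz
      exact hEss x hx
  · intro μ
    constructor
    · intro h
      have hμ := hnd μ h
      have h0 := (hspec μ hμ).1 h.1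
      have h1 : ((μ.re : ℝ) : ℂ) = μ := Complex.conj_eq_iff_re.1 (hreal μ hμ h0)
      refine ⟨μ.re, fun hx => hμ ⟨μ.re, hx, h1⟩, h1.symm, ?_⟩
      rwa [h1]
    · rintro ⟨x, hx, rfl, h0⟩
      have hxU : (x : ℂ) ∈ U := by
        rintro ⟨x', hx', h⟩
        exact hx (Complex.ofReal_injective h ▸ hx')
      exact hdisc _ hxU ((hspec _ hxU).2 h0)

end BoundaryRelation

/-- Weyl's criterion: approximate eigenvalues lie in the spectrum. -/
theorem mem_opSpectrum_of_approx {A : E →ₗ.[ℂ] E} {z : ℂ}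
    (h : ∀ ε > 0, ∃ u w : E, (u, w) ∈ A.graph ∧ u ≠ 0 ∧ ‖w - z • u‖ ≤ ε * ‖u‖) :
    z ∈ opSpectrum A := by
  rintro ⟨R, -, hR⟩
  obtain ⟨u, w, hg, hu, hle⟩ := h (1 / (2 * (‖R‖ + 1))) (by positivity)
  obtain ⟨v, hv, hAv⟩ := (LinearPMap.mem_graph_iff A).1 hg
  simp only at hv hAv
  have h1 := hR v
  rw [hv, hAv] at h1
  have h2 := R.le_opNorm (z • u - w)
  rw [h1, norm_sub_rev] at h2
  have hpos := norm_pos_iff.2 hu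
  have h3 : ‖R‖ * ‖w - z • u‖ ≤ ‖R‖ * (1 / (2 * (‖R‖ + 1)) * ‖u‖) :=
    mul_le_mul_of_nonneg_left hle (norm_nonneg R)
  have h4 : ‖R‖ * (1 / (2 * (‖R‖ + 1)) * ‖u‖) ≤ ‖u‖ / 2 := by
    have h5 := norm_nonneg R
    rw [show ‖R‖ * (1 / (2 * (‖R‖ + 1)) * ‖u‖) = (‖R‖ / (‖R‖ + 1)) * (‖u‖ / 2) by field_simp]
    refine mul_le_of_le_one_left (by positivity) ?_
    rw [div_le_one (by positivity)]
    linarith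
  linarith

end Abstract

/-! ### The Dirac operator -/

theorem pauli1_mul_pauli1 : pauli1 * pauli1 = 1 := by
  ext i j
  fin_cases i <;> fin_cases j <;> simp [pauli1, Matrix.mul_apply]

theorem pauli3_mul_pauli3 : pauli3 * pauli3 = 1 := by
  ext i j
  fin_cases i <;> fin_cases j <;> simp [pauli3, Matrix.mul_apply]

theorem pauli3_mul_pauli1 : pauli3 * pauli1 = -(pauli1 * pauli3) := by
  ext i j
  fin_cases i <;> fin_cases j <;> simp [pauli1, pauli3, Matrix.mul_apply]

theorem isHermitian_pauli1 : pauli1.IsHermitian := by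
  ext i j
  fin_cases i <;> fin_cases j <;> simp [pauli1, Matrix.conjTranspose_apply]

theorem isHermitian_pauli3 : pauli3.IsHermitian := by
  ext i j
  fin_cases i <;> fin_cases j <;> simp [pauli3, Matrix.conjTranspose_apply]

theorem matOp_smul (c : ℂ) (M : Matrix (Fin 2) (Fin 2) ℂ) (Ψ : L2) :
    matOp (c • M) Ψ = c • matOp M Ψ := by
  refine Lp.ext ?_
  filter_upwards [(Matrix.toEuclideanCLM (n := Fin 2) (𝕜 := ℂ) M).coeFn_compLpL Ψ,
    (Matrix.toEuclideanCLM (n := Fin 2) (𝕜 := ℂ) (c • M)).coeFn_compLpL Ψ,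
    Lp.coeFn_smul c (matOp M Ψ)] with x h1 h2 h3
  rw [h3, show (matOp (c • M) Ψ) x = _ from h2, Pi.smul_apply,
    show (matOp M Ψ) x = _ from h1, map_smul]
  rfl

theorem matOp_neg (M : Matrix (Fin 2) (Fin 2) ℂ) (Ψ : L2) : matOp (-M) Ψ = -matOp M Ψ := by
  have := matOp_smul (-1) M Ψ
  rwa [neg_one_smul, neg_one_smul] at this

theorem inner_diracRho_sub_inner {n : ℕ} (a b a' b' : Fin n → C2) :
    inner ℂ (diracRho a b) (diracTau a' b') - inner ℂ (diracTau a b) (diracRho a' b') =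
      -Complex.I * ∑ k, (inner ℂ (b k) (Matrix.toEuclideanCLM (n := Fin 2) (𝕜 := ℂ) pauli1 (b' k)) -
        inner ℂ (a k) (Matrix.toEuclideanCLM (n := Fin 2) (𝕜 := ℂ) pauli1 (a' k))) := by
  simp only [PiLp.inner_apply, Fintype.sum_prod_type, ← Finset.sum_sub_distrib, Finset.mul_sum]
  refine Finset.sum_congr rfl fun k _ => ?_
  simp only [Fin.sum_univ_two, diracRho, diracTau, PiLp.smul_apply, smul_eq_mul,
    Matrix.ofLp_toEuclideanCLM, Matrix.mulVec, dotProduct, pauli1, Matrix.of_apply, Matrix.cons_val',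
    Matrix.cons_val_zero, Matrix.cons_val_one, Matrix.cons_val_fin_one, PiLp.sub_apply,
    RCLike.inner_apply, map_mul, map_sub, map_add, map_div₀, Complex.conj_I, map_ofNat, map_zero, map_one,
    zero_mul, one_mul, zero_add, add_zero]
  ring

theorem diracRho_add {n : ℕ} (a b a' b' : Fin n → C2) :
    diracRho (a + a') (b + b') = diracRho a b + diracRho a' b' := by
  ext p
  simp only [diracRho, Pi.add_apply, add_sub_add_comm, map_add, smul_add, PiLp.add_apply]

theorem diracTau_add {n : ℕ} (a b a' b' : Fin n → C2) :
    diracTau (a + a') (b + b') = diracTau a b + diracTau a' b' := by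
  ext p
  simp only [diracTau, Pi.add_apply, PiLp.add_apply]
  ring

theorem diracRho_smul {n : ℕ} (s : ℂ) (a b : Fin n → C2) :
    diracRho (s • a) (s • b) = s • diracRho a b := by
  ext p
  simp only [diracRho, Pi.smul_apply, ← smul_sub, map_smul, PiLp.smul_apply, smul_eq_mul]
  ring

theorem diracTau_smul {n : ℕ} (s : ℂ) (a b : Fin n → C2) :
    diracTau (s • a) (s • b) = s • diracTau a b := by
  ext p
  simp only [diracTau, Pi.smul_apply, PiLp.smul_apply, smul_eq_mul]
  ring

theorem diracRho_zero {n : ℕ} : diracRho (0 : Fin n → C2) 0 = 0 := by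
  simpa using diracRho_smul 0 (0 : Fin n → C2) 0

theorem diracTau_zero {n : ℕ} : diracTau (0 : Fin n → C2) 0 = 0 := by
  simpa using diracTau_smul 0 (0 : Fin n → C2) 0

theorem HasWeakDeriv.zero (Y : Set ℝ) : HasWeakDeriv Y 0 0 := (weakGraph Y).zero_mem

variable {n : ℕ}

/-- The Dirac expression on `H¹(ℝ \ Y; ℂ²)`, with the boundary maps `ρ` and `τ`. -/
def diracRelation (y : Fin n → ℝ) (hy : Function.Injective y) :
    BoundaryRelation L2 (Fin n × Fin 2) where
  rel :=
    { carrier := {p | ∃ Φ a b, HasWeakDeriv (Set.range y) p.1 Φ ∧ HasTraces y p.1 a b ∧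
        p.2.1 = -Complex.I • matOp pauli1 Φ + (1 / 2 : ℂ) • matOp pauli3 p.1 ∧
        p.2.2.1 = diracRho a b ∧ p.2.2.2 = diracTau a b}
      add_mem' := by
        rintro p q ⟨Φ, a, b, h, ht, e1, e2, e3⟩ ⟨Φ', a', b', h', ht', e1', e2', e3'⟩
        refine ⟨Φ + Φ', a + a', b + b', h.add h', ht.add ht', ?_, ?_, ?_⟩
        · simp only [Prod.fst_add, Prod.snd_add, e1, e1', map_add]
          module
        · simp only [Prod.fst_add, Prod.snd_add, e2, e2', diracRho_add]
        · simp only [Prod.snd_add, e3, e3', diracTau_add]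
      zero_mem' := by
        refine ⟨0, 0, 0, HasWeakDeriv.zero _, HasTraces.zero y, ?_, ?_, ?_⟩
        · simp
        · exact diracRho_zero.symm
        · exact diracTau_zero.symm
      smul_mem' := by
        rintro s p ⟨Φ, a, b, h, ht, e1, e2, e3⟩
        refine ⟨s • Φ, s • a, s • b, h.smul s, ht.smul s, ?_, ?_, ?_⟩
        · simp only [Prod.smul_fst, Prod.smul_snd, e1, map_smul]
          module
        · simp only [Prod.smul_fst, Prod.smul_snd, e2, diracRho_smul]
        · simp only [Prod.smul_snd, e3, diracTau_smul] }
  green := by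
    rintro Ψ w r t Ψ' w' r' t' ⟨Φ, a, b, h, ht, e1, e2, e3⟩ ⟨Φ', a', b', h', ht', e1', e2', e3'⟩
    simp only at h ht e1 e2 e3 h' ht' e1' e2' e3'
    subst e1 e2 e3 e1' e2' e3'
    rw [inner_diracRho_sub_inner]
    have key := HasWeakDeriv.inner_add_inner hy h (h'.matOp pauli1) ht (ht'.matOp pauli1)
    rw [inner_add_left, inner_add_right, inner_smul_left, inner_smul_left, inner_smul_right,
      inner_smul_right, inner_matOp_left isHermitian_pauli1, inner_matOp_left isHermitian_pauli3]
    have hI : (starRingEnd ℂ) (-Complex.I) = Complex.I := by simp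
    have h2 : (starRingEnd ℂ) (1 / 2) = 1 / 2 := by rw [map_div₀, map_one, map_ofNat]
    rw [hI, h2]
    linear_combination Complex.I * key
  rho_zero := by
    rintro r t ⟨Φ, a, b, h, ht, e1, e2, e3⟩
    obtain ⟨ha, hb⟩ := HasTraces.unique ht (HasTraces.zero y)
    simp only at e2 e3
    rw [e2, e3, ha, hb]
    exact ⟨diracRho_zero, diracTau_zero⟩

theorem diracOp_isRestriction (y : Fin n → ℝ) (hy : Function.Injective y)
    (c : Couple (Fin n × Fin 2)) : (diracRelation y hy).IsRestriction c (diracOp y c) := by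
  intro u w
  rw [LinearPMap.mem_graph_iff]
  constructor
  · rintro ⟨v, rfl, rfl⟩
    obtain ⟨⟨a, b, ht, hc⟩, hv⟩ := v.2
    exact ⟨_, _, ⟨_, a, b, weakDiff_spec (Set.finite_range y) ⟨v, hv⟩, ht, rfl, rfl, rfl⟩, hc⟩
  · rintro ⟨r, t, ⟨Φ, a, b, h, ht, e1, e2, e3⟩, hc⟩
    simp only at h ht e1 e2 e3
    subst e1 e2 e3
    have hd : u ∈ (weakDiff (Set.range y) (Set.finite_range y)).domain := ⟨Φ, h⟩
    refine ⟨⟨u, ⟨a, b, ht, hc⟩, hd⟩, rfl, ?_⟩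
    have := (weakDiff_spec (Set.finite_range y) ⟨u, hd⟩).unique (Set.finite_range y) h
    rw [← this]
    rfl

/-! #### The resolvent kernel -/

theorem I_smul_pauli1_mul (z : ℂ) : Complex.I • (pauli1 * (z • 1 - (1 / 2 : ℂ) • pauli3)) =
    !![0, Complex.I * (z + 1 / 2); Complex.I * (z - 1 / 2), 0] := by
  ext i j
  rw [Matrix.smul_apply, Matrix.mul_apply, Fin.sum_univ_two]
  fin_cases i <;> fin_cases j <;> simp [pauli1, pauli3]

/-- Off the origin, `(D - z) g_z = 0`, that is `g_z' = i σ₁ (z - σ₃/2) g_z`. -/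
theorem hasDerivAt_diracKernel {z : ℂ} (hz : z ^ 2 - 1 / 4 ≠ 0) {x : ℝ} (hx : x ≠ 0)
    (i j : Fin 2) : HasDerivAt (fun x => diracKernel z x i j)
      (∑ l, (Complex.I • (pauli1 * (z • 1 - (1 / 2 : ℂ) • pauli3))) i l * diracKernel z x l j) x := by
  have h1 := ((hasDerivAt_schrodingerKernelDeriv hz hx).const_mul (-Complex.I)).mul_const (pauli1 i j)
  have h2 := (hasDerivAt_schrodingerKernel hz hx).mul_const
    (((1 / 2 : ℂ) • pauli3 + z • (1 : Matrix (Fin 2) (Fin 2) ℂ)) i j)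
  refine (h1.add h2).congr_deriv ?_
  have hI := Complex.I_mul_I
  rw [I_smul_pauli1_mul]
  simp only [diracKernel, Fin.sum_univ_two]
  generalize schrodingerKernel (z ^ 2 - 1 / 4) x = g
  generalize schrodingerKernelDeriv (z ^ 2 - 1 / 4) x = g'
  fin_cases i <;> fin_cases j <;> simp [pauli1, pauli3]
  · linear_combination (z + 1 / 2) * g' * hI
  · ring
  · ring
  · linear_combination (z - 1 / 2) * g' * hI

theorem diracG_memLp {y : Fin n → ℝ} {z : ℂ} (hz : ∀ x : ℝ, 0 ≤ x → z ^ 2 - 1 / 4 ≠ x)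
    (ξ : EuclideanSpace ℂ (Fin n × Fin 2)) : MemLp (diracG y z ξ) 2 := by
  refine memLp_piLp_iff.2 fun i => ?_
  simp only [diracG]
  refine memLp_finsetSum _ fun q _ => ?_
  have h1 := (((memLp_schrodingerKernelDeriv hz).comp_sub_right (y q.1)).const_mul
    (-Complex.I)).mul_const (pauli1 i q.2)
  have h2 := ((memLp_schrodingerKernel hz).comp_sub_right (y q.1)).mul_const
    (((1 / 2 : ℂ) • pauli3 + z • (1 : Matrix (Fin 2) (Fin 2) ℂ)) i q.2)
  exact (h1.add h2).mul_const (ξ q)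

theorem hasDerivAt_diracG {y : Fin n → ℝ} {z : ℂ} (hz : z ^ 2 - 1 / 4 ≠ 0)
    (ξ : EuclideanSpace ℂ (Fin n × Fin 2)) {x : ℝ} (hx : x ∉ Set.range y) :
    HasDerivAt (diracG y z ξ) (Matrix.toEuclideanCLM (n := Fin 2) (𝕜 := ℂ)
      (Complex.I • (pauli1 * (z • 1 - (1 / 2 : ℂ) • pauli3))) (diracG y z ξ x)) x := by
  refine hasDerivAt_C2 fun i => ?_
  have h : HasDerivAt (fun x => diracG y z ξ x i) (∑ q : Fin n × Fin 2,
      (∑ l, (Complex.I • (pauli1 * (z • 1 - (1 / 2 : ℂ) • pauli3))) i l *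
        diracKernel z (x - y q.1) l q.2) * ξ q) x := by
    refine HasDerivAt.fun_sum fun q _ => HasDerivAt.mul_const ?_ _
    have hne : x - y q.1 ≠ 0 := fun h => hx ⟨q.1, (sub_eq_zero.1 h).symm⟩
    have := (hasDerivAt_diracKernel hz hne i q.2).scomp x ((hasDerivAt_id x).sub_const (y q.1))
    simpa [Function.comp_def] using this
  refine h.congr_deriv ?_
  rw [Matrix.ofLp_toEuclideanCLM, Matrix.mulVec, dotProduct]
  simp only [Finset.sum_mul, diracG, Finset.mul_sum]
  rw [Finset.sum_comm]
  exact Finset.sum_congr rfl fun _ _ => Finset.sum_congr rfl fun _ _ => by ring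

theorem differentiableAt_upperSqrt {w : ℂ} (hw : ∀ x : ℝ, 0 ≤ x → w ≠ x) :
    DifferentiableAt ℂ upperSqrt w := by
  have hs : -w ∈ Complex.slitPlane := by
    rw [Complex.mem_slitPlane_iff]
    by_contra h
    push Not at h
    refine hw w.re (by simpa using h.1) (Complex.ext rfl ?_)
    simpa using h.2
  unfold upperSqrt Complex.sqrt
  exact (differentiableAt_const _).mul
    (differentiableAt_id.neg.cpow (differentiableAt_const _) hs)

theorem differentiableAt_schrodingerKernel {w : ℂ} (hw : ∀ x : ℝ, 0 ≤ x → w ≠ x) (x : ℝ) :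
    DifferentiableAt ℂ (fun w => schrodingerKernel w x) w := by
  have h := differentiableAt_upperSqrt hw
  have h0 : upperSqrt w ≠ 0 := upperSqrt_ne_zero (by simpa using hw 0 le_rfl)
  unfold schrodingerKernel
  refine DifferentiableAt.div ((h.const_mul _).mul_const _).cexp (h.const_mul _) ?_
  simp [h0]

theorem differentiableAt_schrodingerKernelDeriv {w : ℂ} (hw : ∀ x : ℝ, 0 ≤ x → w ≠ x) (x : ℝ) :
    DifferentiableAt ℂ (fun w => schrodingerKernelDeriv w x) w := by
  have h := differentiableAt_upperSqrt hw
  unfold schrodingerKernelDeriv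
  exact (((h.const_mul _).mul_const _).cexp.const_mul _).div_const _

/-- The essential spectrum of the Dirac operators. -/
def diracEss : Set ℝ := Set.Iic (-1 / 2) ∪ Set.Ici (1 / 2)

theorem sq_sub_ne_of_notMem_diracEss {z : ℂ} (hz : z ∉ Complex.ofReal '' diracEss) :
    ∀ x : ℝ, 0 ≤ x → z ^ 2 - 1 / 4 ≠ x := by
  intro x hx h
  have hre := congrArg Complex.re h
  have him := congrArg Complex.im h
  have e : (1 / 4 : ℂ) = ((1 / 4 : ℝ) : ℂ) := by push_cast; rfl
  rw [e] at hre him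
  simp only [pow_two, Complex.sub_re, Complex.mul_re, Complex.ofReal_re, Complex.sub_im,
    Complex.mul_im, Complex.ofReal_im, sub_zero] at hre him
  have h0 : z.re * z.im = 0 := by linarith
  rcases mul_eq_zero.1 h0 with h1 | h1
  · rw [h1] at hre
    nlinarith [mul_self_nonneg z.im]
  · refine hz ⟨z.re, ?_, Complex.ext rfl (by simp [h1])⟩
    rw [h1] at hre
    have h2 : (1 / 2 : ℝ) ≤ |z.re| := by
      have := sq_le_sq.1 (show (1 / 2 : ℝ) ^ 2 ≤ z.re ^ 2 by nlinarith)
      rwa [abs_of_pos (by norm_num)] at this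
    rcases le_abs.1 h2 with h3 | h3
    · exact Or.inr h3
    · exact Or.inl (by rw [Set.mem_Iic]; linarith)

theorem diracRelation_isRegularAt {y : Fin n → ℝ} (hy : Function.Injective y) {z : ℂ}
    (hz : z ∉ Complex.ofReal '' diracEss) : (diracRelation y hy).IsRegularAt z (tauG y z) := by
  have hw := sq_sub_ne_of_notMem_diracEss hz
  have hw0 : z ^ 2 - 1 / 4 ≠ 0 := by simpa using hw 0 le_rfl
  constructor
  · intro ξ
    set A := Complex.I • (pauli1 * (z • 1 - (1 / 2 : ℂ) • pauli3)) with hA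
    have hm := diracG_memLp (y := y) hw ξ
    have hm' := (Matrix.toEuclideanCLM (n := Fin 2) (𝕜 := ℂ) A).comp_memLp' hm
    obtain ⟨a, b, hab, ht, hr⟩ := diracG_traces hy hw0 ξ
    refine ⟨hm.toLp _, hm'.toLp _, a, b,
      hasWeakDeriv_toLp hm hm' fun x hx => hasDerivAt_diracG hw0 ξ hx, hasTraces_toLp hm hab, ?_,
      hr.symm, ht.symm⟩
    simp only
    have e : hm'.toLp _ = matOp A (hm.toLp _) := (matOp_toLp A hm hm').symm
    rw [e, matOp_comp, hA, Matrix.mul_smul, ← mul_assoc, pauli1_mul_pauli1, one_mul, matOp_smul,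
      sub_eq_add_neg, matOp_add, matOp_neg, matOp_smul, matOp_smul, matOp_one, smul_smul]
    have : -Complex.I * Complex.I = 1 := by simp
    rw [this]
    module
  · -- the free resolvent is `(D + z) (d²/dx² + w)⁻¹` with `w = z² - 1/4`
    obtain ⟨U, V, hUV⟩ := exists_resolvent_second_deriv hw
    refine ⟨-Complex.I • (matOp pauli1 ∘L V) + (1 / 2 : ℂ) • (matOp pauli3 ∘L U) + z • U,
      fun f => ?_⟩
    obtain ⟨h1, h2⟩ := hUV f
    have h3 := (((h2.matOp pauli1).smul (-Complex.I)).add ((h1.matOp pauli3).smul (1 / 2 : ℂ))).add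
      (h1.smul z)
    obtain ⟨a, ha⟩ := h3.exists_hasTraces y
    refine ⟨diracTau a a, _, a, a, h3.mono (Set.empty_subset _), ha, ?_, ?_, rfl⟩
    · simp only [add_apply, smul_apply,
        ContinuousLinearMap.comp_apply, map_add, map_sub, map_smul, matOp_comp, pauli1_mul_pauli1,
        pauli3_mul_pauli3, pauli3_mul_pauli1, matOp_neg, matOp_one]
      match_scalars <;> simp <;> ring_nf <;> simp [Complex.I_sq]
    · ext p
      simp [diracRho]

theorem differentiableOn_tauG (y : Fin n → ℝ) (p q : Fin n × Fin 2) :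
    DifferentiableOn ℂ (fun z => tauG y z p q) (Complex.ofReal '' diracEss)ᶜ := by
  intro z hz
  have hw := sq_sub_ne_of_notMem_diracEss hz
  have hsq : DifferentiableAt ℂ (fun z : ℂ => z ^ 2 - 1 / 4) z := by fun_prop
  have h1 := (differentiableAt_schrodingerKernel hw (y p.1 - y q.1)).comp z hsq
  have h2 := (differentiableAt_schrodingerKernelDeriv hw (y p.1 - y q.1)).comp z hsq
  simp only [tauG, Matrix.of_apply, diracKernel, Matrix.add_apply, Matrix.smul_apply, smul_eq_mul]
  refine DifferentiableAt.differentiableWithinAt ?_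
  exact ((h2.const_mul _).mul_const _).add (h1.mul ((differentiableAt_const _).add
    (differentiableAt_id.mul_const _)))

/-- The symbol `k σ₁ + σ₃/2` of the Dirac operator has the eigenvalue `x` if `k² = x² - 1/4`. -/
theorem exists_dirac_symbol_eigenvector {x : ℝ} (hx : x ∈ diracEss) :
    ∃ (k : ℝ) (v : C2), v ≠ 0 ∧ Matrix.toEuclideanCLM (n := Fin 2) (𝕜 := ℂ)
      ((k : ℂ) • pauli1 + (1 / 2 : ℂ) • pauli3 + (-x : ℂ) • 1) v = 0 := by
  have hx2 : 0 ≤ x ^ 2 - 1 / 4 := by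
    rcases hx with h | h
    · rw [Set.mem_Iic] at h; nlinarith
    · rw [Set.mem_Ici] at h; nlinarith
  have hk : ((√(x ^ 2 - 1 / 4) : ℝ) : ℂ) ^ 2 = x ^ 2 - 1 / 4 := by
    rw [← Complex.ofReal_pow, Real.sq_sqrt hx2]
    push_cast
    ring
  refine ⟨√(x ^ 2 - 1 / 4), ?_⟩
  set k := √(x ^ 2 - 1 / 4)
  -- the eigenvector `(x + 1/2, k)` degenerates for `x = -1/2`
  by_cases h : x = -1 / 2
  · refine ⟨!₂[0, 1], fun h0 => by simpa using congrArg (fun v : C2 => v 1) h0, ?_⟩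
    have hk0 : k = 0 := by
      have : x ^ 2 - 1 / 4 = 0 := by rw [h]; norm_num
      simp only [k, this, Real.sqrt_zero]
    ext i
    rw [Matrix.ofLp_toEuclideanCLM]
    fin_cases i <;> simp [Matrix.mulVec, dotProduct, Fin.sum_univ_two, pauli1, pauli3, hk0, h]
    norm_num
  · refine ⟨!₂[(x : ℂ) + 1 / 2, k], fun h0 => h ?_, ?_⟩
    · have h1 : (x : ℂ) + 1 / 2 = 0 := by simpa using congrArg (fun v : C2 => v 0) h0
      have h2 := congrArg Complex.re h1
      norm_num at h2
      linarith
    · ext i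
      rw [Matrix.ofLp_toEuclideanCLM]
      fin_cases i <;> simp [Matrix.mulVec, dotProduct, Fin.sum_univ_two, pauli1, pauli3]
      · linear_combination hk
      · ring

theorem diracEss_subset_spectrum {y : Fin n → ℝ} (hy : Function.Injective y)
    (c : Couple (Fin n × Fin 2)) {x : ℝ} (hx : x ∈ diracEss) : (x : ℂ) ∈ opSpectrum (diracOp y c) := by
  obtain ⟨k, v, hv, hkv⟩ := exists_dirac_symbol_eigenvector hx
  obtain ⟨B, hB⟩ := (Set.finite_range y).bddAbove
  refine mem_opSpectrum_of_approx fun ε hε => ?_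
  obtain ⟨W, W₁, W₂, h1, -, h3, h4, h5, -, h7⟩ := exists_wave k B
    (ε := ε / (‖matOp pauli1‖ + 1)) (by positivity)
  have hW : W v ≠ 0 := fun h => hv (h7 v h)
  refine ⟨W v, -Complex.I • matOp pauli1 ((Complex.I * (k : ℂ)) • W v + W₁ v) +
    (1 / 2 : ℂ) • matOp pauli3 (W v), (diracOp_isRestriction y hy c _ _).2 ⟨diracRho 0 0, diracTau 0 0,
    ⟨_, 0, 0, (h1 v).mono (Set.empty_subset _),
      (h3 v n y fun j => hB ⟨j, rfl⟩).1, rfl, rfl, rfl⟩, ?_⟩, hW, ?_⟩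
  · rw [diracRho_zero, diracTau_zero]
    exact Couple.Holds.zero c
  · have h8 : matOp ((k : ℂ) • pauli1 + (1 / 2 : ℂ) • pauli3 + (-x : ℂ) • 1) (W v) = 0 := by
      have h0 := h4 0 0
      rw [matOp_zero, map_zero] at h0
      rw [h4, hkv, ← h0]
    rw [matOp_add, matOp_add, matOp_smul, matOp_smul, matOp_smul, matOp_one] at h8
    have e : -Complex.I • matOp pauli1 ((Complex.I * (k : ℂ)) • W v + W₁ v) +
        (1 / 2 : ℂ) • matOp pauli3 (W v) - (x : ℂ) • W v = -Complex.I • matOp pauli1 (W₁ v) := by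
      rw [← sub_eq_zero, ← h8, map_add, map_smul]
      match_scalars <;> simp <;> ring_nf <;> simp [Complex.I_sq]
    rw [e, norm_smul, norm_neg, Complex.norm_I, one_mul]
    have hpos : 0 < ‖matOp pauli1‖ + 1 := by positivity
    calc ‖matOp pauli1 (W₁ v)‖ ≤ ‖matOp pauli1‖ * ‖W₁ v‖ := (matOp pauli1).le_opNorm _
      _ ≤ (‖matOp pauli1‖ + 1) * (ε / (‖matOp pauli1‖ + 1) * ‖W v‖) :=
        mul_le_mul (by linarith) (h5 v) (norm_nonneg _) hpos.le
      _ = ε * ‖W v‖ := by field_simp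

theorem diracEss_accumulates : ∀ x ∈ diracEss, ∀ ε > 0, ∃ x' ∈ diracEss, x' ≠ x ∧ |x' - x| < ε := by
  rintro x (hx | hx) ε hε
  · refine ⟨x - ε / 2, Or.inl ?_, by linarith [hε], ?_⟩
    · rw [Set.mem_Iic] at hx ⊢
      linarith
    · rw [abs_lt]
      constructor <;> linarith
  · refine ⟨x + ε / 2, Or.inr ?_, by linarith [hε], ?_⟩
    · rw [Set.mem_Ici] at hx ⊢
      linarith
    · rw [abs_lt]
      constructor <;> linarith

theorem dirac_spectrum {y : Fin n → ℝ} (hy : Function.Injective y) (c : Couple (Fin n × Fin 2)) :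
    essentialSpectrum (diracOp y c) = Complex.ofReal '' diracEss ∧
      ∀ μ : ℂ, μ ∈ discreteSpectrum (diracOp y c) ↔
        ∃ x ∈ diracEssᶜ, μ = (x : ℂ) ∧ LinearMap.det (c.gamma (tauG y x)) = 0 :=
  (diracOp_isRestriction y hy c).spectrum (isClosed_Iic.union isClosed_Ici)
    (fun _ hz => diracRelation_isRegularAt hy hz) (differentiableOn_tauG y)
    (fun _ hx => diracEss_subset_spectrum hy c hx) diracEss_accumulates

/-! ### The Schrödinger operator -/

theorem schrodingerRho_add (a b a' b' c d c' d' : Fin n → C2) :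
    schrodingerRho (a + c) (b + d) (a' + c') (b' + d') =
      schrodingerRho a b a' b' + schrodingerRho c d c' d' := by
  ext ⟨i, k, j⟩
  fin_cases j <;> simp [schrodingerRho] <;> ring

theorem schrodingerTau_add (a b a' b' c d c' d' : Fin n → C2) :
    schrodingerTau (a + c) (b + d) (a' + c') (b' + d') =
      schrodingerTau a b a' b' + schrodingerTau c d c' d' := by
  ext ⟨i, k, j⟩
  fin_cases j <;> simp [schrodingerTau] <;> ring

theorem schrodingerRho_smul (s : ℂ) (a b a' b' : Fin n → C2) :
    schrodingerRho (s • a) (s • b) (s • a') (s • b') = s • schrodingerRho a b a' b' := by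
  ext ⟨i, k, j⟩
  fin_cases j <;> simp [schrodingerRho] <;> ring

theorem schrodingerTau_smul (s : ℂ) (a b a' b' : Fin n → C2) :
    schrodingerTau (s • a) (s • b) (s • a') (s • b') = s • schrodingerTau a b a' b' := by
  ext ⟨i, k, j⟩
  fin_cases j <;> simp [schrodingerTau] <;> ring

theorem schrodingerRho_zero : schrodingerRho (0 : Fin n → C2) 0 0 0 = 0 := by
  simpa using schrodingerRho_smul 0 (0 : Fin n → C2) 0 0 0

theorem schrodingerTau_zero : schrodingerTau (0 : Fin n → C2) 0 0 0 = 0 := by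
  simpa using schrodingerTau_smul 0 (0 : Fin n → C2) 0 0 0

theorem inner_schrodingerRho_sub_inner (a b c d a' b' c' d' : Fin n → C2) :
    inner ℂ (schrodingerRho a b c d) (schrodingerTau a' b' c' d') -
        inner ℂ (schrodingerTau a b c d) (schrodingerRho a' b' c' d') =
      ∑ k, (inner ℂ (d k) (b' k) - inner ℂ (c k) (a' k)) -
        ∑ k, (inner ℂ (b k) (d' k) - inner ℂ (a k) (c' k)) := by
  simp only [PiLp.inner_apply, Fintype.sum_prod_type, ← Finset.sum_sub_distrib]
  rw [Finset.sum_comm]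
  refine Finset.sum_congr rfl fun k _ => Finset.sum_congr rfl fun i _ => ?_
  simp only [Fin.sum_univ_two, schrodingerRho, schrodingerTau, Matrix.cons_val_zero,
    Matrix.cons_val_one, Matrix.cons_val_fin_one, RCLike.inner_apply, map_sub, map_add, map_neg,
    map_div₀, map_ofNat]
  ring

/-- The Schrödinger expression on `H²(ℝ \ Y; ℂ²)`, with the boundary maps `ρ̂𝟙` and `τ̂𝟙`. -/
def schrodingerRelation (y : Fin n → ℝ) (hy : Function.Injective y) :
    BoundaryRelation L2 (Fin 2 × Fin n × Fin 2) where
  rel :=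
    { carrier := {p | ∃ Φ Ξ a b a' b', HasWeakDeriv (Set.range y) p.1 Φ ∧
        HasWeakDeriv (Set.range y) Φ Ξ ∧ HasTraces y p.1 a b ∧ HasTraces y Φ a' b' ∧
        p.2.1 = -Ξ ∧ p.2.2.1 = schrodingerRho a b a' b' ∧ p.2.2.2 = schrodingerTau a b a' b'}
      add_mem' := by
        rintro p q ⟨Φ, Ξ, a, b, c, d, h1, h2, t1, t2, e1, e2, e3⟩
          ⟨Φ', Ξ', a', b', c', d', h1', h2', t1', t2', e1', e2', e3'⟩
        refine ⟨Φ + Φ', Ξ + Ξ', a + a', b + b', c + c', d + d', h1.add h1', h2.add h2',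
          t1.add t1', t2.add t2', ?_, ?_, ?_⟩
        · simp only [Prod.fst_add, Prod.snd_add, e1, e1', neg_add]
        · simp only [Prod.fst_add, Prod.snd_add, e2, e2', schrodingerRho_add]
        · simp only [Prod.snd_add, e3, e3', schrodingerTau_add]
      zero_mem' := by
        refine ⟨0, 0, 0, 0, 0, 0, HasWeakDeriv.zero _, HasWeakDeriv.zero _, HasTraces.zero y,
          HasTraces.zero y, ?_, ?_, ?_⟩
        · simp
        · exact schrodingerRho_zero.symm
        · exact schrodingerTau_zero.symm
      smul_mem' := by
        rintro s p ⟨Φ, Ξ, a, b, c, d, h1, h2, t1, t2, e1, e2, e3⟩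
        refine ⟨s • Φ, s • Ξ, s • a, s • b, s • c, s • d, h1.smul s, h2.smul s,
          t1.smul s, t2.smul s, ?_, ?_, ?_⟩
        · simp only [Prod.smul_fst, Prod.smul_snd, e1, smul_neg]
        · simp only [Prod.smul_fst, Prod.smul_snd, e2, schrodingerRho_smul]
        · simp only [Prod.smul_snd, e3, schrodingerTau_smul] }
  green := by
    rintro Ψ w r t Ψ' w' r' t' ⟨Φ, Ξ, a, b, c, d, h1, h2, t1, t2, e1, e2, e3⟩
      ⟨Φ', Ξ', a', b', c', d', h1', h2', t1', t2', e1', e2', e3'⟩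
    simp only at h1 h2 t1 t2 e1 e2 e3 h1' h2' t1' t2' e1' e2' e3'
    subst e1 e2 e3 e1' e2' e3'
    rw [inner_schrodingerRho_sub_inner, inner_neg_left, inner_neg_right]
    linear_combination HasWeakDeriv.inner_add_inner hy h1 h2' t1 t2' -
      HasWeakDeriv.inner_add_inner hy h2 h1' t2 t1'
  rho_zero := by
    rintro r t ⟨Φ, Ξ, a, b, c, d, h1, h2, t1, t2, e1, e2, e3⟩
    simp only at h1 h2 t1 t2 e2 e3
    obtain rfl := h1.unique (Set.finite_range y) (HasWeakDeriv.zero _)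
    obtain ⟨rfl, rfl⟩ := HasTraces.unique t1 (HasTraces.zero y)
    obtain ⟨rfl, rfl⟩ := HasTraces.unique t2 (HasTraces.zero y)
    rw [e2, e3]
    exact ⟨schrodingerRho_zero, schrodingerTau_zero⟩

theorem schrodingerOp_isRestriction (y : Fin n → ℝ) (hy : Function.Injective y)
    (c : Couple (Fin 2 × Fin n × Fin 2)) :
    (schrodingerRelation y hy).IsRestriction c (schrodingerOp y c) := by
  have hY := Set.finite_range y
  intro u w
  rw [LinearPMap.mem_graph_iff]
  constructor
  · rintro ⟨v, rfl, rfl⟩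
    obtain ⟨⟨Φ, hΦ, a, b, a', b', t1, t2, hc⟩, hv, hv'⟩ := v.2
    have h1 := weakDiff_spec hY ⟨v, hv⟩
    obtain rfl := hΦ.unique hY h1
    exact ⟨_, _, ⟨_, _, a, b, a', b', h1, weakDiff_spec hY ⟨_, hv'⟩, t1, t2, rfl, rfl, rfl⟩, hc⟩
  · rintro ⟨r, t, ⟨Φ, Ξ, a, b, a', b', h1, h2, t1, t2, e1, e2, e3⟩, hc⟩
    simp only at h1 h2 t1 t2 e1 e2 e3
    subst e1 e2 e3
    have hd : u ∈ (weakDiff (Set.range y) hY).domain := ⟨Φ, h1⟩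
    have hΦ := (weakDiff_spec hY ⟨u, hd⟩).unique hY h1
    have hd' : weakDiff (Set.range y) hY ⟨u, hd⟩ ∈ (weakDiff (Set.range y) hY).domain :=
      ⟨Ξ, hΦ ▸ h2⟩
    refine ⟨⟨u, ⟨Φ, h1, a, b, a', b', t1, t2, hc⟩, hd, hd'⟩, rfl, ?_⟩
    have := (weakDiff_spec hY ⟨_, hd'⟩).unique hY (hΦ ▸ h2)
    rw [← this]
    rfl

/-! #### The resolvent kernel -/

theorem hasDerivAt_schrodingerGDeriv {y : Fin n → ℝ} {z : ℂ} (hz : z ≠ 0)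
    (ξ : EuclideanSpace ℂ (Fin n × Fin 2)) {x : ℝ} (hx : x ∉ Set.range y) :
    HasDerivAt (schrodingerGDeriv y z ξ) (-z * schrodingerG y z ξ x) x := by
  rw [schrodingerG, Finset.mul_sum]
  refine HasDerivAt.fun_sum fun q _ => ?_
  rw [← mul_assoc]
  refine HasDerivAt.mul_const ?_ _
  have hne : y q.1 - x ≠ 0 := fun h => hx ⟨q.1, sub_eq_zero.1 h⟩
  obtain ⟨m, j⟩ := q
  have hs : HasDerivAt (fun x : ℝ => y m - x) (-1) x := by
    simpa using (hasDerivAt_id x).const_sub (y m)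
  fin_cases j
  · have h := ((hasDerivAt_schrodingerKernelDeriv hz hne).scomp x hs).fun_neg
    simpa [Function.comp_def] using h
  · have h := ((hasDerivAt_schrodingerKernel hz hne).scomp x hs).const_mul z
    simpa [Function.comp_def] using h

theorem memLp_schrodingerG {y : Fin n → ℝ} {z : ℂ} (hz : ∀ x : ℝ, 0 ≤ x → z ≠ x)
    (ξ : EuclideanSpace ℂ (Fin n × Fin 2)) : MemLp (schrodingerG y z ξ) 2 := by
  unfold schrodingerG
  refine memLp_finsetSum _ fun q _ => MemLp.mul_const ?_ (ξ q)
  obtain ⟨m, j⟩ := q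
  fin_cases j
  · exact (memLp_schrodingerKernel hz).comp_sub_left (y m)
  · exact (memLp_schrodingerKernelDeriv hz).comp_sub_left (y m)

theorem memLp_schrodingerGDeriv {y : Fin n → ℝ} {z : ℂ} (hz : ∀ x : ℝ, 0 ≤ x → z ≠ x)
    (ξ : EuclideanSpace ℂ (Fin n × Fin 2)) : MemLp (schrodingerGDeriv y z ξ) 2 := by
  unfold schrodingerGDeriv
  refine memLp_finsetSum _ fun q _ => MemLp.mul_const ?_ (ξ q)
  obtain ⟨m, j⟩ := q
  fin_cases j
  · exact ((memLp_schrodingerKernelDeriv hz).comp_sub_left (y m)).neg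
  · exact ((memLp_schrodingerKernel hz).comp_sub_left (y m)).const_mul z

theorem ne_of_notMem_Ici {z : ℂ} (hz : z ∉ Complex.ofReal '' Set.Ici 0) :
    ∀ x : ℝ, 0 ≤ x → z ≠ x := fun x hx h => hz ⟨x, hx, h.symm⟩

theorem toEuclideanLin_tauGHatOne (y : Fin n → ℝ) (z : ℂ)
    (ξ : EuclideanSpace ℂ (Fin 2 × Fin n × Fin 2)) (i : Fin 2) (p : Fin n × Fin 2) :
    Matrix.toEuclideanLin (tauGHatOne y z) ξ (i, p) =
      Matrix.toEuclideanLin (tauGHat y z) (WithLp.toLp 2 fun q => ξ (i, q)) p := by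
  simp only [Matrix.toLpLin_apply, Matrix.mulVec, dotProduct, tauGHatOne, Matrix.kronecker,
    Matrix.kroneckerMap_apply]
  rw [Fintype.sum_prod_type, Finset.sum_eq_single i]
  · simp
  · intro j _ hj
    simp [Matrix.one_apply_ne hj.symm]
  · simp

theorem schrodingerRelation_isRegularAt {y : Fin n → ℝ} (hy : Function.Injective y) {z : ℂ}
    (hz : z ∉ Complex.ofReal '' Set.Ici 0) :
    (schrodingerRelation y hy).IsRegularAt z (tauGHatOne y z) := by
  have hw := ne_of_notMem_Ici hz
  have hz0 : z ≠ 0 := by simpa using hw 0 le_rfl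
  constructor
  · intro ξ
    let ξ' : Fin 2 → EuclideanSpace ℂ (Fin n × Fin 2) := fun i => WithLp.toLp 2 fun q => ξ (i, q)
    let f : ℝ → C2 := fun x => WithLp.toLp 2 fun i => schrodingerG y z (ξ' i) x
    let f' : ℝ → C2 := fun x => WithLp.toLp 2 fun i => schrodingerGDeriv y z (ξ' i) x
    have hf : MemLp f 2 := memLp_piLp_iff.2 fun i => memLp_schrodingerG hw (ξ' i)
    have hf' : MemLp f' 2 := memLp_piLp_iff.2 fun i => memLp_schrodingerGDeriv hw (ξ' i)
    choose a b a' b' h1 h2 h3 h4 h5 h6 h7 h8 using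
      fun i => (schrodingerG_traces hy hz0 (ξ' i)).2
    have hd : HasWeakDeriv (Set.range y) (hf'.toLp f') (-z • hf.toLp f) := by
      rw [← MemLp.toLp_const_smul]
      refine hasWeakDeriv_toLp hf' _ fun x hx => hasDerivAt_C2 fun i => ?_
      exact hasDerivAt_schrodingerGDeriv hz0 (ξ' i) hx
    have ht : ∀ {g : ℝ → C2} (l : Filter ℝ) (v : Fin 2 → ℂ),
        (∀ i, Tendsto (fun x => g x i) l (𝓝 (v i))) → Tendsto g l (𝓝 (WithLp.toLp 2 v)) :=
      fun l v h => (PiLp.continuous_toLp 2 _).continuousAt.tendsto.comp (tendsto_pi_nhds.2 h)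
    refine ⟨hf.toLp f, hf'.toLp f', -z • hf.toLp f, fun k => WithLp.toLp 2 fun i => a i k,
      fun k => WithLp.toLp 2 fun i => b i k, fun k => WithLp.toLp 2 fun i => a' i k,
      fun k => WithLp.toLp 2 fun i => b' i k,
      hasWeakDeriv_toLp hf hf' fun x hx => hasDerivAt_C2 fun i =>
        (schrodingerG_traces hy hz0 (ξ' i)).1 x hx, hd,
      hasTraces_toLp hf fun k => ⟨ht _ _ fun i => h1 i k, ht _ _ fun i => h2 i k⟩,
      hasTraces_toLp hf' fun k => ⟨ht _ _ fun i => h3 i k, ht _ _ fun i => h4 i k⟩, ?_, ?_, ?_⟩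
    · simp
    · ext ⟨i, k, j⟩
      fin_cases j
      · exact (h7 i k).symm
      · exact (h8 i k).symm
    · ext ⟨i, k, j⟩
      simp only [toEuclideanLin_tauGHatOne]
      fin_cases j
      · exact (h5 i k).symm
      · exact (h6 i k).symm
  · obtain ⟨U, V, hUV⟩ := exists_resolvent_second_deriv hw
    refine ⟨U, fun f => ?_⟩
    obtain ⟨h1, h2⟩ := hUV f
    obtain ⟨a, ha⟩ := h1.exists_hasTraces y
    obtain ⟨a', ha'⟩ := h2.exists_hasTraces y
    refine ⟨schrodingerTau a a a' a', _, _, a, a, a', a', h1.mono (Set.empty_subset _),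
      h2.mono (Set.empty_subset _), ha, ha', (neg_sub _ _).symm, ?_, rfl⟩
    ext ⟨i, k, j⟩
    fin_cases j <;> simp [schrodingerRho]

theorem differentiableOn_tauGHatOne (y : Fin n → ℝ) (p q : Fin 2 × Fin n × Fin 2) :
    DifferentiableOn ℂ (fun z => tauGHatOne y z p q) (Complex.ofReal '' Set.Ici 0)ᶜ := by
  intro z hz
  have hw := ne_of_notMem_Ici hz
  refine DifferentiableAt.differentiableWithinAt ?_
  obtain ⟨i, k, s⟩ := p
  obtain ⟨i', k', s'⟩ := q
  have h1 := differentiableAt_schrodingerKernel hw (y k' - y k)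
  have h2 := differentiableAt_schrodingerKernelDeriv hw (y k' - y k)
  simp only [tauGHatOne, Matrix.kronecker, Matrix.kroneckerMap_apply, tauGHat, Matrix.of_apply]
  refine DifferentiableAt.const_mul ?_ _
  fin_cases s <;> fin_cases s'
  · exact h1
  · exact h2
  · exact h2.neg
  · exact differentiableAt_id.mul h1

theorem Ici_subset_spectrum_schrodingerOp {y : Fin n → ℝ} (hy : Function.Injective y)
    (c : Couple (Fin 2 × Fin n × Fin 2)) {x : ℝ} (hx : x ∈ Set.Ici 0) :
    (x : ℂ) ∈ opSpectrum (schrodingerOp y c) := by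
  obtain ⟨B, hB⟩ := (Set.finite_range y).bddAbove
  refine mem_opSpectrum_of_approx fun ε hε => ?_
  set k := √x with hk
  have hk0 : 0 ≤ k := Real.sqrt_nonneg x
  have hkx : (k : ℂ) ^ 2 = x := by
    rw [← Complex.ofReal_pow, hk, Real.sq_sqrt hx]
  obtain ⟨W, W₁, W₂, h1, h2, h3, -, h5, h6, h7⟩ := exists_wave k B
    (ε := ε / (2 * k + 1)) (by positivity)
  let v : C2 := EuclideanSpace.single 0 1
  have hv : v ≠ 0 := fun h => by simpa [v] using congrArg (fun v : C2 => v 0) h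
  have hW : W v ≠ 0 := fun h => hv (h7 v h)
  have ht := h3 v n y fun j => hB ⟨j, rfl⟩
  have ht1 : HasTraces y ((Complex.I * k) • W v + W₁ v) 0 0 := by
    simpa using (ht.1.smul (Complex.I * k)).add ht.2
  refine ⟨W v, -((Complex.I * k) • ((Complex.I * k) • W v + W₁ v) +
      ((Complex.I * k) • W₁ v + W₂ v)),
    (schrodingerOp_isRestriction y hy c _ _).2 ⟨schrodingerRho 0 0 0 0, schrodingerTau 0 0 0 0,
      ⟨_, _, 0, 0, 0, 0, (h1 v).mono (Set.empty_subset _),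
        (((h1 v).smul _).add (h2 v)).mono (Set.empty_subset _), ht.1, ht1, rfl, rfl, rfl⟩, ?_⟩,
    hW, ?_⟩
  · rw [schrodingerRho_zero, schrodingerTau_zero]
    exact Couple.Holds.zero c
  · have e : -((Complex.I * k) • ((Complex.I * k) • W v + W₁ v) +
        ((Complex.I * k) • W₁ v + W₂ v)) - (x : ℂ) • W v =
        -((2 * Complex.I * k) • W₁ v + W₂ v) := by
      rw [← hkx]
      have hI := Complex.I_sq
      match_scalars
      · linear_combination -(k : ℂ) ^ 2 * hI
      · ring
      · ring
    rw [e, norm_neg]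
    have hn : ‖(2 * Complex.I * k : ℂ)‖ = 2 * k := by
      simp [abs_of_nonneg hk0]
    calc ‖(2 * Complex.I * k) • W₁ v + W₂ v‖ ≤ ‖(2 * Complex.I * k) • W₁ v‖ + ‖W₂ v‖ :=
          norm_add_le _ _
      _ = 2 * k * ‖W₁ v‖ + ‖W₂ v‖ := by rw [norm_smul, hn]
      _ ≤ 2 * k * (ε / (2 * k + 1) * ‖W v‖) + ε / (2 * k + 1) * ‖W v‖ := by
        gcongr
        · exact h5 v
        · exact h6 v
      _ = ε * ‖W v‖ := by field_simp

theorem schrodinger_spectrum {y : Fin n → ℝ} (hy : Function.Injective y)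
    (c : Couple (Fin 2 × Fin n × Fin 2)) :
    essentialSpectrum (schrodingerOp y c) = Complex.ofReal '' Set.Ici 0 ∧
      ∀ μ : ℂ, μ ∈ discreteSpectrum (schrodingerOp y c) ↔
        ∃ x ∈ (Set.Ici (0 : ℝ))ᶜ, μ = (x : ℂ) ∧ LinearMap.det (c.gamma (tauGHatOne y x)) = 0 := by
  refine (schrodingerOp_isRestriction y hy c).spectrum isClosed_Ici
    (fun _ hz => schrodingerRelation_isRegularAt hy hz) (differentiableOn_tauGHatOne y)
    (fun _ hx => Ici_subset_spectrum_schrodingerOp hy c hx) fun x hx ε hε =>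
      ⟨x + ε / 2, ?_, by linarith, ?_⟩
  · rw [Set.mem_Ici] at hx ⊢
    linarith
  · rw [add_sub_cancel_left, abs_of_pos (by linarith)]
    linarith

/-! ### The free operators -/

theorem range_elim0 : Set.range (Fin.elim0 : Fin 0 → ℝ) = ∅ := Set.range_eq_empty _

/-- The couple `(0, 0)`, with the boundary condition `r = 0`. -/
def zeroCouple (ι : Type) [Fintype ι] : Couple ι where
  proj := 0
  isProj := ⟨IsIdempotentElem.zero, LinearMap.IsSymmetric.zero⟩
  theta := 0
  isSymm := LinearMap.IsSymmetric.zero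

theorem Couple.holds_of_isEmpty {ι : Type} [Fintype ι] [IsEmpty ι] (c : Couple ι)
    (r t : EuclideanSpace ℂ ι) : c.Holds r t := by
  have h := Couple.Holds.zero c
  rwa [Subsingleton.elim r 0, Subsingleton.elim t 0]

/-- Without points, every boundary condition is empty and leaves the free operator. -/
theorem freeDirac_eq (c : Couple (Fin 0 × Fin 2)) : freeDirac = diracOp Fin.elim0 c := by
  refine LinearPMap.eq_of_eq_graph (Submodule.ext fun p => ?_)
  obtain ⟨u, w⟩ := p
  rw [diracOp_isRestriction _ (Function.injective_of_subsingleton _) c u w,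
    LinearPMap.mem_graph_iff]
  constructor
  · rintro ⟨v, rfl, rfl⟩
    refine ⟨_, _, ⟨_, Fin.elim0, Fin.elim0, ?_, fun k => k.elim0, rfl, rfl, rfl⟩,
      c.holds_of_isEmpty _ _⟩
    rw [range_elim0]
    exact weakDiff_spec Set.finite_empty v
  · rintro ⟨r, t, ⟨Φ, a, b, h, -, e1, -, -⟩, -⟩
    simp only at h e1
    rw [range_elim0] at h
    have hd : u ∈ (weakDiff ∅ Set.finite_empty).domain := ⟨Φ, h⟩
    refine ⟨⟨u, hd⟩, rfl, ?_⟩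
    have := (weakDiff_spec Set.finite_empty ⟨u, hd⟩).unique Set.finite_empty h
    rw [e1, ← this]
    rfl

theorem freeSchrodinger_eq (c : Couple (Fin 2 × Fin 0 × Fin 2)) :
    freeSchrodinger = schrodingerOp Fin.elim0 c := by
  refine LinearPMap.eq_of_eq_graph (Submodule.ext fun p => ?_)
  obtain ⟨u, w⟩ := p
  rw [schrodingerOp_isRestriction _ (Function.injective_of_subsingleton _) c u w,
    LinearPMap.mem_graph_iff]
  constructor
  · rintro ⟨v, rfl, rfl⟩
    obtain ⟨hv, hv'⟩ := v.2
    refine ⟨_, _, ⟨weakDiff ∅ Set.finite_empty ⟨v, hv⟩, weakDiff ∅ Set.finite_empty ⟨_, hv'⟩,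
      Fin.elim0, Fin.elim0, Fin.elim0, Fin.elim0, ?_, ?_, fun k => k.elim0,
      fun k => k.elim0, rfl, rfl, rfl⟩, c.holds_of_isEmpty _ _⟩
    · rw [range_elim0]
      exact weakDiff_spec Set.finite_empty ⟨v, hv⟩
    · rw [range_elim0]
      exact weakDiff_spec Set.finite_empty ⟨_, hv'⟩
  · rintro ⟨r, t, ⟨Φ, Ξ, a, b, a', b', h1, h2, -, -, e1, -, -⟩, -⟩
    simp only at h1 e1
    rw [range_elim0] at h1 h2
    have hd : u ∈ (weakDiff ∅ Set.finite_empty).domain := ⟨Φ, h1⟩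
    have hΦ := (weakDiff_spec Set.finite_empty ⟨u, hd⟩).unique Set.finite_empty h1
    have hd' : weakDiff ∅ Set.finite_empty ⟨u, hd⟩ ∈ (weakDiff ∅ Set.finite_empty).domain :=
      ⟨Ξ, hΦ ▸ h2⟩
    refine ⟨⟨u, hd, hd'⟩, rfl, ?_⟩
    have := (weakDiff_spec Set.finite_empty ⟨_, hd'⟩).unique Set.finite_empty (hΦ ▸ h2)
    rw [e1, ← this]
    rfl

/-! ### The resolvent of the square of a symmetric operator -/

section Square

variable {E : Type*} [NormedAddCommGroup E] [InnerProductSpace ℂ E] {A B : E →ₗ.[ℂ] E}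

theorem isResolventAt_iff {z : ℂ} {R : E →L[ℂ] E} : IsResolventAt A z R ↔
    (∀ f, (R f, z • R f - f) ∈ A.graph) ∧ ∀ u w, (u, w) ∈ A.graph → R (z • u - w) = u := by
  refine and_congr (forall_congr' fun f => ?_) ⟨fun h u w hg => ?_, fun h u => h _ _ (A.mem_graph u)⟩
  · rw [LinearPMap.mem_graph_iff]
    constructor
    · rintro ⟨h, e⟩
      exact ⟨⟨R f, h⟩, rfl, eq_sub_of_add_eq' (sub_eq_iff_eq_add.1 e).symm⟩
    · rintro ⟨v, e1, e2⟩
      simp only at e1 e2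
      refine ⟨e1 ▸ v.2, ?_⟩
      have : (⟨R f, e1 ▸ v.2⟩ : A.domain) = v := Subtype.ext e1.symm
      rw [this, e2, sub_sub_cancel]
  · obtain ⟨v, rfl, rfl⟩ := (LinearPMap.mem_graph_iff A).1 hg
    exact h v

theorem mem_graph_of_opSq_eq {c : ℂ} (h : opSq A = addConst B c) {u v : E} :
    (u, v) ∈ B.graph ↔ ∃ m, (u, m) ∈ A.graph ∧ (m, v + c • u) ∈ A.graph := by
  have h1 : (u, v) ∈ B.graph ↔ (u, v + c • u) ∈ (addConst B c).graph := by
    rw [LinearPMap.mem_graph_iff, LinearPMap.mem_graph_iff]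
    constructor
    · rintro ⟨x, rfl, rfl⟩
      exact ⟨x, rfl, rfl⟩
    · rintro ⟨x, rfl, hx⟩
      exact ⟨x, rfl, add_right_cancel (b := c • (x : E)) hx⟩
  rw [h1, ← h, LinearPMap.mem_graph_iff]
  constructor
  · rintro ⟨x, rfl, hx⟩
    obtain ⟨hd, hd'⟩ := x.2
    refine ⟨_, A.mem_graph ⟨x, hd⟩, ?_⟩
    simp only at hx
    rw [← hx]
    exact A.mem_graph ⟨_, hd'⟩
  · rintro ⟨m, hm, hm'⟩
    obtain ⟨x, rfl, rfl⟩ := (LinearPMap.mem_graph_iff A).1 hm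
    obtain ⟨x', hx, hx'⟩ := (LinearPMap.mem_graph_iff A).1 hm'
    simp only at hx hx'
    have hd : A x ∈ A.domain := hx ▸ x'.2
    refine ⟨⟨x, x.2, hd⟩, rfl, ?_⟩
    have : x' = ⟨A x, hd⟩ := Subtype.ext hx
    rw [← hx', this]
    rfl

/-- From `z² - A² = -(z - A)(-z - A)`. -/
theorem mem_opResolventSet_of_opSq_eq {c z : ℂ} (h : opSq A = addConst B c)
    (hz : z ∈ opResolventSet A) (hz' : -z ∈ opResolventSet A) :
    z ^ 2 - c ∈ opResolventSet B := by
  obtain ⟨R, hR⟩ := hz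
  obtain ⟨R', hR'⟩ := hz'
  rw [isResolventAt_iff] at hR hR'
  refine ⟨-(R' ∘L R), isResolventAt_iff.2 ⟨fun f => ?_, fun u v huv => ?_⟩⟩
  · change (-R' (R f), (z ^ 2 - c) • -R' (R f) - f) ∈ B.graph
    refine (mem_graph_of_opSq_eq h).2 ⟨z • R' (R f) + R f, ?_, ?_⟩
    · convert A.graph.neg_mem (hR'.1 (R f)) using 1
      refine Prod.ext rfl ?_
      change _ = -(-z • R' (R f) - R f)
      module
    · convert A.graph.add_mem (A.graph.smul_mem z (hR'.1 (R f))) (hR.1 f) using 1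
      refine Prod.ext rfl ?_
      change _ = z • (-z • R' (R f) - R f) + (z • R f - f)
      module
  · obtain ⟨m, hm, hm'⟩ := (mem_graph_of_opSq_eq h).1 huv
    change -R' (R ((z ^ 2 - c) • u - v)) = u
    have e : (z ^ 2 - c) • u - v = z • (z • u - m) + (z • m - (v + c • u)) := by module
    rw [e, map_add, map_smul, hR.2 _ _ hm, hR.2 _ _ hm', ← map_neg]
    have e' : -(z • u + m) = -z • u - m := by module
    rw [e', hR'.2 _ _ hm]

/-- If `R̂` is the resolvent of `A² - c` at `z² - c`, then `(A + z) R̂` solves the resolvent equation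
of `A` at `z`. -/
theorem exists_mem_graph_of_opSq_eq {c z : ℂ} (h : opSq A = addConst B c) {Rh : E →L[ℂ] E}
    (hRh : IsResolventAt B (z ^ 2 - c) Rh) (f : E) :
    ∃ m, (Rh f, m) ∈ A.graph ∧ (m, z ^ 2 • Rh f - f) ∈ A.graph ∧
      (m + z • Rh f, z • (m + z • Rh f) - f) ∈ A.graph := by
  obtain ⟨m, hm, hm'⟩ := (mem_graph_of_opSq_eq h).1 ((isResolventAt_iff.1 hRh).1 f)
  have e : (z ^ 2 - c) • Rh f - f + c • Rh f = z ^ 2 • Rh f - f := by module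
  rw [e] at hm'
  refine ⟨m, hm, hm', ?_⟩
  convert A.graph.add_mem hm' (A.graph.smul_mem z hm) using 1
  refine Prod.ext rfl ?_
  change _ = z ^ 2 • Rh f - f + z • m
  module

theorem resolvent_eq_of_opSq_eq {c z : ℂ} (h : opSq A = addConst B c) {R Rh : E →L[ℂ] E}
    (hR : IsResolventAt A z R) (hRh : IsResolventAt B (z ^ 2 - c) Rh) (f : E) :
    ∃ h : Rh f ∈ A.domain, R f = A ⟨Rh f, h⟩ + z • Rh f := by
  obtain ⟨m, hm, -, hg⟩ := exists_mem_graph_of_opSq_eq h hRh f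
  obtain ⟨v, hv, hAv⟩ := (LinearPMap.mem_graph_iff A).1 hm
  simp only at hv hAv
  refine ⟨hv ▸ v.2, ?_⟩
  have e : (⟨Rh f, hv ▸ v.2⟩ : A.domain) = v := Subtype.ext hv.symm
  have h1 := (isResolventAt_iff.1 hR).2 _ _ hg
  rw [sub_sub_cancel] at h1
  rw [e, hAv, h1]

/-- For symmetric `A` the operator `(A + z) R̂` is bounded, since `‖A R̂ f‖² = ⟨A² R̂ f, R̂ f⟩`; it is
the resolvent of `A` at `z`. -/
theorem mem_opResolventSet_of_sq_sub_mem {c z : ℂ} (h : opSq A = addConst B c)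
    (hA : ∀ {u w u' w' : E}, (u, w) ∈ A.graph → (u', w') ∈ A.graph → inner ℂ w u' = inner ℂ u w')
    (hz : z ^ 2 - c ∈ opResolventSet B) : z ∈ opResolventSet A := by
  obtain ⟨Rh, hRh⟩ := hz
  choose m hm hm' hg using exists_mem_graph_of_opSq_eq h hRh
  have huniq : ∀ {u w w'}, (u, w) ∈ A.graph → (u, w') ∈ A.graph → w = w' := fun h h' =>
    A.mem_graph_snd_inj h h' rfl
  let L : E →ₗ[ℂ] E :=
    { toFun := m
      map_add' := fun f g => huniq (hm (f + g)) (by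
        rw [map_add]
        exact A.graph.add_mem (hm f) (hm g))
      map_smul' := fun a f => huniq (hm (a • f)) (by
        rw [map_smul]
        exact A.graph.smul_mem a (hm f)) }
  set C := (‖z ^ 2‖ * ‖Rh‖ + 1) * ‖Rh‖ with hC
  have hC0 : 0 ≤ C := by positivity
  have hbound : ∀ f, ‖L f‖ ≤ (C + 1) * ‖f‖ := by
    intro f
    have h1 : ‖m f‖ ^ 2 = ‖(inner ℂ (z ^ 2 • Rh f - f) (Rh f) : ℂ)‖ := by
      rw [hA (hm' f) (hm f), inner_self_eq_norm_sq_to_K, norm_pow, RCLike.norm_ofReal, abs_norm]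
    have h2 : ‖z ^ 2 • Rh f - f‖ ≤ (‖z ^ 2‖ * ‖Rh‖ + 1) * ‖f‖ := by
      calc ‖z ^ 2 • Rh f - f‖ ≤ ‖z ^ 2 • Rh f‖ + ‖f‖ := norm_sub_le _ _
        _ ≤ ‖z ^ 2‖ * (‖Rh‖ * ‖f‖) + ‖f‖ := by
          rw [norm_smul]
          gcongr
          exact Rh.le_opNorm f
        _ = _ := by ring
    have h3 : ‖m f‖ ^ 2 ≤ C * ‖f‖ ^ 2 := by
      calc ‖m f‖ ^ 2 ≤ ‖z ^ 2 • Rh f - f‖ * ‖Rh f‖ := h1 ▸ norm_inner_le_norm _ _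
        _ ≤ ((‖z ^ 2‖ * ‖Rh‖ + 1) * ‖f‖) * (‖Rh‖ * ‖f‖) :=
          mul_le_mul h2 (Rh.le_opNorm f) (norm_nonneg _) (by positivity)
        _ = C * ‖f‖ ^ 2 := by rw [hC]; ring
    refine le_of_sq_le_sq (h3.trans ?_) (by positivity)
    rw [mul_pow]
    refine mul_le_mul_of_nonneg_right ?_ (by positivity)
    nlinarith
  refine ⟨L.mkContinuous _ hbound + z • Rh, isResolventAt_iff.2 ⟨hg, fun u w huw => ?_⟩⟩
  -- `A - z` is injective: its kernel lies in the kernel of `B - (z² - c)`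
  set x := m (z • u - w) + z • Rh (z • u - w) with hx
  change x = u
  have h1 : (x - u, z • (x - u)) ∈ A.graph := by
    convert A.graph.sub_mem (hg (z • u - w)) huw using 1
    refine Prod.ext rfl ?_
    change z • (x - u) = z • x - (z • u - w) - w
    module
  have h2 : (x - u, (z ^ 2 - c) • (x - u)) ∈ B.graph := by
    refine (mem_graph_of_opSq_eq h).2 ⟨_, h1, ?_⟩
    convert A.graph.smul_mem z h1 using 1
    refine Prod.ext rfl ?_
    change _ = z • z • (x - u)
    module
  have h3 := (isResolventAt_iff.1 hRh).2 _ _ h2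
  rw [sub_self, map_zero] at h3
  exact (sub_eq_zero.1 h3.symm)

theorem mem_opResolventSet_iff_of_opSq_eq {c z : ℂ} (h : opSq A = addConst B c)
    (hA : ∀ {u w u' w' : E}, (u, w) ∈ A.graph → (u', w') ∈ A.graph →
      inner ℂ w u' = inner ℂ u w') :
    (z ∈ opResolventSet A ∧ -z ∈ opResolventSet A) ↔ z ^ 2 - c ∈ opResolventSet B :=
  ⟨fun hz => mem_opResolventSet_of_opSq_eq h hz.1 hz.2, fun hz =>
    ⟨mem_opResolventSet_of_sq_sub_mem h hA hz, mem_opResolventSet_of_sq_sub_mem h hA (by rwa [neg_sq])⟩⟩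

theorem mem_discreteSpectrum_iff {z : ℂ} :
    z ∈ discreteSpectrum A ↔ z ∈ opSpectrum A ∧ z ∉ essentialSpectrum A :=
  ⟨fun h => ⟨h.1, fun h' => h'.2 h⟩, fun h => by_contra fun h' => h.2 ⟨h.1, h'⟩⟩

end Square

theorem mem_diracEss_compl {x : ℝ} : x ∈ diracEssᶜ ↔ x ∈ Set.Ioo (-1 / 2 : ℝ) (1 / 2) := by
  simp [diracEss]

theorem ofReal_mem_image {x : ℝ} {S : Set ℝ} : (x : ℂ) ∈ Complex.ofReal '' S ↔ x ∈ S :=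
  Complex.ofReal_injective.mem_set_image

end PointInteraction

end

open PointInteraction

theorem mainTheorem10 {n : ℕ} (y : Fin n → ℝ) (hy : StrictMono y) :
    -- essential spectra of the free operators
    essentialSpectrum freeDirac = Complex.ofReal '' (Set.Iic (-1 / 2) ∪ Set.Ici (1 / 2)) ∧
    essentialSpectrum freeSchrodinger = Complex.ofReal '' Set.Ici 0 ∧
    -- essential and discrete spectrum of `D_{Π,Θ}`
    (∀ c : Couple (Fin n × Fin 2),
      essentialSpectrum (diracOp y c) = Complex.ofReal '' (Set.Iic (-1 / 2) ∪ Set.Ici (1 / 2)) ∧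
      ∀ μ : ℂ, μ ∈ discreteSpectrum (diracOp y c) ↔
        ∃ x ∈ Set.Ioo (-1 / 2 : ℝ) (1 / 2), μ = (x : ℂ) ∧
          LinearMap.det (c.gamma (tauG y x)) = 0) ∧
    -- essential and discrete spectrum of `Ĥ_{Π̂,Θ̂}`
    (∀ ch : Couple (Fin 2 × Fin n × Fin 2),
      essentialSpectrum (schrodingerOp y ch) = Complex.ofReal '' Set.Ici 0 ∧
      ∀ μ : ℂ, μ ∈ discreteSpectrum (schrodingerOp y ch) ↔
        ∃ x ∈ Set.Iio (0 : ℝ), μ = (x : ℂ) ∧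
          LinearMap.det (ch.gamma (tauGHatOne y x)) = 0) ∧
    -- the correspondence, for couples such that `(D_{Π,Θ})² = Ĥ_{Π̂,Θ̂} + 1/4`
    (∀ (c : Couple (Fin n × Fin 2)) (ch : Couple (Fin 2 × Fin n × Fin 2)),
      opSq (diracOp y c) = addConst (schrodingerOp y ch) (1 / 4) →
        (∀ z : ℂ, (z ∈ opResolventSet (diracOp y c) ∧ -z ∈ opResolventSet (diracOp y c)) ↔
          z ^ 2 - 1 / 4 ∈ opResolventSet (schrodingerOp y ch)) ∧
        (∀ z : ℂ, (z ∈ opSpectrum (diracOp y c) ∨ -z ∈ opSpectrum (diracOp y c)) ↔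
          z ^ 2 - 1 / 4 ∈ opSpectrum (schrodingerOp y ch)) ∧
        (∀ (z : ℂ) (R Rh : L2 →L[ℂ] L2),
          IsResolventAt (diracOp y c) z R →
          IsResolventAt (schrodingerOp y ch) (z ^ 2 - 1 / 4) Rh →
          ∀ f : L2, ∃ h : Rh f ∈ (diracOp y c).domain,
            R f = diracOp y c ⟨Rh f, h⟩ + z • Rh f) ∧
        (∀ x : ℝ, -1 / 4 ≤ x →
          (((x : ℂ) ∈ discreteSpectrum (schrodingerOp y ch) ∧ x ∈ Set.Ico (-1 / 4 : ℝ) 0) ↔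
            ((Real.sqrt (x + 1 / 4) : ℝ) : ℂ) ∈ discreteSpectrum (diracOp y c) ∨
            ((-Real.sqrt (x + 1 / 4) : ℝ) : ℂ) ∈ discreteSpectrum (diracOp y c)))) := by
  have hyi := hy.injective
  refine ⟨?_, ?_, fun c => ⟨(dirac_spectrum hyi c).1, fun μ => ?_⟩,
    fun ch => ⟨(schrodinger_spectrum hyi ch).1, fun μ => ?_⟩, fun c ch h => ?_⟩
  · rw [freeDirac_eq (zeroCouple _)]
    exact (dirac_spectrum (Function.injective_of_subsingleton _) _).1
  · rw [freeSchrodinger_eq (zeroCouple _)]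
    exact (schrodinger_spectrum (Function.injective_of_subsingleton _) _).1
  · simp only [(dirac_spectrum hyi c).2 μ, mem_diracEss_compl]
  · simp only [(schrodinger_spectrum hyi ch).2 μ, Set.compl_Ici]
  · have hres := fun z : ℂ =>
      mem_opResolventSet_iff_of_opSq_eq (z := z) h (diracOp_isRestriction y hyi c).inner_eq
    have hspec : ∀ z : ℂ, (z ∈ opSpectrum (diracOp y c) ∨ -z ∈ opSpectrum (diracOp y c)) ↔
        z ^ 2 - 1 / 4 ∈ opSpectrum (schrodingerOp y ch) := fun z => by
      simp only [opSpectrum, Set.mem_compl_iff, ← hres z]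
      tauto
    refine ⟨hres, hspec, fun z R Rh hR hRh f => resolvent_eq_of_opSq_eq h hR hRh f,
      fun x hx => ?_⟩
    have hx0 : 0 ≤ x + 1 / 4 := by linarith
    have hs0 := Real.sqrt_nonneg (x + 1 / 4)
    have hsq := Real.sq_sqrt hx0
    set s := √(x + 1 / 4)
    have hz := hspec s
    have e : (s : ℂ) ^ 2 - 1 / 4 = x := by
      rw [← Complex.ofReal_pow, hsq]
      push_cast
      ring
    have hs : s ∉ diracEss ↔ x < 0 := by
      rw [← Set.mem_compl_iff, mem_diracEss_compl]
      constructor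
      · rintro ⟨-, h2⟩
        nlinarith
      · intro h2
        constructor <;> nlinarith
    have hs' : -s ∉ diracEss ↔ x < 0 := by
      rw [← hs, ← Set.mem_compl_iff, ← Set.mem_compl_iff, mem_diracEss_compl, mem_diracEss_compl]
      constructor <;> rintro ⟨h1, h2⟩ <;> constructor <;> linarith
    rw [e, ← Complex.ofReal_neg] at hz
    rw [mem_discreteSpectrum_iff, mem_discreteSpectrum_iff, mem_discreteSpectrum_iff,
      (dirac_spectrum hyi c).1, (schrodinger_spectrum hyi ch).1, ofReal_mem_image, ofReal_mem_image,
      ofReal_mem_image, hs, hs', ← hz, Set.mem_Ici, Set.mem_Ico, not_le]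
    have := hx
    tauto
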